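/- Let $\lambda=0.95$, let $$H(x,y)=\frac{y^2}{2}+\frac{x^4}{4}+\frac{1-\lambda}{3}x^3-\frac{\lambda}{2}x^2 ,$$ and let $\alpha=438.4905$, $\beta=-25.2469$, $\gamma=-452.7899$, $\delta=-741.0341$ (exact decimals). Put $g(x,y)=(\alpha+\beta x+\gamma x^2)y+\delta\frac{y^3}{3}$ and consider the planar system $$\dot x=-y,\qquad \dot y=x^3+(1-\lambda)x^2-\lambda x+\varepsilon\, g(x,y).\tag{$*_\varepsilon$}$$ The level set $H=0$ is a figure eight loop, whose left and right eyes are $\{x<0,\,H<0\}$ and $\{x>0,\,H<0\}$. For an energy $h<0$ above the minimum of $H$ in the respective eye, let $\Gamma^l_h=\{x<0,\ H=h\}$ and $\Gamma^r_h=\{x>0,\ H=h\}$ be the ovals of $H$ in the two eyes. They are periodic orbits of $(*_0)$; let $I^{l}(h)=-\oint_{\Gamma^{l}_h} g\,dx$ and $I^{r}(h)=-\oint_{\Gamma^{r}_h} g\,dx$ be the Abelian integrals, where each oval is traversed once in the direction of the flow of $(*_0)$. Then 1. $I^l(-0.0121)>0$, $I^l(-0.0846)<0$, $I^l(-0.1933)>0$,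 and $I^r(-0.0105)>0$, $I^r(-0.0738)<0$, $I^r(-0.1686)>0$. 2. There is $\varepsilon_0>0$ such that for every $\varepsilon$ with $0<|\varepsilon|<\varepsilon_0$ the system $(*_\varepsilon)$ has at least four limit cycles (isolated closed orbits) $L_1,L_2,R_1,R_2$, two inside each eye, with $$L_1\subset\{x<0,\ -0.1933<H<-0.0846\},\qquad L_2\subset\{x<0,\ -0.0846<H<-0.0121\},$$ $$R_1\subset\{x>0,\ -0.1686<H<-0.0738\},\qquad R_2\subset\{x>0,\ -0.0738<H<-0.0105\}.$$ In each eye one of the two limit cycles is attracting (asymptotically orbitally stable) and the other is repelling (attracting after time reversal): if $\varepsilon>0$, then $L_1,R_1$ are attracting and $L_2,R_2$ are repelling; if $\varepsilon<0$, then $L_1,R_1$ are repelling and $L_2,R_2$ are attracting. -/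

import Mathlib

open Set Filter Topology

namespace FigureEight

noncomputable section

/-- The elliptic Hamiltonian `y²/2 + x⁴/4 + (1-λ)x³/3 - λx²/2`, at the point `p = (x, y)`. -/
def hamiltonian (lam : ℝ) (p : ℝ × ℝ) : ℝ :=
  p.2 ^ 2 / 2 + p.1 ^ 4 / 4 + (1 - lam) / 3 * p.1 ^ 3 - lam / 2 * p.1 ^ 2

/-- The Hamiltonian vector field `(-H_y, H_x)` of `hamiltonian lam`. -/
def hamiltonianField (lam : ℝ) (p : ℝ × ℝ) : ℝ × ℝ :=
  (-p.2, p.1 ^ 3 + (1 - lam) * p.1 ^ 2 - lam * p.1)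

/-- The cubic perturbation `g(x, y) = (α + βx + γx²)y + δy³/3` of the second component. -/
def perturbation (α β γ δ : ℝ) (p : ℝ × ℝ) : ℝ :=
  (α + β * p.1 + γ * p.1 ^ 2) * p.2 + δ * (p.2 ^ 3 / 3)

/-- The perturbed vector field `(-H_y, H_x + ε g)`. -/
def perturbedField (lam α β γ δ ε : ℝ) (p : ℝ × ℝ) : ℝ × ℝ :=
  hamiltonianField lam p + ε • (0, perturbation α β γ δ p)

/-- The oval of energy `h` in the left eye of the figure eight loop `H = 0`. -/
def leftOval (lam h : ℝ) : Set (ℝ × ℝ) := {p | p.1 < 0 ∧ hamiltonian lam p = h}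

/-- The oval of energy `h` in the right eye of the figure eight loop `H = 0`. -/
def rightOval (lam h : ℝ) : Set (ℝ × ℝ) := {p | 0 < p.1 ∧ hamiltonian lam p = h}

/-- The open annulus filled by the ovals of energy in `(a, b)` in the left eye. -/
def leftAnnulus (lam a b : ℝ) : Set (ℝ × ℝ) :=
  {p | p.1 < 0 ∧ a < hamiltonian lam p ∧ hamiltonian lam p < b}

/-- The open annulus filled by the ovals of energy in `(a, b)` in the right eye. -/
def rightAnnulus (lam a b : ℝ) : Set (ℝ × ℝ) :=
  {p | 0 < p.1 ∧ a < hamiltonian lam p ∧ hamiltonian lam p < b}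

/-- `I` is the Abelian integral `∮_Γ f dy - g dx`, where `Γ` is a periodic orbit of the planar
vector field `X` and is traversed exactly once, in the direction of `X`. -/
def IsAbelianIntegral (X : ℝ × ℝ → ℝ × ℝ) (f g : ℝ × ℝ → ℝ) (Γ : Set (ℝ × ℝ)) (I : ℝ) : Prop :=
  ∃ (c : ℝ → ℝ × ℝ) (T : ℝ), 0 < T ∧ IsIntegralCurve c (fun _ => X) ∧
    Function.Periodic c T ∧ InjOn c (Ico 0 T) ∧ range c = Γ ∧
    I = ∫ t in (0 : ℝ)..T,
      (f (c t) * deriv (fun s => (c s).2) t - g (c t) * deriv (fun s => (c s).1) t)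

/-- `Γ` is a closed orbit of `X`: the image of a nonconstant periodic solution. -/
def IsClosedOrbit (X : ℝ × ℝ → ℝ × ℝ) (Γ : Set (ℝ × ℝ)) : Prop :=
  ∃ (c : ℝ → ℝ × ℝ) (T : ℝ), 0 < T ∧ IsIntegralCurve c (fun _ => X) ∧
    Function.Periodic c T ∧ (∃ t, c t ≠ c 0) ∧ range c = Γ

/-- A limit cycle is an isolated closed orbit: no other closed orbit meets some neighbourhood
of it. -/
def IsLimitCycle (X : ℝ × ℝ → ℝ × ℝ) (Γ : Set (ℝ × ℝ)) : Prop :=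
  IsClosedOrbit X Γ ∧ ∃ U : Set (ℝ × ℝ), IsOpen U ∧ Γ ⊆ U ∧
    ∀ Γ' : Set (ℝ × ℝ), IsClosedOrbit X Γ' → (Γ' ∩ U).Nonempty → Γ' = Γ

/-- `Γ` is attracting (asymptotically orbitally stable): solutions that start close enough to `Γ`
exist for all positive times, stay close to `Γ`, and converge to `Γ`. (For a locally Lipschitz
field the solution with a given initial point is unique.) -/
def IsAttracting (X : ℝ × ℝ → ℝ × ℝ) (Γ : Set (ℝ × ℝ)) : Prop :=
  ∀ U : Set (ℝ × ℝ), IsOpen U → Γ ⊆ U →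
    ∃ V : Set (ℝ × ℝ), IsOpen V ∧ Γ ⊆ V ∧ ∀ p ∈ V, ∃ c : ℝ → ℝ × ℝ,
      c 0 = p ∧ IsIntegralCurveOn c (fun _ => X) (Ici 0) ∧ (∀ t, 0 ≤ t → c t ∈ U) ∧
      Tendsto (fun t => Metric.infDist (c t) Γ) atTop (𝓝 0)

/-- `Γ` is repelling: it is attracting for the time-reversed field. -/
def IsRepelling (X : ℝ × ℝ → ℝ × ℝ) (Γ : Set (ℝ × ℝ)) : Prop :=
  IsAttracting (fun p => -X p) Γ

end

end FigureEight

/-! Along the perturbed flow the energy changes only through the perturbation: `dH/dt = ε y g`. In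
polar coordinates about the centre of an eye, orbits near an oval are graphs `r = R(θ)` of a scalar
`2π`-periodic equation, because the angular speed is positive there. Over one turn the energy
changes by `ε` times an integral which is continuous in the starting radius and `ε`, and which for
`ε = 0` is the Abelian integral of the oval (`Well.IsRadial.energy_sub_energy`,
`Well.IsLevel.eventually_integral_energyRate_pos`). If the Abelian integral is positive on one oval
and negative on a larger one, then for small `ε > 0` the return map moves outwards near the first
and inwards near the second, hence has a fixed point between them; for the opposite pair of signs
the same holds for small `ε < 0`.

Only signs on two ovals are used, not simplicity of a zero of the Abelian integral. Isolation and
stability come from analyticity instead. The displacement function is analytic in the starting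
radius, so where it changes sign from `+` to `-` for the last time its zero is isolated
(`exists_isolated_sign_change`). Solutions of a scalar equation keep their order, so the returns of
neighbouring orbits converge monotonically to the fixed point; this gives both the isolated closed
orbit and its attraction (`Well.exists_attracting_limitCycle`). The reflection `y ↦ -y` combined
with time reversal exchanges `ε` and `-ε`, and turns attracting cycles into repelling ones
(`Well.exists_limitCycle`). Analyticity is obtained from the implicit function theorem for the
integral equation in the Banach algebra `C([0, T])`, whose linearization is a Volterra operator.

The signs of the six Abelian integrals are certified by rational arithmetic. Each integral is twice
the integral of `g` over the projection of the upper half of the oval. After `x = m + k cos φ` it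
becomes an integral of a polynomial times a square root; the root is replaced by `sin φ` times a
linear function of `cos φ`, with explicit error bounds, and the remaining trigonometric integrals
are exact (`Well.integral_pert_height_pos`). -/

namespace FigureEight

noncomputable section

/-! ### Scalar linear equations -/

section LinearODE

theorem hasDerivAt_integral {f : ℝ → ℝ} (hf : Continuous f) (a t : ℝ) :
    HasDerivAt (fun u => ∫ x in a..u, f x) (f t) t :=
  (hf.integral_hasStrictDerivAt a t).hasDerivAt

/-- Solutions of a scalar linear homogeneous equation are positive multiples of the initial
value. -/
theorem exists_pos_eq_mul_of_hasDerivAt {v b : ℝ → ℝ} {T : ℝ} (hb : ContinuousOn b (Icc 0 T))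
    (hv : ∀ t ∈ Icc 0 T, HasDerivAt v (b t * v t) t) :
    ∀ t ∈ Icc 0 T, ∃ e > 0, v t = v 0 * e := by
  intro t ht
  have hT : 0 ≤ T := ht.1.trans ht.2
  set b' := IccExtend hT ((Icc 0 T).domRestrict b)
  have hb' : Continuous b' := hb.domRestrict.Icc_extend'
  -- Integrating factor. The coefficient was extended continuously to the line so that its primitive
  -- is differentiable at the endpoints too.
  have key : ∀ t ∈ Icc 0 T,
      HasDerivAt (fun t => v t * Real.exp (-∫ s in (0 : ℝ)..t, b' s)) 0 t := by
    intro t ht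
    refine ((hv t ht).fun_mul (hasDerivAt_integral hb' 0 t).fun_neg.exp).congr_deriv ?_
    have : b' t = b t := IccExtend_of_mem hT _ ht
    rw [this]
    ring
  have h0 := constant_of_has_deriv_right_zero
    (f := fun t => v t * Real.exp (-∫ s in (0 : ℝ)..t, b' s)) (a := 0) (b := T)
    (fun t ht => (key t ht).continuousAt.continuousWithinAt)
    (fun t ht => (key t ⟨ht.1, ht.2.le⟩).hasDerivWithinAt) t ht
  simp only [intervalIntegral.integral_same, neg_zero, Real.exp_zero, mul_one] at h0
  refine ⟨Real.exp (∫ s in (0 : ℝ)..t, b' s), Real.exp_pos _, ?_⟩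
  rw [← h0, mul_assoc, ← Real.exp_add]
  simp

end LinearODE

/-! ### The Volterra operator on continuous functions -/

section Volterra

variable {T : ℝ}

/-- The primitive vanishing at `0`, as an operator on continuous functions on `[0, T]`. -/
def volterra (hT : 0 ≤ T) : C(Icc 0 T, ℝ) →L[ℝ] C(Icc 0 T, ℝ) :=
  LinearMap.mkContinuous
    { toFun := fun f => ⟨fun t => ∫ s in (0 : ℝ)..t, IccExtend hT f s, by
        have : Continuous fun u : ℝ => ∫ s in (0 : ℝ)..u, IccExtend hT f s :=
          intervalIntegral.continuous_primitive
            (fun a b => (f.continuous.Icc_extend' (h := hT)).intervalIntegrable a b) 0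
        exact this.comp continuous_subtype_val⟩
      map_add' := fun f g => by
        ext t
        simp only [ContinuousMap.coe_mk, ContinuousMap.add_apply]
        rw [← intervalIntegral.integral_add
          ((f.continuous.Icc_extend' (h := hT)).intervalIntegrable _ _)
          ((g.continuous.Icc_extend' (h := hT)).intervalIntegrable _ _)]
        rfl
      map_smul' := fun c f => by
        ext t
        simp only [ContinuousMap.coe_mk, ContinuousMap.smul_apply, RingHom.id_apply]
        rw [← intervalIntegral.integral_smul]
        rfl } T (fun f => by
      rw [ContinuousMap.norm_le _ (by positivity)]
      intro t
      have h : ‖∫ s in (0 : ℝ)..t, IccExtend hT f s‖ ≤ ‖f‖ * |(t : ℝ) - 0| :=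
        intervalIntegral.norm_integral_le_of_norm_le_const
          (fun s _ => f.norm_coe_le_norm (projIcc 0 T hT s))
      rw [sub_zero, abs_of_nonneg t.2.1, mul_comm] at h
      exact h.trans (mul_le_mul_of_nonneg_right t.2.2 (norm_nonneg _)))

theorem volterra_apply (hT : 0 ≤ T) (f : C(Icc 0 T, ℝ)) (t : Icc 0 T) :
    volterra hT f t = ∫ s in (0 : ℝ)..t, IccExtend hT f s := rfl

/-- A kernel element equals the primitive of `a v`, so it solves `v' = a v` with `v(0) = 0`. -/
theorem volterra_injective_aux (hT : 0 ≤ T) (a v : C(Icc 0 T, ℝ))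
    (hv : v - volterra hT (a * v) = 0) : v = 0 := by
  obtain ⟨m, hm⟩ : ∃ m, m = a * v := ⟨_, rfl⟩
  rw [← hm] at hv
  have hc : Continuous (IccExtend hT m) := m.continuous.Icc_extend'
  have hvt : ∀ t (ht : t ∈ Icc 0 T), v ⟨t, ht⟩ = ∫ s in (0 : ℝ)..t, IccExtend hT m s := by
    intro t ht
    have := congrArg (fun f : C(Icc 0 T, ℝ) => f ⟨t, ht⟩) hv
    simp only [ContinuousMap.sub_apply, ContinuousMap.zero_apply, sub_eq_zero] at this
    rw [this, volterra_apply]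
  have h := exists_pos_eq_mul_of_hasDerivAt (v := fun t => ∫ s in (0 : ℝ)..t, IccExtend hT m s)
    (b := IccExtend hT a) (T := T) a.continuous.Icc_extend'.continuousOn (fun t ht => by
      convert hasDerivAt_integral hc 0 t using 1
      rw [← hvt t ht, IccExtend_of_mem _ _ ht, IccExtend_of_mem _ _ ht, hm]
      rfl)
  ext ⟨t, ht⟩
  obtain ⟨e, -, he⟩ := h t ht
  rw [hvt t ht, he]
  simp

/-- Variation of constants: `v = w + G` with `G' = a (w + G)`, `G(0) = 0`. Working with `G` avoids
differentiating `w`, which is only continuous. -/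
theorem volterra_surjective_aux (hT : 0 ≤ T) (a w : C(Icc 0 T, ℝ)) :
    ∃ v, v - volterra hT (a * v) = w := by
  have ha : Continuous (IccExtend hT a) := a.continuous.Icc_extend'
  have hw : Continuous (IccExtend hT w) := w.continuous.Icc_extend'
  set A : ℝ → ℝ := fun t => ∫ s in (0 : ℝ)..t, IccExtend hT a s with hA
  have hAd : ∀ t, HasDerivAt A (IccExtend hT a t) t := hasDerivAt_integral ha 0
  have hAc : Continuous A := continuous_iff_continuousAt.2 fun t => (hAd t).continuousAt
  have hgc : Continuous fun s => Real.exp (-A s) * IccExtend hT a s * IccExtend hT w s := by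
    fun_prop
  set G : ℝ → ℝ := fun t => Real.exp (A t) *
    ∫ s in (0 : ℝ)..t, Real.exp (-A s) * IccExtend hT a s * IccExtend hT w s with hG
  have hGd : ∀ t, HasDerivAt G (IccExtend hT a t * (IccExtend hT w t + G t)) t := by
    intro t
    refine ((hAd t).exp.fun_mul (hasDerivAt_integral hgc 0 t)).congr_deriv ?_
    have : Real.exp (A t) * Real.exp (-A t) = 1 := by rw [← Real.exp_add]; simp
    simp only [hG]
    linear_combination ((IccExtend hT a t * IccExtend hT w t)) * this
  have hGc : Continuous G := continuous_iff_continuousAt.2 fun t => (hGd t).continuousAt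
  refine ⟨w + ⟨fun t => G t, hGc.comp continuous_subtype_val⟩, ?_⟩
  ext t
  rw [ContinuousMap.sub_apply, volterra_apply]
  have : ∫ s in (0 : ℝ)..t, IccExtend hT
      (a * (w + ⟨fun t : Icc 0 T => G t, hGc.comp continuous_subtype_val⟩) : C(Icc 0 T, ℝ)) s =
      ∫ s in (0 : ℝ)..t, IccExtend hT a s * (IccExtend hT w s + G s) := by
    apply intervalIntegral.integral_congr
    intro s hs
    rw [uIcc_of_le t.2.1] at hs
    have hs' : s ∈ Icc 0 T := ⟨hs.1, hs.2.trans t.2.2⟩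
    simp only
    rw [IccExtend_of_mem _ _ hs', IccExtend_of_mem _ _ hs', IccExtend_of_mem _ _ hs']
    rfl
  rw [this, intervalIntegral.integral_eq_sub_of_hasDerivAt (fun s _ => hGd s)
    (Continuous.intervalIntegrable (by fun_prop) _ _)]
  simp [hG]

theorem isInvertible_id_sub_volterra_mul (hT : 0 ≤ T) (a : C(Icc 0 T, ℝ)) :
    (ContinuousLinearMap.id ℝ C(Icc 0 T, ℝ) -
      volterra hT ∘L ContinuousLinearMap.mul ℝ C(Icc 0 T, ℝ) a).IsInvertible := by
  refine ⟨ContinuousLinearEquiv.ofBijective (ContinuousLinearMap.id ℝ C(Icc 0 T, ℝ) -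
      volterra hT ∘L ContinuousLinearMap.mul ℝ C(Icc 0 T, ℝ) a) ?_ ?_, ?_⟩
  · rw [LinearMap.ker_eq_bot']
    intro v hv
    exact volterra_injective_aux hT a v hv
  · rw [LinearMap.range_eq_top]
    intro w
    exact volterra_surjective_aux hT a w
  · ext; rfl

end Volterra

/-! ### Analytic dependence on initial value and parameter -/

section ImplicitODE

variable {T : ℝ}

open scoped ContDiff

/-- The derivative of a superposition operator is a multiplication operator. -/
theorem superposition_fderiv_apply {F : C(Icc 0 T, ℝ) → C(Icc 0 T, ℝ)} {f : Icc 0 T → ℝ → ℝ}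
    {r : C(Icc 0 T, ℝ)} {L : C(Icc 0 T, ℝ) →L[ℝ] C(Icc 0 T, ℝ)} (hL : HasFDerivAt F L r)
    (hF : ∀ᶠ s in 𝓝 r, ∀ t, F s t = f t (s t)) (v : C(Icc 0 T, ℝ)) : L v = L 1 * v := by
  -- `L v t` is the derivative at `0` of `s ↦ f t (r t + s * v t)`, which involves only the value of
  -- `v` at `t`. The direction `1` gives the partial derivative of `f t`, and the chain rule gives
  -- every other direction.
  ext t
  have hder : ∀ v, HasDerivAt (fun s : ℝ => f t (r t + s * v t)) (L v t) 0 := by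
    intro v
    have hline : HasDerivAt (fun s : ℝ => r + s • v) v 0 := by
      simpa using ((hasDerivAt_id (0 : ℝ)).smul_const v).const_add r
    have h1 : HasDerivAt (fun s : ℝ => F (r + s • v)) (L v) 0 := by
      have : HasFDerivAt F L (r + (0 : ℝ) • v) := by simpa using hL
      exact this.comp_hasDerivAt 0 hline
    have h2 := (ContinuousMap.evalCLM ℝ t : C(Icc 0 T, ℝ) →L[ℝ] ℝ).hasFDerivAt.comp_hasDerivAt 0 h1
    refine h2.congr_of_eventuallyEq ?_
    have htend : Tendsto (fun s : ℝ => r + s • v) (𝓝 0) (𝓝 r) := by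
      have := hline.continuousAt.tendsto
      simpa using this
    filter_upwards [htend.eventually hF] with s hs
    simp [hs t]
  have h1 := hder 1
  simp only [ContinuousMap.one_apply, mul_one] at h1
  have h3 : HasDerivAt (fun s : ℝ => f t (r t + s * v t)) (L 1 t * v t) 0 := by
    have hs : HasDerivAt (fun s : ℝ => s * v t) (v t) 0 := by
      simpa using (hasDerivAt_id (0 : ℝ)).mul_const (v t)
    have h1' : HasDerivAt (fun s : ℝ => f t (r t + s)) (L 1 t) ((fun s : ℝ => s * v t) 0) := by
      simpa using h1
    exact HasDerivAt.comp (h₂ := fun u => f t (r t + u)) (h := fun s : ℝ => s * v t) 0 h1' hs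
  simpa using (hder v).unique h3

/-- Analytic dependence of the solution of `r' = f(ε, r)`, `r(0) = x` on `(x, ε)`. -/
theorem exists_analyticAt_solution (hT : 0 ≤ T)
    {F : ℝ × C(Icc 0 T, ℝ) → C(Icc 0 T, ℝ)} {f : Icc 0 T → ℝ → ℝ} {x₀ ε₀ : ℝ} {r₀ : C(Icc 0 T, ℝ)}
    (hF : ContDiffAt ℝ ω F (ε₀, r₀)) (hf : ∀ᶠ s in 𝓝 r₀, ∀ t, F (ε₀, s) t = f t (s t))
    (h₀ : r₀ = algebraMap ℝ _ x₀ + volterra hT (F (ε₀, r₀))) :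
    ∃ ψ : ℝ × ℝ → C(Icc 0 T, ℝ), AnalyticAt ℝ ψ (x₀, ε₀) ∧ ψ (x₀, ε₀) = r₀ ∧
      ∀ᶠ z in 𝓝 (x₀, ε₀), ψ z = algebraMap ℝ _ z.1 + volterra hT (F (z.2, ψ z)) := by
  set Φ : (ℝ × ℝ) × C(Icc 0 T, ℝ) → C(Icc 0 T, ℝ) :=
    fun z => z.2 - algebraMap ℝ C(Icc 0 T, ℝ) z.1.1 - volterra hT (F (z.1.2, z.2)) with hΦ
  have hcd : ContDiffAt ℝ ω Φ ((x₀, ε₀), r₀) := by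
    have h1 : ContDiffAt ℝ ω (fun z : (ℝ × ℝ) × C(Icc 0 T, ℝ) => F (z.1.2, z.2)) ((x₀, ε₀), r₀) :=
      ContDiffAt.comp ((x₀, ε₀), r₀) (g := F)
        (f := fun z : (ℝ × ℝ) × C(Icc 0 T, ℝ) => (z.1.2, z.2)) hF (by fun_prop)
    have h2 : ContDiff ℝ ω (fun z : (ℝ × ℝ) × C(Icc 0 T, ℝ) =>
        algebraMap ℝ C(Icc 0 T, ℝ) z.1.1) := by
      simp only [Algebra.algebraMap_eq_smul_one]
      fun_prop
    exact (contDiffAt_snd.sub h2.contDiffAt).sub ((volterra hT).contDiff.contDiffAt.comp _ h1)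
  have hFd : HasFDerivAt (fun s => F (ε₀, s))
      (fderiv ℝ F (ε₀, r₀) ∘L .inr ℝ ℝ C(Icc 0 T, ℝ)) r₀ :=
    ((hF.differentiableAt (by simp)).hasFDerivAt).comp r₀ (hasFDerivAt_prodMk_right ε₀ r₀)
  set L := fderiv ℝ F (ε₀, r₀) ∘L .inr ℝ ℝ C(Icc 0 T, ℝ)
  -- The partial derivative in the unknown function is the identity minus Volterra after
  -- multiplication, so it is invertible and the implicit function theorem applies.
  have hpart : fderiv ℝ Φ ((x₀, ε₀), r₀) ∘L .inr ℝ (ℝ × ℝ) C(Icc 0 T, ℝ) =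
      ContinuousLinearMap.id ℝ C(Icc 0 T, ℝ) -
      volterra hT ∘L ContinuousLinearMap.mul ℝ C(Icc 0 T, ℝ) (L 1) := by
    have h1 : HasFDerivAt (fun s => Φ ((x₀, ε₀), s))
        (fderiv ℝ Φ ((x₀, ε₀), r₀) ∘L .inr ℝ (ℝ × ℝ) C(Icc 0 T, ℝ)) r₀ :=
      ((hcd.differentiableAt (by simp)).hasFDerivAt).comp r₀
        (hasFDerivAt_prodMk_right (x₀, ε₀) r₀)
    have h2 : HasFDerivAt (fun s => Φ ((x₀, ε₀), s))
        (ContinuousLinearMap.id ℝ C(Icc 0 T, ℝ) - volterra hT ∘L L) r₀ :=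
      ((hasFDerivAt_id r₀).sub_const (algebraMap ℝ C(Icc 0 T, ℝ) x₀)).sub
        ((volterra hT).hasFDerivAt.comp r₀ hFd)
    rw [h1.unique h2]
    congr 2
    ext1 v
    exact superposition_fderiv_apply hFd hf v
  have hinv : (fderiv ℝ Φ ((x₀, ε₀), r₀) ∘L .inr ℝ (ℝ × ℝ) C(Icc 0 T, ℝ)).IsInvertible := by
    rw [hpart]
    exact isInvertible_id_sub_volterra_mul hT _
  have hne : (ω : WithTop ℕ∞) ≠ 0 := by simp
  have hz : Φ ((x₀, ε₀), r₀) = 0 := by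
    simp only [hΦ]
    rw [sub_sub, ← h₀, sub_self]
  refine ⟨hcd.implicitFunction hne hinv,
    (hcd.contDiffAt_implicitFunction hne hinv).analyticAt,
    hcd.implicitFunction_apply_self hne hinv, ?_⟩
  have hev : ∀ᶠ z in 𝓝 (x₀, ε₀), Φ (z, hcd.implicitFunction hne hinv z) = Φ ((x₀, ε₀), r₀) :=
    hcd.eventually_apply_implicitFunction hne hinv
  filter_upwards [hev] with z hz'
  rw [hz] at hz'
  generalize hcd.implicitFunction hne hinv z = s at hz' ⊢
  simp only [hΦ, sub_sub] at hz'
  exact sub_eq_zero.1 hz'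

end ImplicitODE

/-! ### Reparametrization by the angle -/

section TimeChange

/-- The time change with speed `1 / κ`. -/
theorem exists_timeChange {κ : ℝ → ℝ} (hκ : Continuous κ) {m : ℝ} (hm : 0 < m)
    (hmκ : ∀ s, m ≤ κ s) (s₀ : ℝ) :
    ∃ τ : ℝ ≃o ℝ, τ 0 = s₀ ∧ ∀ t, HasDerivAt τ (κ (τ t))⁻¹ t := by
  set K : ℝ → ℝ := fun s => ∫ u in s₀..s, κ u with hK
  have hKd : ∀ s, HasDerivAt K (κ s) s := hasDerivAt_integral hκ s₀
  have hKc : Continuous K := continuous_iff_continuousAt.2 fun s => (hKd s).continuousAt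
  have hKm : StrictMono K := strictMono_of_deriv_pos fun s => by
    rw [(hKd s).deriv]; exact hm.trans_le (hmκ s)
  -- The lower bound on `κ` makes `K` grow at least linearly, hence `K` is onto and its inverse is
  -- defined for all times.
  have hlin : Monotone fun s => K s - m * s := by
    apply monotone_of_deriv_nonneg
    · intro s
      exact ((hKd s).fun_sub ((hasDerivAt_id s).const_mul m)).differentiableAt
    · intro s
      have h : HasDerivAt (fun s => K s - m * s) (κ s - m * 1) s :=
        (hKd s).fun_sub ((hasDerivAt_id s).const_mul m)
      rw [h.deriv]
      linarith [hmκ s]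
  have htop : Tendsto K atTop atTop := by
    have h1 : Tendsto (fun s => m * s + (K s₀ - m * s₀)) atTop atTop :=
      tendsto_atTop_add_const_right _ _ (tendsto_id.const_mul_atTop hm)
    refine tendsto_atTop_mono' _ ?_ h1
    filter_upwards [eventually_ge_atTop s₀] with s hs
    have := hlin hs
    simp only at this
    linarith
  have hbot : Tendsto K atBot atBot := by
    have h1 : Tendsto (fun s => m * s + (K s₀ - m * s₀)) atBot atBot :=
      tendsto_atBot_add_const_right _ _ (tendsto_id.const_mul_atBot hm)
    refine tendsto_atBot_mono' _ ?_ h1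
    filter_upwards [eventually_le_atBot s₀] with s hs
    have := hlin hs
    simp only at this
    linarith
  have hsurj : Function.Surjective K := hKc.surjective htop hbot
  set e := hKm.orderIsoOfSurjective K hsurj
  have he : ∀ s, e s = K s := fun s => rfl
  refine ⟨e.symm, ?_, fun t => ?_⟩
  · rw [OrderIso.symm_apply_eq, he]
    simp [hK]
  · refine HasDerivAt.of_local_left_inverse (f := K) e.symm.continuous.continuousAt (hKd _)
      (hm.trans_le (hmκ _)).ne' (Eventually.of_forall fun y => ?_)
    rw [← he, e.apply_symm_apply]

end TimeChange

/-! ### Uniqueness of integral curves -/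

section Uniqueness

variable {E : Type*} [NormedAddCommGroup E] [NormedSpace ℝ E] {X : E → E}

/-- The one-sided version serves orbits that are only known to stay near the cycle in forward time.
The Lipschitz constant is taken on the compact union of the two arcs. -/
theorem eqOn_Ici_of_isIntegralCurveOn (hX : ContDiff ℝ 1 X) {c₁ c₂ : ℝ → E}
    (h₁ : IsIntegralCurveOn c₁ (fun _ => X) (Ici 0))
    (h₂ : IsIntegralCurveOn c₂ (fun _ => X) (Ici 0)) (h : c₁ 0 = c₂ 0) : EqOn c₁ c₂ (Ici 0) := by
  intro T hT
  have hc₁ : ContinuousOn c₁ (Icc 0 T) := h₁.continuousOn.mono Icc_subset_Ici_self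
  have hc₂ : ContinuousOn c₂ (Icc 0 T) := h₂.continuousOn.mono Icc_subset_Ici_self
  obtain ⟨K, hK⟩ := LocallyLipschitzOn.exists_lipschitzOnWith_of_compact
    ((isCompact_Icc.image_of_continuousOn hc₁).union (isCompact_Icc.image_of_continuousOn hc₂))
    hX.locallyLipschitz.locallyLipschitzOn
  exact ODE_solution_unique_of_mem_Icc_right (v := fun _ => X) (fun t _ => hK) hc₁
    (fun t ht => (h₁ t ht.1).mono (Ici_subset_Ici.2 ht.1))
    (fun t ht => Or.inl (mem_image_of_mem _ ⟨ht.1, ht.2.le⟩)) hc₂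
    (fun t ht => (h₂ t ht.1).mono (Ici_subset_Ici.2 ht.1))
    (fun t ht => Or.inr (mem_image_of_mem _ ⟨ht.1, ht.2.le⟩)) h ⟨hT, le_rfl⟩

theorem eq_of_isIntegralCurve (hX : ContDiff ℝ 1 X) {c₁ c₂ : ℝ → E}
    (h₁ : IsIntegralCurve c₁ (fun _ => X)) (h₂ : IsIntegralCurve c₂ (fun _ => X))
    (h : c₁ 0 = c₂ 0) : c₁ = c₂ := by
  ext t
  have hc₁ := h₁.continuous
  have hc₂ := h₂.continuous
  set T := |t| + 1
  obtain ⟨K, hK⟩ := LocallyLipschitzOn.exists_lipschitzOnWith_of_compact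
    (((isCompact_Icc (a := -T) (b := T)).image hc₁).union (isCompact_Icc.image hc₂))
    hX.locallyLipschitz.locallyLipschitzOn
  have hT : 0 < T := by positivity
  exact ODE_solution_unique_of_mem_Icc (v := fun _ => X) (a := -T) (b := T) (t₀ := 0)
    (fun t _ => hK) ⟨by linarith, hT⟩ hc₁.continuousOn (fun t _ => h₁ t)
    (fun t ht => Or.inl (mem_image_of_mem _ (Ioo_subset_Icc_self ht))) hc₂.continuousOn
    (fun t _ => h₂ t) (fun t ht => Or.inr (mem_image_of_mem _ (Ioo_subset_Icc_self ht))) h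
    ⟨by linarith [neg_abs_le t], by linarith [le_abs_self t]⟩

/-- An integral curve that returns to its starting point is periodic. -/
theorem periodic_of_isIntegralCurve (hX : ContDiff ℝ 1 X) {c : ℝ → E}
    (hc : IsIntegralCurve c (fun _ => X)) {T : ℝ} (h : c T = c 0) : Function.Periodic c T := by
  intro t
  have h1 : IsIntegralCurve (fun t => c (t + T)) (fun _ => X) := fun t => by
    simpa using (hc (t + T)).comp_add_const t T
  exact congrFun (eq_of_isIntegralCurve hX h1 hc (by simpa using h)) t

end Uniqueness

/-! ### Isolated sign changes and polar coordinates -/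

/-- A function with `d a > 0 > d b`, analytic inside, has a zero at which it changes its sign from
`+` to `-` and which is isolated. -/
theorem exists_isolated_sign_change {d : ℝ → ℝ} {a b : ℝ} (hab : a ≤ b)
    (hd : ContinuousOn d (Icc a b)) (han : ∀ x ∈ Ioo a b, AnalyticAt ℝ d x)
    (ha : 0 < d a) (hb : d b < 0) :
    ∃ x ∈ Ioo a b, d x = 0 ∧ ∃ η > 0, Ioo (x - η) (x + η) ⊆ Ioo a b ∧
      (∀ y ∈ Ioo (x - η) x, 0 < d y) ∧ ∀ y ∈ Ioo x (x + η), d y < 0 := by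
  -- The zero is the supremum of the positivity set: `d ≤ 0` to its right, while positive values
  -- accumulate at it from the left.
  set S := {y | y ∈ Icc a b ∧ 0 < d y} with hS
  have haS : a ∈ S := ⟨⟨le_rfl, hab⟩, ha⟩
  have hbdd : BddAbove S := ⟨b, fun y hy => hy.1.2⟩
  set x := sSup S with hx
  have hax : a ≤ x := le_csSup hbdd haS
  have hxb : x ≤ b := csSup_le ⟨a, haS⟩ fun y hy => hy.1.2
  have hright : ∀ y ∈ Ioc x b, d y ≤ 0 := by
    intro y hy
    by_contra hlt
    exact absurd (le_csSup hbdd (show y ∈ S from ⟨⟨hax.trans hy.1.le, hy.2⟩, not_le.1 hlt⟩))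
      (not_le.2 hy.1)
  have hcl : x ∈ closure S := csSup_mem_closure ⟨a, haS⟩ hbdd
  have hge : 0 ≤ d x := by
    have h1 : ContinuousWithinAt d S x := (hd x ⟨hax, hxb⟩).mono fun y hy => hy.1
    have h2 := h1.mem_closure_image hcl
    have h3 : closure (d '' S) ⊆ Ici 0 :=
      closure_minimal (by rintro _ ⟨y, hy, rfl⟩; exact hy.2.le) isClosed_Ici
    exact h3 h2
  have hxb' : x < b := lt_of_le_of_ne hxb fun h => by rw [h] at hge; linarith
  have hle : d x ≤ 0 := by
    have h1 : ContinuousWithinAt d (Ioc x b) x :=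
      (hd x ⟨hax, hxb⟩).mono fun y hy => ⟨hax.trans hy.1.le, hy.2⟩
    have h2 := h1.mem_closure_image (by rw [closure_Ioc hxb'.ne]; exact ⟨le_rfl, hxb⟩)
    have h3 : closure (d '' Ioc x b) ⊆ Iic 0 :=
      closure_minimal (by rintro _ ⟨y, hy, rfl⟩; exact hright y hy) isClosed_Iic
    exact h3 h2
  have hzero : d x = 0 := le_antisymm hle hge
  have hax' : a < x := lt_of_le_of_ne hax fun h => by rw [← h] at hzero; linarith
  have hxS : x ∉ S := fun h => by have := h.2; linarith
  have hfreq : ∀ η > 0, ∃ y ∈ S, x - η < y ∧ y < x := by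
    intro η hη
    obtain ⟨y, hy, hlt⟩ := exists_lt_of_lt_csSup ⟨a, haS⟩ (show x - η < sSup S by linarith)
    exact ⟨y, hy, hlt, lt_of_le_of_ne (le_csSup hbdd hy) fun h => hxS (h ▸ hy)⟩
  rcases (han x ⟨hax', hxb'⟩).eventually_eq_zero_or_eventually_ne_zero with h | h
  -- `d` cannot vanish near `x`, since points of `S` lie arbitrarily close to it.
  · obtain ⟨η, hη, hball⟩ := Metric.eventually_nhds_iff.1 h
    obtain ⟨y, hy, h1, h2⟩ := hfreq η hη
    have := hball (show dist y x < η by rw [Real.dist_eq, abs_lt]; constructor <;> linarith)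
    exact absurd hy.2 (by simp [this])
  · rw [eventually_nhdsWithin_iff] at h
    obtain ⟨η₁, hη₁, hball⟩ := Metric.eventually_nhds_iff.1 h
    set η := min η₁ (min (x - a) (b - x)) with hηdef
    have hη : 0 < η := lt_min hη₁ (lt_min (by linarith) (by linarith))
    have e1 : η ≤ η₁ := min_le_left _ _
    have e2 : η ≤ x - a := (min_le_right _ _).trans (min_le_left _ _)
    have e3 : η ≤ b - x := (min_le_right _ _).trans (min_le_right _ _)
    have hne : ∀ y ∈ Ioo (x - η) (x + η), y ≠ x → d y ≠ 0 := fun y hy hyx =>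
      hball (show dist y x < η₁ by
        rw [Real.dist_eq, abs_lt]; constructor <;> linarith [hy.1, hy.2]) hyx
    refine ⟨x, ⟨hax', hxb'⟩, hzero, η, hη, fun y hy => ⟨by linarith [hy.1], by linarith [hy.2]⟩,
      fun y hy => ?_, fun y hy => ?_⟩
    -- A value `≤ 0` left of `x`, followed by a point of `S` still closer to `x`, would force a zero
    -- in the punctured neighbourhood.
    · by_contra hneg
      obtain ⟨z, hz, hz1, hz2⟩ := hfreq (x - y) (by linarith [hy.2])
      have hyz : y ≤ z := by linarith
      have hcont : ContinuousOn d (Icc y z) :=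
        hd.mono fun w hw => ⟨by linarith [hw.1, hy.1], by linarith [hw.2]⟩
      obtain ⟨w, hw, hw0⟩ := intermediate_value_Icc hyz hcont ⟨not_lt.1 hneg, hz.2.le⟩
      exact hne w ⟨by linarith [hw.1, hy.1], by linarith [hw.2]⟩ (by linarith [hw.2] : w < x).ne hw0
    · exact lt_of_le_of_ne (hright y ⟨hy.1, by linarith [hy.2]⟩)
        (hne y ⟨by linarith [hy.1], hy.2⟩ hy.1.ne')

/-- Polar coordinates `(θ, r)` centred at `(c, 0)`. -/
def polarMap (c : ℝ) (z : ℝ × ℝ) : ℝ × ℝ := (c + z.2 * Real.cos z.1, z.2 * Real.sin z.1)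

theorem continuous_polarMap (c : ℝ) : Continuous (polarMap c) := by
  unfold polarMap
  fun_prop

/-- In the coordinates `(log r, θ)` the polar map is the complex exponential up to translation, and
that is an open map. -/
theorem isOpen_image_polarMap (c : ℝ) {O : Set (ℝ × ℝ)} (hO : IsOpen O) (hpos : ∀ z ∈ O, 0 < z.2) :
    IsOpen (polarMap c '' O) := by
  set O' : Set ℂ := {w | (w.im, Real.exp w.re) ∈ O}
  have hO' : IsOpen O' := hO.preimage
    (Complex.continuous_im.prodMk (Real.continuous_exp.comp Complex.continuous_re))
  have h1 : IsOpen (Complex.exp '' O') := Complex.isOpenMap_exp _ hO'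
  have h2 : IsOpen ((fun p : ℝ × ℝ => (⟨p.1 - c, p.2⟩ : ℂ)) ⁻¹' (Complex.exp '' O')) := by
    refine h1.preimage ?_
    have : (fun p : ℝ × ℝ => (⟨p.1 - c, p.2⟩ : ℂ)) =
        fun p : ℝ × ℝ => Complex.equivRealProdCLM.symm (p.1 - c, p.2) := by
      funext p
      apply Complex.ext <;> simp
    rw [this]
    fun_prop
  convert h2 using 1
  ext p
  simp only [mem_image, mem_preimage, O', mem_ofPred_eq]
  constructor
  · rintro ⟨z, hz, rfl⟩
    refine ⟨⟨Real.log z.2, z.1⟩, ?_, ?_⟩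
    · simpa [Real.exp_log (hpos z hz)] using hz
    · apply Complex.ext
      · simp [Complex.exp_re, Real.exp_log (hpos z hz), polarMap]
      · simp [Complex.exp_im, Real.exp_log (hpos z hz), polarMap]
  · rintro ⟨w, hw, h⟩
    refine ⟨_, hw, ?_⟩
    have hre := congrArg Complex.re h
    have him := congrArg Complex.im h
    simp only [Complex.exp_re, Complex.exp_im] at hre him
    ext
    · simp [polarMap, hre]
    · simp [polarMap, him]

/-! ### The well in polar coordinates -/

/-- The data of a perturbed quartic potential well with centre `(c, 0)`: with `u = x - c`, the
field is `(-y, u (k₀ + k₁ u + u²) + ε y (a₀ + a₁ u + a₂ u² + a₃ y²))`. -/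
structure Well where
  (c k₀ k₁ a₀ a₁ a₂ a₃ : ℝ)

namespace Well

variable (w : Well)

/-- The force of the potential at `c + u`, divided by `u`. -/
def stiffness (u : ℝ) : ℝ := w.k₀ + w.k₁ * u + u ^ 2

/-- The perturbation of the second component. -/
def pert (p : ℝ × ℝ) : ℝ :=
  p.2 * (w.a₀ + w.a₁ * (p.1 - w.c) + w.a₂ * (p.1 - w.c) ^ 2 + w.a₃ * p.2 ^ 2)

/-- The perturbed vector field. -/
def field (ε : ℝ) (p : ℝ × ℝ) : ℝ × ℝ :=
  (-p.2, (p.1 - w.c) * w.stiffness (p.1 - w.c) + ε * w.pert p)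

/-- The Hamiltonian of the unperturbed field, normalized to vanish at the centre. -/
def energy (p : ℝ × ℝ) : ℝ :=
  p.2 ^ 2 / 2 + w.k₀ / 2 * (p.1 - w.c) ^ 2 + w.k₁ / 3 * (p.1 - w.c) ^ 3 + (p.1 - w.c) ^ 4 / 4

/-- The second component of the field divided by the radius, in polar coordinates. -/
def force (ε θ r : ℝ) : ℝ :=
  Real.cos θ * w.stiffness (r * Real.cos θ) + ε * (Real.sin θ * (w.a₀ + w.a₁ * (r * Real.cos θ) +
    w.a₂ * (r * Real.cos θ) ^ 2 + w.a₃ * (r * Real.sin θ) ^ 2))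

/-- The angular speed of the field in polar coordinates. -/
def angSpeed (ε θ r : ℝ) : ℝ := Real.cos θ * w.force ε θ r + Real.sin θ ^ 2

/-- The radial equation `dr/dθ = radialField ε θ r` satisfied by the orbits. -/
def radialField (ε θ r : ℝ) : ℝ :=
  r * Real.sin θ * (w.force ε θ r - Real.cos θ) / w.angSpeed ε θ r

/-- `R` is a solution of the radial equation on `[0, T]` that starts at `x`. -/
structure IsRadial (T ε x : ℝ) (R : ℝ → ℝ) : Prop where
  init : R 0 = x
  pos : ∀ θ ∈ Icc 0 T, 0 < R θ
  angPos : ∀ θ ∈ Icc 0 T, 0 < w.angSpeed ε θ (R θ)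
  deriv : ∀ θ ∈ Icc 0 T, HasDerivAt R (w.radialField ε θ (R θ)) θ

theorem contDiff_field (ε : ℝ) : ContDiff ℝ 1 (w.field ε) := by
  unfold field pert stiffness
  fun_prop

theorem continuous_energy : Continuous w.energy := by
  unfold energy
  fun_prop

theorem continuous_force : Continuous fun z : ℝ × ℝ × ℝ => w.force z.1 z.2.1 z.2.2 := by
  unfold force stiffness
  fun_prop

theorem continuousOn_force {ε : ℝ} {R : ℝ → ℝ} {S : Set ℝ} (hR : ContinuousOn R S) :
    ContinuousOn (fun θ => w.force ε θ (R θ)) S := by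
  unfold force stiffness
  fun_prop

theorem continuous_angSpeed : Continuous fun z : ℝ × ℝ × ℝ => w.angSpeed z.1 z.2.1 z.2.2 := by
  have := w.continuous_force
  unfold angSpeed
  fun_prop

theorem angSpeed_add_two_pi (ε θ r : ℝ) : w.angSpeed ε (θ + 2 * Real.pi) r = w.angSpeed ε θ r := by
  simp [angSpeed, force]

theorem radialField_add_two_pi (ε θ r : ℝ) :
    w.radialField ε (θ + 2 * Real.pi) r = w.radialField ε θ r := by
  simp [radialField, force, angSpeed]

theorem polarMap_add_two_pi (c θ r : ℝ) : polarMap c (θ + 2 * Real.pi, r) = polarMap c (θ, r) := by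
  simp [polarMap]

/-- Divided difference of `force` in the radius. -/
def forceSlope (ε θ r s : ℝ) : ℝ :=
  Real.cos θ * (w.k₁ * Real.cos θ + Real.cos θ ^ 2 * (r + s)) +
    ε * (Real.sin θ * (w.a₁ * Real.cos θ + w.a₂ * (Real.cos θ ^ 2 * (r + s)) +
      w.a₃ * (Real.sin θ ^ 2 * (r + s))))

theorem force_sub_force (ε θ r s : ℝ) :
    w.force ε θ r - w.force ε θ s = (r - s) * w.forceSlope ε θ r s := by
  simp only [force, forceSlope, stiffness]
  ring

/-- Divided difference of `radialField` in the radius. -/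
def radialSlope (ε θ r s : ℝ) : ℝ :=
  (Real.sin θ * ((w.force ε θ r - Real.cos θ) + s * w.forceSlope ε θ r s) * w.angSpeed ε θ s -
    s * Real.sin θ * (w.force ε θ s - Real.cos θ) * (Real.cos θ * w.forceSlope ε θ r s)) /
    (w.angSpeed ε θ r * w.angSpeed ε θ s)

/-- Makes the difference of two radial solutions satisfy a linear homogeneous equation with
continuous coefficient, so that its sign persists. -/
theorem radialField_sub_radialField {ε θ r s : ℝ} (hr : 0 < w.angSpeed ε θ r)
    (hs : 0 < w.angSpeed ε θ s) :
    w.radialField ε θ r - w.radialField ε θ s = w.radialSlope ε θ r s * (r - s) := by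
  have h := w.force_sub_force ε θ r s
  have hD : w.angSpeed ε θ r - w.angSpeed ε θ s =
      Real.cos θ * ((r - s) * w.forceSlope ε θ r s) := by
    rw [← h]; simp only [angSpeed]; ring
  unfold radialField radialSlope
  rw [div_sub_div _ _ hr.ne' hs.ne', div_mul_eq_mul_div]
  congr 1
  linear_combination (Real.sin θ * s * w.angSpeed ε θ s) * h -
    s * Real.sin θ * (w.force ε θ s - Real.cos θ) * hD

/-- The curve of a solution of the radial equation is tangent to the field. -/
theorem hasDerivAt_polarMap {ε θ : ℝ} {R : ℝ → ℝ} (hpos : 0 < w.angSpeed ε θ (R θ))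
    (hR : HasDerivAt R (w.radialField ε θ (R θ)) θ) :
    HasDerivAt (fun θ => polarMap w.c (θ, R θ))
      ((w.angSpeed ε θ (R θ))⁻¹ • w.field ε (polarMap w.c (θ, R θ))) θ := by
  have hD := hpos.ne'
  have h1 : HasDerivAt (fun θ => w.c + R θ * Real.cos θ)
      (w.radialField ε θ (R θ) * Real.cos θ + R θ * -Real.sin θ) θ :=
    (hR.fun_mul (Real.hasDerivAt_cos θ)).const_add w.c
  have h2 : HasDerivAt (fun θ => R θ * Real.sin θ)
      (w.radialField ε θ (R θ) * Real.sin θ + R θ * Real.cos θ) θ :=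
    hR.fun_mul (Real.hasDerivAt_sin θ)
  refine (h1.prodMk h2).congr_deriv ?_
  have hcs := Real.sin_sq_add_cos_sq θ
  have hDdef : w.angSpeed ε θ (R θ) =
    Real.cos θ * w.force ε θ (R θ) + Real.sin θ ^ 2 := rfl
  ext
  · simp only [polarMap, field, Prod.smul_mk, smul_eq_mul, radialField]
    field_simp
    linear_combination (-(R θ * Real.sin θ)) * (hcs + hDdef)
  · have hf : (w.field ε (polarMap w.c (θ, R θ))).2 = R θ * w.force ε θ (R θ) := by
      simp only [field, polarMap, pert, force, add_sub_cancel_left]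
      ring
    simp only [Prod.smul_snd, hf, smul_eq_mul, radialField]
    field_simp
    linear_combination R θ * w.force ε θ (R θ) * hcs + R θ * Real.cos θ * hDdef

variable {w}

namespace IsRadial

variable {T ε x₁ x₂ x : ℝ} {R R₁ R₂ : ℝ → ℝ}

theorem continuousOn (h : w.IsRadial T ε x R) : ContinuousOn R (Icc 0 T) :=
  fun θ hθ => (h.deriv θ hθ).continuousAt.continuousWithinAt

/-- Two solutions of the radial equation keep their order. -/
theorem exists_sub_eq (h₁ : w.IsRadial T ε x₁ R₁) (h₂ : w.IsRadial T ε x₂ R₂) :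
    ∀ θ ∈ Icc 0 T, ∃ e > 0, R₁ θ - R₂ θ = (x₁ - x₂) * e := by
  have hb : ContinuousOn (fun θ => w.radialSlope ε θ (R₁ θ) (R₂ θ)) (Icc 0 T) := by
    have c₁ := h₁.continuousOn
    have c₂ := h₂.continuousOn
    have f₁ : ContinuousOn (fun θ => w.force ε θ (R₁ θ)) (Icc 0 T) :=
      w.continuousOn_force c₁
    have f₂ : ContinuousOn (fun θ => w.force ε θ (R₂ θ)) (Icc 0 T) :=
      w.continuousOn_force c₂
    unfold radialSlope
    refine ContinuousOn.div ?_ ?_ fun θ hθ => (mul_pos (h₁.angPos θ hθ) (h₂.angPos θ hθ)).ne'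
    · unfold forceSlope angSpeed
      fun_prop
    · unfold angSpeed
      fun_prop
  have := exists_pos_eq_mul_of_hasDerivAt (v := fun θ => R₁ θ - R₂ θ) hb fun θ hθ => by
    rw [← w.radialField_sub_radialField (h₁.angPos θ hθ) (h₂.angPos θ hθ)]
    exact (h₁.deriv θ hθ).fun_sub (h₂.deriv θ hθ)
  simpa only [h₁.init, h₂.init] using this

theorem eqOn (h₁ : w.IsRadial T ε x R₁) (h₂ : w.IsRadial T ε x R₂) : EqOn R₁ R₂ (Icc 0 T) := by
  intro θ hθ
  obtain ⟨e, -, he⟩ := h₁.exists_sub_eq h₂ θ hθ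
  rw [sub_self, zero_mul] at he
  exact sub_eq_zero.1 he

theorem lt_of_lt (h₁ : w.IsRadial T ε x₁ R₁) (h₂ : w.IsRadial T ε x₂ R₂) (h : x₁ < x₂) :
    ∀ θ ∈ Icc 0 T, R₁ θ < R₂ θ := by
  intro θ hθ
  obtain ⟨e, he0, he⟩ := h₂.exists_sub_eq h₁ θ hθ
  have := mul_pos (sub_pos.2 h) he0
  linarith

theorem mono (h : w.IsRadial T ε x R) {T' : ℝ} (hT : T' ≤ T) : w.IsRadial T' ε x R where
  init := h.init
  pos θ hθ := h.pos θ ⟨hθ.1, hθ.2.trans hT⟩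
  angPos θ hθ := h.angPos θ ⟨hθ.1, hθ.2.trans hT⟩
  deriv θ hθ := h.deriv θ ⟨hθ.1, hθ.2.trans hT⟩

theorem shift (h : w.IsRadial (T + 2 * Real.pi) ε x R) :
    w.IsRadial T ε (R (2 * Real.pi)) fun θ => R (θ + 2 * Real.pi) where
  init := by simp
  pos θ hθ := h.pos _ ⟨by linarith [hθ.1, Real.pi_pos], by linarith [hθ.2]⟩
  angPos θ hθ := by
    rw [← angSpeed_add_two_pi]
    exact h.angPos _ ⟨by linarith [hθ.1, Real.pi_pos], by linarith [hθ.2]⟩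
  deriv θ hθ := by
    rw [← radialField_add_two_pi]
    exact (h.deriv _ ⟨by linarith [hθ.1, Real.pi_pos], by linarith [hθ.2]⟩).comp_add_const _ _

theorem hasDerivAt_polarMap (h : w.IsRadial T ε x R) {θ : ℝ} (hθ : θ ∈ Icc 0 T) :
    HasDerivAt (fun θ => polarMap w.c (θ, R θ))
      ((w.angSpeed ε θ (R θ))⁻¹ • w.field ε (polarMap w.c (θ, R θ))) θ :=
  w.hasDerivAt_polarMap (h.angPos θ hθ) (h.deriv θ hθ)

/-- The Hamiltonian part of the field is tangent to the level sets, so only `ε y g` survives; the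
division by the angular speed converts time into angle. -/
theorem hasDerivAt_energy (h : w.IsRadial T ε x R) {θ : ℝ} (hθ : θ ∈ Icc 0 T) :
    HasDerivAt (fun θ => w.energy (polarMap w.c (θ, R θ)))
      (ε * ((polarMap w.c (θ, R θ)).2 * w.pert (polarMap w.c (θ, R θ)) /
        w.angSpeed ε θ (R θ))) θ := by
  have hp := h.hasDerivAt_polarMap hθ
  have h1 : HasDerivAt (fun θ => (polarMap w.c (θ, R θ)).1) _ θ :=
    (hasFDerivAt_fst (𝕜 := ℝ)).comp_hasDerivAt θ hp
  have h2 : HasDerivAt (fun θ => (polarMap w.c (θ, R θ)).2) _ θ :=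
    (hasFDerivAt_snd (𝕜 := ℝ)).comp_hasDerivAt θ hp
  have hu := h1.fun_sub (hasDerivAt_const θ w.c)
  refine (((((h2.fun_pow 2).div_const 2).fun_add ((hu.fun_pow 2).const_mul (w.k₀ / 2))).fun_add
    ((hu.fun_pow 3).const_mul (w.k₁ / 3))).fun_add ((hu.fun_pow 4).div_const 4)).congr_deriv ?_
  simp only [field, stiffness, Prod.smul_mk, smul_eq_mul]
  push_cast
  ring

end IsRadial

/-! ### Ovals as graphs over the angle -/

/-- `h` is the energy of an oval in the strip `A < x - c < B`, in which the centre is the only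
equilibrium of the unperturbed field. -/
structure IsLevel (w : Well) (A B h : ℝ) : Prop where
  left_neg : A < 0
  right_pos : 0 < B
  stiffness_pos : ∀ u ∈ Icc A B, 0 < w.stiffness u
  pos : 0 < h
  lt_left : h < w.energy (w.c + A, 0)
  lt_right : h < w.energy (w.c + B, 0)

/-- The angular speed is `cos² θ` times the stiffness plus `sin² θ`, and the two squares do not
vanish together. -/
theorem angSpeed_zero_pos {A B θ r : ℝ} (hs : ∀ u ∈ Icc A B, 0 < w.stiffness u)
    (hr : r * Real.cos θ ∈ Icc A B) : 0 < w.angSpeed 0 θ r := by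
  have h := hs _ hr
  have hcs := Real.sin_sq_add_cos_sq θ
  have : w.angSpeed 0 θ r = Real.cos θ ^ 2 * w.stiffness (r * Real.cos θ) + Real.sin θ ^ 2 := by
    simp only [angSpeed, force]
    ring
  rw [this]
  rcases eq_or_ne (Real.sin θ) 0 with h0 | h0
  · rw [h0] at hcs ⊢
    have : Real.cos θ ^ 2 = 1 := by linarith
    rw [this]
    linarith
  · have := mul_nonneg (sq_nonneg (Real.cos θ)) h.le
    positivity

theorem hasDerivAt_energy_radius (θ r : ℝ) :
    HasDerivAt (fun r => w.energy (polarMap w.c (θ, r))) (r * w.angSpeed 0 θ r) r := by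
  have hx : HasDerivAt (fun r => w.c + r * Real.cos θ - w.c) (Real.cos θ) r := by
    simpa using ((hasDerivAt_id r).mul_const (Real.cos θ)).const_add w.c |>.sub_const w.c
  have hy : HasDerivAt (fun r => r * Real.sin θ) (Real.sin θ) r := by
    simpa using (hasDerivAt_id r).mul_const (Real.sin θ)
  refine (((((hy.fun_pow 2).div_const 2).fun_add ((hx.fun_pow 2).const_mul (w.k₀ / 2))).fun_add
    ((hx.fun_pow 3).const_mul (w.k₁ / 3))).fun_add ((hx.fun_pow 4).div_const 4)).congr_deriv ?_
  simp only [angSpeed, force, stiffness]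
  push_cast
  ring

theorem hasDerivAt_energy_angle (θ r : ℝ) :
    HasDerivAt (fun θ => w.energy (polarMap w.c (θ, r)))
      (r ^ 2 * Real.sin θ * (Real.cos θ - w.force 0 θ r)) θ := by
  have hx : HasDerivAt (fun θ => w.c + r * Real.cos θ - w.c) (r * -Real.sin θ) θ := by
    simpa using (((Real.hasDerivAt_cos θ).const_mul r).const_add w.c).sub_const w.c
  have hy : HasDerivAt (fun θ => r * Real.sin θ) (r * Real.cos θ) θ :=
    (Real.hasDerivAt_sin θ).const_mul r
  refine (((((hy.fun_pow 2).div_const 2).fun_add ((hx.fun_pow 2).const_mul (w.k₀ / 2))).fun_add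
    ((hx.fun_pow 3).const_mul (w.k₁ / 3))).fun_add ((hx.fun_pow 4).div_const 4)).congr_deriv ?_
  simp only [force, stiffness]
  push_cast
  ring

theorem mul_cos_mem_Icc {A B θ r s : ℝ} (hA : A ≤ 0) (hB : 0 ≤ B) (hs : 0 ≤ s) (hsr : s ≤ r)
    (hr : r * Real.cos θ ∈ Icc A B) : s * Real.cos θ ∈ Icc A B := by
  rcases le_total 0 (Real.cos θ) with h | h
  · exact ⟨hA.trans (mul_nonneg hs h), (mul_le_mul_of_nonneg_right hsr h).trans hr.2⟩
  · exact ⟨hr.1.trans (mul_le_mul_of_nonpos_right hsr h), (mul_nonpos_of_nonneg_of_nonpos hs h).trans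
      hB⟩

/-- The energy increases along the rays from the centre. -/
theorem energy_lt_energy {A B θ r s : ℝ} (hA : A ≤ 0) (hB : 0 ≤ B)
    (hst : ∀ u ∈ Icc A B, 0 < w.stiffness u) (hs : 0 ≤ s) (hsr : s < r)
    (hr : r * Real.cos θ ∈ Icc A B) :
    w.energy (polarMap w.c (θ, s)) < w.energy (polarMap w.c (θ, r)) := by
  have hmono : StrictMonoOn (fun r => w.energy (polarMap w.c (θ, r))) (Icc 0 r) := by
    refine strictMonoOn_of_deriv_pos (convex_Icc 0 r)
      (fun t _ => (hasDerivAt_energy_radius θ t).continuousAt.continuousWithinAt) fun t ht => ?_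
    rw [interior_Icc] at ht
    rw [(hasDerivAt_energy_radius θ t).deriv]
    exact mul_pos ht.1 (angSpeed_zero_pos hst (mul_cos_mem_Icc hA hB ht.1.le ht.2.le hr))
  exact hmono ⟨hs, hsr.le⟩ ⟨hs.trans hsr.le, le_rfl⟩ hsr

namespace IsLevel

variable {A B h : ℝ}

theorem eq_of_energy_eq (hl : w.IsLevel A B h) {θ r s : ℝ} (hr : 0 < r) (hs : 0 < s)
    (hrc : r * Real.cos θ ∈ Icc A B) (hsc : s * Real.cos θ ∈ Icc A B)
    (he : w.energy (polarMap w.c (θ, r)) = w.energy (polarMap w.c (θ, s))) : r = s := by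
  rcases lt_trichotomy r s with hlt | heq | hlt
  · exact absurd he (energy_lt_energy hl.left_neg.le hl.right_pos.le hl.stiffness_pos hr.le hlt
      hsc).ne
  · exact heq
  · exact absurd he (energy_lt_energy hl.left_neg.le hl.right_pos.le hl.stiffness_pos hs.le hlt
      hrc).ne'

theorem exists_radius (hl : w.IsLevel A B h) (θ : ℝ) :
    ∃ r, 0 < r ∧ r * Real.cos θ ∈ Ioo A B ∧ w.energy (polarMap w.c (θ, r)) = h := by
  have hA := hl.left_neg
  have hB := hl.right_pos
  obtain ⟨m, hm, hmc, hmh⟩ : ∃ m, 0 < m ∧ m * Real.cos θ ∈ Icc A B ∧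
      h < w.energy (polarMap w.c (θ, m)) := by
    rcases lt_trichotomy (Real.cos θ) 0 with hc | hc | hc
    · have hm : A / Real.cos θ * Real.cos θ = A := div_mul_cancel₀ _ hc.ne
      refine ⟨A / Real.cos θ, div_pos_of_neg_of_neg hA hc, by rw [hm]; exact ⟨le_rfl, by linarith⟩,
        hl.lt_left.trans_le ?_⟩
      simp only [energy, polarMap, hm]
      nlinarith [sq_nonneg (A / Real.cos θ * Real.sin θ)]
    · have hs : Real.sin θ ^ 2 = 1 := by have := Real.sin_sq_add_cos_sq θ; rw [hc] at this; linarith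
      -- On a vertical ray the strip gives no bound; the energy at height `h + 1` is `(h + 1)² / 2 >
      -- h`.
      refine ⟨h + 1, by linarith [hl.pos], by rw [hc]; simp [hA.le, hB.le], ?_⟩
      simp only [energy, polarMap, hc, mul_pow, hs]
      nlinarith [sq_nonneg h]
    · have hm : B / Real.cos θ * Real.cos θ = B := div_mul_cancel₀ _ hc.ne'
      refine ⟨B / Real.cos θ, div_pos hB hc, by rw [hm]; exact ⟨by linarith, le_rfl⟩,
        hl.lt_right.trans_le ?_⟩
      simp only [energy, polarMap, hm]
      nlinarith [sq_nonneg (B / Real.cos θ * Real.sin θ)]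
  have hcont : ContinuousOn (fun r => w.energy (polarMap w.c (θ, r))) (Icc 0 m) :=
    fun t _ => (hasDerivAt_energy_radius θ t).continuousAt.continuousWithinAt
  obtain ⟨r, hr, hrh⟩ := intermediate_value_Ioo hm.le hcont
    (show h ∈ Ioo _ _ from ⟨by simpa [energy, polarMap] using hl.pos, hmh⟩)
  refine ⟨r, hr.1, ?_, hrh⟩
  rcases le_total 0 (Real.cos θ) with hc | hc
  · refine ⟨hA.trans_le (mul_nonneg hr.1.le hc), ?_⟩
    rcases hc.eq_or_lt with h0 | h0
    · rw [← h0, mul_zero]; exact hB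
    · exact (mul_lt_mul_of_pos_right hr.2 h0).trans_le hmc.2
  · refine ⟨?_, (mul_nonpos_of_nonneg_of_nonpos hr.1.le hc).trans_lt hB⟩
    rcases hc.eq_or_lt with h0 | h0
    · rw [h0, mul_zero]; exact hA
    · exact hmc.1.trans_lt (mul_lt_mul_of_neg_right hr.2 h0)

/-- The oval of energy `h` in polar coordinates. -/
def radius (hl : w.IsLevel A B h) (θ : ℝ) : ℝ := (hl.exists_radius θ).choose

theorem radius_pos (hl : w.IsLevel A B h) (θ : ℝ) : 0 < hl.radius θ :=
  (hl.exists_radius θ).choose_spec.1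

theorem radius_mem (hl : w.IsLevel A B h) (θ : ℝ) : hl.radius θ * Real.cos θ ∈ Ioo A B :=
  (hl.exists_radius θ).choose_spec.2.1

theorem energy_radius (hl : w.IsLevel A B h) (θ : ℝ) :
    w.energy (polarMap w.c (θ, hl.radius θ)) = h :=
  (hl.exists_radius θ).choose_spec.2.2

theorem eq_radius (hl : w.IsLevel A B h) {θ r : ℝ} (hr : 0 < r) (hrc : r * Real.cos θ ∈ Icc A B)
    (he : w.energy (polarMap w.c (θ, r)) = h) : r = hl.radius θ :=
  hl.eq_of_energy_eq hr (hl.radius_pos θ) hrc (Ioo_subset_Icc_self (hl.radius_mem θ))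
    (he.trans (hl.energy_radius θ).symm)

theorem angSpeed_pos (hl : w.IsLevel A B h) (θ : ℝ) : 0 < w.angSpeed 0 θ (hl.radius θ) :=
  angSpeed_zero_pos hl.stiffness_pos (Ioo_subset_Icc_self (hl.radius_mem θ))

theorem radius_add_two_pi (hl : w.IsLevel A B h) (θ : ℝ) :
    hl.radius (θ + 2 * Real.pi) = hl.radius θ := by
  refine hl.eq_radius (hl.radius_pos _) ?_ ?_
  · simpa using Ioo_subset_Icc_self (hl.radius_mem (θ + 2 * Real.pi))
  · rw [← polarMap_add_two_pi]
    exact hl.energy_radius _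

/-- `radius` is a pointwise choice. It is differentiable because it agrees locally with the implicit
function of the energy equation, by uniqueness of the level point on each ray; differentiating the
constant energy then yields the radial equation at `ε = 0`. -/
theorem hasDerivAt_radius (hl : w.IsLevel A B h) (θ : ℝ) :
    HasDerivAt hl.radius (w.radialField 0 θ (hl.radius θ)) θ := by
  set r := hl.radius θ with hr
  set G : ℝ × ℝ → ℝ := fun z => w.energy (polarMap w.c z) with hG
  have hcd : ContDiff ℝ 1 G := by
    simp only [hG, energy, polarMap]
    fun_prop
  have hcda : ContDiffAt ℝ 1 G (θ, r) := hcd.contDiffAt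
  have hfd : HasFDerivAt G (fderiv ℝ G (θ, r)) (θ, r) :=
    (hcda.differentiableAt one_ne_zero).hasFDerivAt
  have hdr : fderiv ℝ G (θ, r) (0, 1) = r * w.angSpeed 0 θ r := by
    have h1 : HasDerivAt (fun s => G (θ, s)) (fderiv ℝ G (θ, r) (0, 1)) r :=
      hfd.comp_hasDerivAt r ((hasDerivAt_const r θ).prodMk (hasDerivAt_id r))
    exact h1.unique (hasDerivAt_energy_radius θ r)
  have hdθ : fderiv ℝ G (θ, r) (1, 0) = r ^ 2 * Real.sin θ * (Real.cos θ - w.force 0 θ r) := by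
    have h1 : HasDerivAt (fun s => G (s, r)) (fderiv ℝ G (θ, r) (1, 0)) θ :=
      HasFDerivAt.comp_hasDerivAt (l := G) (f := fun s : ℝ => (s, r)) θ hfd
        ((hasDerivAt_id θ).prodMk (hasDerivAt_const θ r))
    exact h1.unique (hasDerivAt_energy_angle θ r)
  have hD := hl.angSpeed_pos θ
  rw [← hr] at hD
  have hrpos : 0 < r := hl.radius_pos θ
  have hne : r * w.angSpeed 0 θ r ≠ 0 := (mul_pos hrpos hD).ne'
  have hinv : (fderiv ℝ G (θ, r) ∘L .inr ℝ ℝ ℝ).IsInvertible := by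
    refine ⟨ContinuousLinearEquiv.unitsEquivAut ℝ (Units.mk0 _ hne), ?_⟩
    ext
    simp [← hdr]
  set ψ := hcda.implicitFunction one_ne_zero hinv
  have hψ0 : ψ θ = r := hcda.implicitFunction_apply_self one_ne_zero hinv
  have hψd : HasDerivAt ψ (deriv ψ θ) θ :=
    ((hcda.contDiffAt_implicitFunction one_ne_zero hinv).differentiableAt one_ne_zero).hasDerivAt
  have hψe : ∀ᶠ t in 𝓝 θ, G (t, ψ t) = G (θ, r) :=
    hcda.eventually_apply_implicitFunction one_ne_zero hinv
  have hψr : ψ =ᶠ[𝓝 θ] hl.radius := by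
    have h1 : ∀ᶠ t in 𝓝 θ, 0 < ψ t :=
      hψd.continuousAt.eventually (lt_mem_nhds (by rw [hψ0]; exact hrpos))
    have h2 : ∀ᶠ t in 𝓝 θ, ψ t * Real.cos t ∈ Ioo A B :=
      (hψd.continuousAt.mul Real.continuous_cos.continuousAt).eventually
        (isOpen_Ioo.mem_nhds (by
          simp only [Pi.mul_apply, hψ0]
          exact hl.radius_mem θ))
    filter_upwards [h1, h2, hψe] with t ht1 ht2 ht3
    exact hl.eq_radius ht1 (Ioo_subset_Icc_self ht2) (ht3.trans (hl.energy_radius θ))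
  have hd := hψd.congr_of_eventuallyEq hψr.symm
  have hconst : HasDerivAt (fun t => G (t, hl.radius t)) (fderiv ℝ G (θ, r) (1, deriv ψ θ)) θ := by
    have h1 : HasFDerivAt G (fderiv ℝ G (θ, r)) (id θ, hl.radius θ) := hfd
    exact h1.comp_hasDerivAt θ ((hasDerivAt_id θ).prodMk hd)
  have hzero : fderiv ℝ G (θ, r) (1, deriv ψ θ) = 0 := by
    refine hconst.unique ?_
    have : (fun t => G (t, hl.radius t)) = fun _ => h := funext fun t => hl.energy_radius t
    rw [this]
    exact hasDerivAt_const θ h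
  have hsplit : ((1 : ℝ), deriv ψ θ) = (1, 0) + deriv ψ θ • ((0 : ℝ), (1 : ℝ)) := by
    ext <;> simp
  rw [hsplit, map_add, map_smul, hdθ, hdr, smul_eq_mul] at hzero
  refine hd.congr_deriv ?_
  rw [radialField, eq_div_iff hD.ne']
  have := mul_left_cancel₀ hrpos.ne' (show r * (deriv ψ θ * w.angSpeed 0 θ r) =
    r * (r * Real.sin θ * (w.force 0 θ r - Real.cos θ)) by linear_combination hzero)
  exact this

theorem continuous_radius (hl : w.IsLevel A B h) : Continuous hl.radius :=
  continuous_iff_continuousAt.2 fun θ => (hl.hasDerivAt_radius θ).continuousAt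

theorem isRadial (hl : w.IsLevel A B h) (T : ℝ) : w.IsRadial T 0 (hl.radius 0) hl.radius where
  init := rfl
  pos θ _ := hl.radius_pos θ
  angPos θ _ := hl.angSpeed_pos θ
  deriv θ _ := hl.hasDerivAt_radius θ

end IsLevel

end Well

/-! ### Superposition operators and analytic families of orbits -/

namespace Well

open scoped ContDiff

variable (w : Well)

/-- The derivative of the energy along the curve of a solution of the radial equation is `ε` times
this. -/
def energyRate (ε θ r : ℝ) : ℝ :=
  (polarMap w.c (θ, r)).2 * w.pert (polarMap w.c (θ, r)) / w.angSpeed ε θ r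

variable {T : ℝ}

def cosMap (T : ℝ) : C(Icc 0 T, ℝ) := ⟨fun t => Real.cos t, by fun_prop⟩

def sinMap (T : ℝ) : C(Icc 0 T, ℝ) := ⟨fun t => Real.sin t, by fun_prop⟩

/-- This and the next three operators lift the pointwise expressions to the Banach algebra `C([0,
T])`, where polynomials are analytic. Division is `Ring.inverse`, meaningful only where the angular
speed has no zero. -/
def forceOp (z : ℝ × C(Icc 0 T, ℝ)) : C(Icc 0 T, ℝ) :=
  cosMap T * (w.k₀ • 1 + w.k₁ • (z.2 * cosMap T) + (z.2 * cosMap T) ^ 2) +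
    z.1 • (sinMap T * (w.a₀ • 1 + w.a₁ • (z.2 * cosMap T) + w.a₂ • (z.2 * cosMap T) ^ 2 +
      w.a₃ • (z.2 * sinMap T) ^ 2))

def angSpeedOp (z : ℝ × C(Icc 0 T, ℝ)) : C(Icc 0 T, ℝ) :=
  cosMap T * w.forceOp z + sinMap T ^ 2

def radialFieldOp (z : ℝ × C(Icc 0 T, ℝ)) : C(Icc 0 T, ℝ) :=
  z.2 * sinMap T * (w.forceOp z - cosMap T) * Ring.inverse (w.angSpeedOp z)

def energyRateOp (z : ℝ × C(Icc 0 T, ℝ)) : C(Icc 0 T, ℝ) :=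
  z.2 * sinMap T * (z.2 * sinMap T * (w.a₀ • 1 + w.a₁ • (z.2 * cosMap T) +
    w.a₂ • (z.2 * cosMap T) ^ 2 + w.a₃ • (z.2 * sinMap T) ^ 2)) * Ring.inverse (w.angSpeedOp z)

theorem forceOp_apply (z : ℝ × C(Icc 0 T, ℝ)) (t : Icc 0 T) :
    w.forceOp z t = w.force z.1 t (z.2 t) := by
  simp [forceOp, force, stiffness, cosMap, sinMap]

theorem angSpeedOp_apply (z : ℝ × C(Icc 0 T, ℝ)) (t : Icc 0 T) :
    w.angSpeedOp z t = w.angSpeed z.1 t (z.2 t) := by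
  simp [angSpeedOp, forceOp_apply, angSpeed, cosMap, sinMap]

theorem inverse_apply {d : C(Icc 0 T, ℝ)} (hd : IsUnit d) (t : Icc 0 T) :
    Ring.inverse d t = (d t)⁻¹ := by
  have h : (d * Ring.inverse d) t = 1 := by rw [Ring.mul_inverse_cancel _ hd]; rfl
  rw [ContinuousMap.mul_apply] at h
  exact eq_inv_of_mul_eq_one_right h

variable {w}

theorem radialFieldOp_apply {z : ℝ × C(Icc 0 T, ℝ)} (hz : IsUnit (w.angSpeedOp z)) (t : Icc 0 T) :
    w.radialFieldOp z t = w.radialField z.1 t (z.2 t) := by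
  simp [radialFieldOp, radialField, forceOp_apply, inverse_apply hz, angSpeedOp_apply, cosMap,
    sinMap, div_eq_mul_inv]

theorem energyRateOp_apply {z : ℝ × C(Icc 0 T, ℝ)} (hz : IsUnit (w.angSpeedOp z)) (t : Icc 0 T) :
    w.energyRateOp z t = w.energyRate z.1 t (z.2 t) := by
  simp [energyRateOp, energyRate, pert, polarMap, inverse_apply hz, angSpeedOp_apply, cosMap,
    sinMap, div_eq_mul_inv]

theorem isUnit_angSpeedOp {z : ℝ × C(Icc 0 T, ℝ)} (hz : ∀ t : Icc 0 T, 0 < w.angSpeed z.1 t (z.2 t)) :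
    IsUnit (w.angSpeedOp z) := by
  rw [ContinuousMap.isUnit_iff_forall_ne_zero]
  intro t
  rw [angSpeedOp_apply]
  exact (hz t).ne'

theorem contDiff_forceOp : ContDiff ℝ ω (w.forceOp (T := T)) := by
  unfold forceOp
  fun_prop

theorem contDiff_angSpeedOp : ContDiff ℝ ω (w.angSpeedOp (T := T)) := by
  have := w.contDiff_forceOp (T := T)
  unfold angSpeedOp
  fun_prop

theorem contDiffAt_inverse_angSpeedOp {z : ℝ × C(Icc 0 T, ℝ)} (hz : IsUnit (w.angSpeedOp z)) :
    ContDiffAt ℝ ω (fun z => Ring.inverse (w.angSpeedOp (T := T) z)) z := by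
  obtain ⟨u, hu⟩ := hz
  have h1 : ContDiffAt ℝ ω Ring.inverse (w.angSpeedOp z) := by
    rw [← hu]
    exact contDiffAt_ringInverse ℝ u
  exact h1.comp z w.contDiff_angSpeedOp.contDiffAt

theorem contDiffAt_radialFieldOp {z : ℝ × C(Icc 0 T, ℝ)} (hz : IsUnit (w.angSpeedOp z)) :
    ContDiffAt ℝ ω (w.radialFieldOp (T := T)) z := by
  have h1 : ContDiff ℝ ω fun z : ℝ × C(Icc 0 T, ℝ) =>
      z.2 * sinMap T * (w.forceOp z - cosMap T) := by
    have := w.contDiff_forceOp (T := T)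
    fun_prop
  exact h1.contDiffAt.mul (contDiffAt_inverse_angSpeedOp hz)

theorem continuousAt_energyRateOp {z : ℝ × C(Icc 0 T, ℝ)} (hz : IsUnit (w.angSpeedOp z)) :
    ContinuousAt (w.energyRateOp (T := T)) z := by
  have h1 : Continuous fun z : ℝ × C(Icc 0 T, ℝ) =>
      z.2 * sinMap T * (z.2 * sinMap T * (w.a₀ • 1 + w.a₁ • (z.2 * cosMap T) +
    w.a₂ • (z.2 * cosMap T) ^ 2 + w.a₃ • (z.2 * sinMap T) ^ 2)) := by
    fun_prop
  exact h1.continuousAt.mul (contDiffAt_inverse_angSpeedOp hz).continuousAt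

/-- A fixed point of the integral operator yields a solution of the radial equation. -/
theorem exists_isRadial (hT : 0 ≤ T) {ε x : ℝ} {r : C(Icc 0 T, ℝ)} (hpos : ∀ t, 0 < r t)
    (hang : ∀ t : Icc 0 T, 0 < w.angSpeed ε t (r t))
    (hr : r = algebraMap ℝ _ x + volterra hT (w.radialFieldOp (ε, r))) :
    ∃ R, w.IsRadial T ε x R ∧ ∀ t : Icc 0 T, R t = r t := by
  have hu : IsUnit (w.angSpeedOp (ε, r)) := isUnit_angSpeedOp hang
  set R : ℝ → ℝ := fun t => x + ∫ s in (0 : ℝ)..t, IccExtend hT (w.radialFieldOp (ε, r)) s with hR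
  have hRr : ∀ t : Icc 0 T, R t = r t := by
    intro t
    conv_rhs => rw [hr]
    simp [hR, volterra_apply]
  refine ⟨R, ⟨by simp [hR], fun θ hθ => ?_, fun θ hθ => ?_, fun θ hθ => ?_⟩, hRr⟩
  · rw [hRr ⟨θ, hθ⟩]
    exact hpos _
  · rw [hRr ⟨θ, hθ⟩]
    exact hang ⟨θ, hθ⟩
  · have hc : Continuous (IccExtend hT (w.radialFieldOp (ε, r))) :=
      (w.radialFieldOp (ε, r)).continuous.Icc_extend'
    have h := (hasDerivAt_integral hc 0 θ).const_add x
    refine h.congr_deriv ?_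
    rw [IccExtend_of_mem _ _ hθ, radialFieldOp_apply hu, hRr ⟨θ, hθ⟩]

/-- Converse of `exists_isRadial`; it supplies the unperturbed oval as base point for the implicit
function theorem. -/
theorem IsRadial.eq_volterra (hT : 0 ≤ T) {ε x : ℝ} {R : ℝ → ℝ} (h : w.IsRadial T ε x R)
    {r : C(Icc 0 T, ℝ)} (hr : ∀ t : Icc 0 T, R t = r t) :
    r = algebraMap ℝ _ x + volterra hT (w.radialFieldOp (ε, r)) := by
  have hu : IsUnit (w.angSpeedOp (ε, r)) := isUnit_angSpeedOp fun t => by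
    simpa [hr] using h.angPos t t.2
  ext t
  have hint : ∫ s in (0 : ℝ)..t, IccExtend hT (w.radialFieldOp (ε, r)) s = R t - R 0 := by
    refine intervalIntegral.integral_eq_sub_of_hasDerivAt (fun s hs => ?_)
      ((w.radialFieldOp (ε, r)).continuous.Icc_extend'.intervalIntegrable _ _)
    rw [uIcc_of_le t.2.1] at hs
    have hs' : s ∈ Icc 0 T := ⟨hs.1, hs.2.trans t.2.2⟩
    rw [IccExtend_of_mem _ _ hs', radialFieldOp_apply hu, ← hr ⟨s, hs'⟩]
    exact h.deriv s hs'
  simp only [ContinuousMap.add_apply, volterra_apply, hint, h.init, hr]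
  simp

/-- An open condition that holds along a solution holds along nearby ones. -/
theorem eventually_forall_mem {O : Set (ℝ × ℝ × ℝ)} (hO : IsOpen O) {ψ : ℝ × ℝ → C(Icc 0 T, ℝ)}
    {z₀ : ℝ × ℝ} (hψ : ContinuousAt ψ z₀) (h : ∀ t : Icc 0 T, (z₀.2, (t : ℝ), ψ z₀ t) ∈ O) :
    ∀ᶠ z in 𝓝 z₀, ∀ t : Icc 0 T, (z.2, (t : ℝ), ψ z t) ∈ O := by
  have := isCompact_univ.eventually_forall_of_forall_eventually (x₀ := z₀) (K := (univ : Set (Icc 0 T)))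
    (P := fun z t => (z.2, (t : ℝ), ψ z t) ∈ O) (fun t _ => by
      have hc : ContinuousAt (fun y : (ℝ × ℝ) × Icc 0 T => (y.1.2, (y.2 : ℝ), ψ y.1 y.2)) (z₀, t) := by
        have h1 : ContinuousAt (fun y : (ℝ × ℝ) × Icc 0 T => ψ y.1) (z₀, t) :=
          ContinuousAt.comp (g := ψ) (f := Prod.fst) (x := (z₀, t)) hψ continuousAt_fst
        have h2 : ContinuousAt (fun y : (ℝ × ℝ) × Icc 0 T => ψ y.1 y.2) (z₀, t) :=
          h1.eval continuousAt_snd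
        have h3 : ContinuousAt (fun y : (ℝ × ℝ) × Icc 0 T => (y.1.2, (y.2 : ℝ))) (z₀, t) := by
          fun_prop
        exact (continuousAt_fst.comp h3).prodMk ((continuousAt_snd.comp h3).prodMk h2)
      exact hc.eventually (hO.mem_nhds (h t)))
  filter_upwards [this] with z hz t using hz t (mem_univ t)

variable {A B h : ℝ}

/-- The orbits near an oval of the unperturbed field, as an analytic family. -/
theorem IsLevel.exists_analyticAt_family (hl : w.IsLevel A B h) (hT : 0 ≤ T) {O : Set (ℝ × ℝ)}
    (hO : IsOpen O) (hmem : ∀ θ, polarMap w.c (θ, hl.radius θ) ∈ O) :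
    ∃ ψ : ℝ × ℝ → C(Icc 0 T, ℝ), AnalyticAt ℝ ψ (hl.radius 0, 0) ∧
      (∀ t : Icc 0 T, ψ (hl.radius 0, 0) t = hl.radius t) ∧
      ∀ᶠ z in 𝓝 (hl.radius 0, 0), ∃ R, w.IsRadial T z.2 z.1 R ∧
        (∀ t : Icc 0 T, R t = ψ z t) ∧ ∀ θ ∈ Icc 0 T, polarMap w.c (θ, R θ) ∈ O := by
  set r₀ : C(Icc 0 T, ℝ) :=
    ⟨fun t => hl.radius t, hl.continuous_radius.comp continuous_subtype_val⟩ with hr₀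
  have hu : IsUnit (w.angSpeedOp (0, r₀)) := isUnit_angSpeedOp fun t => hl.angSpeed_pos t
  have hev : ∀ᶠ s in 𝓝 r₀, ∀ t : Icc 0 T, w.radialFieldOp (0, s) t = w.radialField 0 t (s t) := by
    have hc : ContinuousAt (fun s : C(Icc 0 T, ℝ) => w.angSpeedOp (0, s)) r₀ :=
      (w.contDiff_angSpeedOp.continuous.comp (Continuous.prodMk_right (0 : ℝ))).continuousAt
    filter_upwards [hc.eventually (Units.isOpen.mem_nhds hu)] with s hs t
    exact radialFieldOp_apply hs t
  obtain ⟨ψ, hψa, hψ0, hψe⟩ := exists_analyticAt_solution hT (contDiffAt_radialFieldOp hu) hev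
    ((hl.isRadial T).eq_volterra hT fun t => rfl)
  refine ⟨ψ, hψa, fun t => by rw [hψ0]; rfl, ?_⟩
  have hO' : IsOpen {y : ℝ × ℝ × ℝ | 0 < y.2.2 ∧ 0 < w.angSpeed y.1 y.2.1 y.2.2 ∧
      polarMap w.c (y.2.1, y.2.2) ∈ O} := by
    refine (isOpen_lt continuous_const (continuous_snd.comp continuous_snd)).inter
      ((isOpen_lt continuous_const w.continuous_angSpeed).inter (hO.preimage ?_))
    exact (continuous_polarMap w.c).comp continuous_snd
  filter_upwards [hψe, eventually_forall_mem hO' hψa.continuousAt (fun t => by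
    rw [hψ0]
    exact ⟨hl.radius_pos t, hl.angSpeed_pos t, hmem t⟩)] with z hz hzm
  obtain ⟨R, hR, hRψ⟩ := exists_isRadial hT (fun t => (hzm t).1) (fun t => (hzm t).2.1) hz
  refine ⟨R, hR, hRψ, fun θ hθ => ?_⟩
  rw [hRψ ⟨θ, hθ⟩]
  exact (hzm ⟨θ, hθ⟩).2.2

/-- Near `x` the solutions of the radial equation depend analytically on the initial value, and
their curves lie in `O`. -/
def IsAnalyticFamilyAt (w : Well) (T : ℝ) (O : Set (ℝ × ℝ)) (ε x : ℝ) : Prop :=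
  ∃ ψ : ℝ → C(Icc 0 T, ℝ), AnalyticAt ℝ ψ x ∧ ∀ᶠ y in 𝓝 x, ∃ R, w.IsRadial T ε y R ∧
    (∀ t : Icc 0 T, R t = ψ y t) ∧ ∀ θ ∈ Icc 0 T, polarMap w.c (θ, R θ) ∈ O

/-- Restricts the jointly analytic family to a fixed `ε`. Stating this for all nearby `(x, ε)`
prepares the compactness argument over an interval of initial radii. -/
theorem IsLevel.eventually_isAnalyticFamilyAt (hl : w.IsLevel A B h) (hT : 0 ≤ T)
    {O : Set (ℝ × ℝ)} (hO : IsOpen O) (hmem : ∀ θ, polarMap w.c (θ, hl.radius θ) ∈ O) :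
    ∀ᶠ z : ℝ × ℝ in 𝓝 (hl.radius 0, 0), w.IsAnalyticFamilyAt T O z.2 z.1 := by
  obtain ⟨ψ, hψa, -, hψ⟩ := hl.exists_analyticAt_family hT hO hmem
  filter_upwards [hψa.eventually_analyticAt, hψ.eventually_nhds] with z hz1 hz2
  have hline : AnalyticAt ℝ (fun y : ℝ => (y, z.2)) z.1 := analyticAt_id.prod analyticAt_const
  refine ⟨fun y => ψ (y, z.2), AnalyticAt.comp (g := ψ) (f := fun y : ℝ => (y, z.2)) hz1 hline, ?_⟩
  exact hline.continuousAt.eventually (p := fun z => ∃ R, w.IsRadial T z.2 z.1 R ∧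
        (∀ t : Icc 0 T, R t = ψ z t) ∧ ∀ θ ∈ Icc 0 T, polarMap w.c (θ, R θ) ∈ O) hz2

/-- The sign of the change of the energy along one turn is that of the unperturbed one. -/
theorem IsLevel.eventually_integral_energyRate_pos (hl : w.IsLevel A B h)
    (hT : 2 * Real.pi ≤ T) {σ : ℝ}
    (hσ : 0 < σ * ∫ θ in (0 : ℝ)..2 * Real.pi, w.energyRate 0 θ (hl.radius θ)) :
    ∀ᶠ z : ℝ × ℝ in 𝓝 (hl.radius 0, 0), ∀ R, w.IsRadial T z.2 z.1 R →
      0 < σ * ∫ θ in (0 : ℝ)..2 * Real.pi, w.energyRate z.2 θ (R θ) := by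
  have hT0 : 0 ≤ T := Real.two_pi_pos.le.trans hT
  obtain ⟨ψ, hψa, hψ0, hψ⟩ := hl.exists_analyticAt_family hT0 isOpen_univ fun _ => mem_univ _
  set e : Icc 0 T := ⟨2 * Real.pi, Real.two_pi_pos.le, hT⟩ with he
  have hint : ∀ {ε x : ℝ} {R : ℝ → ℝ} {r : C(Icc 0 T, ℝ)}, w.IsRadial T ε x R →
      (∀ t : Icc 0 T, R t = r t) → volterra hT0 (w.energyRateOp (ε, r)) e =
        ∫ θ in (0 : ℝ)..2 * Real.pi, w.energyRate ε θ (R θ) := by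
    intro ε x R r hR hr
    -- The integral is the value at `2π` of Volterra applied to the rate operator, so its continuity
    -- in `(x, ε)` follows from continuity of the operators.
    have hu : IsUnit (w.angSpeedOp (ε, r)) := isUnit_angSpeedOp fun t => by
      simpa [hr] using hR.angPos t t.2
    rw [volterra_apply]
    refine intervalIntegral.integral_congr fun θ hθ => ?_
    rw [uIcc_of_le e.2.1] at hθ
    have hθ' : θ ∈ Icc 0 T := ⟨hθ.1, hθ.2.trans hT⟩
    rw [IccExtend_of_mem _ _ hθ', energyRateOp_apply hu, ← hr ⟨θ, hθ'⟩]
  have hu : IsUnit (w.angSpeedOp ((0 : ℝ), ψ (hl.radius 0, 0))) := isUnit_angSpeedOp fun t => by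
    rw [hψ0]
    exact hl.angSpeed_pos t
  have hc : ContinuousAt (fun z : ℝ × ℝ =>
      σ * volterra hT0 (w.energyRateOp (z.2, ψ z)) e) (hl.radius 0, 0) := by
    have h1 : ContinuousAt (fun z : ℝ × ℝ => (z.2, ψ z)) (hl.radius 0, 0) :=
      continuousAt_snd.prodMk hψa.continuousAt
    have h2 : ContinuousAt (fun z : ℝ × ℝ => w.energyRateOp (z.2, ψ z)) (hl.radius 0, 0) :=
      ContinuousAt.comp (g := w.energyRateOp) (f := fun z : ℝ × ℝ => (z.2, ψ z))
        (continuousAt_energyRateOp hu) h1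
    have h3 : Continuous fun f : C(Icc 0 T, ℝ) => σ * volterra hT0 f e := by
      have := (volterra hT0).continuous
      fun_prop
    exact h3.continuousAt.comp h2
  have hpos : 0 < σ * volterra hT0 (w.energyRateOp (0, ψ (hl.radius 0, 0))) e := by
    rw [hint (hl.isRadial T) fun t => (hψ0 t).symm]
    exact hσ
  filter_upwards [hc.eventually (lt_mem_nhds hpos), hψ] with z hz hzψ R hR
  obtain ⟨R', hR', hRψ', -⟩ := hzψ
  rw [← hint hR fun t => (hR.eqOn hR' t.2).trans (hRψ' t)]
  exact hz

theorem angSpeed_sub_int (w : Well) (ε θ r : ℝ) (k : ℤ) :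
    w.angSpeed ε (θ - k * (2 * Real.pi)) r = w.angSpeed ε θ r := by
  simp [angSpeed, force, Real.cos_sub_int_mul_two_pi, Real.sin_sub_int_mul_two_pi]

theorem polarMap_sub_int (c θ r : ℝ) (k : ℤ) :
    polarMap c (θ - k * (2 * Real.pi), r) = polarMap c (θ, r) := by
  simp [polarMap, Real.cos_sub_int_mul_two_pi, Real.sin_sub_int_mul_two_pi]

theorem dist_polarMap_le (c θ r s : ℝ) :
    dist (polarMap c (θ, r)) (polarMap c (θ, s)) ≤ |r - s| := by
  rw [Prod.dist_eq, max_le_iff, Real.dist_eq, Real.dist_eq]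
  simp only [polarMap]
  constructor
  · rw [show c + r * Real.cos θ - (c + s * Real.cos θ) = (r - s) * Real.cos θ by ring, abs_mul]
    exact mul_le_of_le_one_right (abs_nonneg _) (Real.abs_cos_le_one θ)
  · rw [show r * Real.sin θ - s * Real.sin θ = (r - s) * Real.sin θ by ring, abs_mul]
    exact mul_le_of_le_one_right (abs_nonneg _) (Real.abs_sin_le_one θ)

/-! ### The return map near a cycle -/

/-- A family of solutions of the radial equation around a `2π`-periodic one, to which the neighbours
come closer after each turn. -/
structure IsReturnTube (w : Well) (O : Set (ℝ × ℝ)) (ε x₀ η : ℝ) (R : ℝ → ℝ → ℝ) : Prop where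
  pos : 0 < η
  radial : ∀ x ∈ Ioo (x₀ - η) (x₀ + η), w.IsRadial (4 * Real.pi) ε x (R x)
  mem : ∀ x ∈ Ioo (x₀ - η) (x₀ + η), ∀ θ ∈ Icc 0 (4 * Real.pi), polarMap w.c (θ, R x θ) ∈ O
  unif : ∀ x ∈ Ioo (x₀ - η) (x₀ + η), ∀ e > 0, ∀ᶠ y in 𝓝 x,
    ∀ θ ∈ Icc 0 (4 * Real.pi), |R y θ - R x θ| < e
  bdd : ∃ K, ∀ x ∈ Ioo (x₀ - η) (x₀ + η), ∀ θ ∈ Icc 0 (4 * Real.pi), w.angSpeed ε θ (R x θ) ≤ K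
  fixed : R x₀ (2 * Real.pi) = x₀
  left : ∀ x ∈ Ioo (x₀ - η) x₀, x < R x (2 * Real.pi)
  right : ∀ x ∈ Ioo x₀ (x₀ + η), R x (2 * Real.pi) < x

theorem two_pi_mem : 2 * Real.pi ∈ Icc 0 (4 * Real.pi) :=
  ⟨by linarith [Real.pi_pos], by linarith [Real.pi_pos]⟩

/-- A displacement function that is positive at `a` and negative at `b` yields an attracting
periodic solution of the radial equation. -/
theorem exists_isReturnTube {O : Set (ℝ × ℝ)} {ε a b : ℝ} (hab : a < b)
    (hfam : ∀ x ∈ Icc a b, w.IsAnalyticFamilyAt (4 * Real.pi) O ε x)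
    (ha : ∀ R, w.IsRadial (4 * Real.pi) ε a R → polarMap w.c (2 * Real.pi, R (2 * Real.pi)) ∈ O →
      a < R (2 * Real.pi))
    (hb : ∀ R, w.IsRadial (4 * Real.pi) ε b R → polarMap w.c (2 * Real.pi, R (2 * Real.pi)) ∈ O →
      R (2 * Real.pi) < b) :
    ∃ x₀ η R, w.IsReturnTube O ε x₀ η R := by
  have hR0 : ∀ x : ℝ, ∃ R, x ∈ Icc a b → w.IsRadial (4 * Real.pi) ε x R ∧
      ∀ θ ∈ Icc 0 (4 * Real.pi), polarMap w.c (θ, R θ) ∈ O := by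
    intro x
    by_cases hx : x ∈ Icc a b
    · obtain ⟨ψ, -, hψ⟩ := hfam x hx
      obtain ⟨R, hR, -, hO⟩ := hψ.self_of_nhds
      exact ⟨R, fun _ => ⟨hR, hO⟩⟩
    · exact ⟨0, fun h => absurd h hx⟩
  choose R hR using hR0
  have hψ : ∀ x ∈ Icc a b, ∃ ψ : ℝ → C(Icc 0 (4 * Real.pi), ℝ), AnalyticAt ℝ ψ x ∧
      (∀ t : Icc 0 (4 * Real.pi), R x t = ψ x t) ∧
      ∀ᶠ y in 𝓝 x, y ∈ Icc a b → ∀ t : Icc 0 (4 * Real.pi), R y t = ψ y t := by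
    intro x hx
    obtain ⟨ψ, hψa, hψ⟩ := hfam x hx
    have hev : ∀ᶠ y in 𝓝 x, y ∈ Icc a b → ∀ t : Icc 0 (4 * Real.pi), R y t = ψ y t := by
      filter_upwards [hψ] with y hy hyI t
      obtain ⟨R', hR', hRψ, -⟩ := hy
      exact ((hR y hyI).1.eqOn hR' t.2).trans (hRψ t)
    exact ⟨ψ, hψa, hev.self_of_nhds hx, hev⟩
  have hunif : ∀ x ∈ Icc a b, ∀ e > 0, ∀ᶠ y in 𝓝 x, y ∈ Icc a b →
      ∀ θ ∈ Icc 0 (4 * Real.pi), |R y θ - R x θ| < e := by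
    intro x hx e he
    obtain ⟨ψ, hψa, hψx, hψ⟩ := hψ x hx
    filter_upwards [hψ, hψa.continuousAt.eventually (Metric.ball_mem_nhds _ he)] with y hy hy2 hyI θ hθ
    have h1 := hy hyI ⟨θ, hθ⟩
    have h2 := hψx ⟨θ, hθ⟩
    simp only at h1 h2
    rw [h1, h2, ← Real.dist_eq]
    exact (ContinuousMap.dist_apply_le_dist _).trans_lt hy2
  have hd : ContinuousOn (fun x => R x (2 * Real.pi) - x) (Icc a b) := by
    refine ContinuousOn.sub (fun x hx => ?_) continuousOn_id
    rw [ContinuousWithinAt, Metric.tendsto_nhds]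
    intro e he
    rw [eventually_nhdsWithin_iff]
    filter_upwards [hunif x hx e he] with y hy hyI
    rw [Real.dist_eq]
    exact hy hyI _ two_pi_mem
  have han : ∀ x ∈ Ioo a b, AnalyticAt ℝ (fun x => R x (2 * Real.pi) - x) x := by
    intro x hx
    obtain ⟨ψ, hψa, -, hψ⟩ := hψ x (Ioo_subset_Icc_self hx)
    have h1 : AnalyticAt ℝ (fun y => ContinuousMap.evalCLM ℝ
        (⟨2 * Real.pi, two_pi_mem⟩ : Icc 0 (4 * Real.pi)) (ψ y) - y) x :=
      (((ContinuousMap.evalCLM ℝ _ : C(Icc 0 (4 * Real.pi), ℝ) →L[ℝ] ℝ).analyticAt _).comp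
        hψa).fun_sub analyticAt_id
    refine h1.congr ?_
    filter_upwards [hψ, Ioo_mem_nhds hx.1 hx.2] with y hy hy2
    have := hy (Ioo_subset_Icc_self hy2) ⟨2 * Real.pi, two_pi_mem⟩
    simp only at this
    rw [this]
    rfl
  have haI : a ∈ Icc a b := ⟨le_rfl, hab.le⟩
  have hbI : b ∈ Icc a b := ⟨hab.le, le_rfl⟩
  obtain ⟨x₀, hx₀, hzero, η, hη, hsub, hleft, hright⟩ := exists_isolated_sign_change hab.le hd han
    (sub_pos.2 (ha _ (hR a haI).1 ((hR a haI).2 _ two_pi_mem)))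
    (sub_neg.2 (hb _ (hR b hbI).1 ((hR b hbI).2 _ two_pi_mem)))
  have hsub' : Ioo (x₀ - η) (x₀ + η) ⊆ Icc a b := hsub.trans Ioo_subset_Icc_self
  refine ⟨x₀, η, R, hη, fun x hx => (hR x (hsub' hx)).1, fun x hx => (hR x (hsub' hx)).2,
    fun x hx e he => ?_, ?_, sub_eq_zero.1 hzero, fun x hx => sub_pos.1 (hleft x hx),
    fun x hx => sub_neg.1 (hright x hx)⟩
  · filter_upwards [hunif x (hsub' hx) e he, Ioo_mem_nhds hx.1 hx.2] with y hy hy2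
    exact hy (hsub' hy2)
  -- By order preservation every solution of the tube lies below the one starting at `b`, so all of
  -- them stay in one compact set of angles and radii.
  · have hc : ContinuousOn (R b) (Icc 0 (4 * Real.pi)) := (hR b hbI).1.continuousOn
    obtain ⟨M, hM⟩ := (isCompact_Icc.image_of_continuousOn hc).bddAbove
    have hcomp : IsCompact (Icc 0 (4 * Real.pi) ×ˢ Icc 0 M) := isCompact_Icc.prod isCompact_Icc
    have hcont : Continuous fun z : ℝ × ℝ => w.angSpeed ε z.1 z.2 :=
      w.continuous_angSpeed.comp (Continuous.prodMk_right ε)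
    obtain ⟨K, hK⟩ := (hcomp.image hcont).bddAbove
    refine ⟨K, fun x hx θ hθ => hK ⟨(θ, R x θ), ⟨hθ, ((hR x (hsub' hx)).1.pos θ hθ).le, ?_⟩, rfl⟩⟩
    have hlt := (hR x (hsub' hx)).1.lt_of_lt (hR b hbI).1 (hsub hx).2 θ hθ
    exact hlt.le.trans (hM (mem_image_of_mem _ hθ))

namespace IsReturnTube

variable {O : Set (ℝ × ℝ)} {ε x₀ η : ℝ} {R : ℝ → ℝ → ℝ}

theorem center_mem (h : w.IsReturnTube O ε x₀ η R) : x₀ ∈ Ioo (x₀ - η) (x₀ + η) :=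
  ⟨by linarith [h.pos], by linarith [h.pos]⟩

theorem restrict (h : w.IsReturnTube O ε x₀ η R) {η' : ℝ} (h0 : 0 < η') (hη : η' ≤ η) :
    w.IsReturnTube O ε x₀ η' R := by
  have hs : Ioo (x₀ - η') (x₀ + η') ⊆ Ioo (x₀ - η) (x₀ + η) :=
    Ioo_subset_Ioo (by linarith) (by linarith)
  obtain ⟨K, hK⟩ := h.bdd
  exact ⟨h0, fun x hx => h.radial x (hs hx), fun x hx => h.mem x (hs hx),
    fun x hx => h.unif x (hs hx), ⟨K, fun x hx => hK x (hs hx)⟩, h.fixed,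
    fun x hx => h.left x ⟨by linarith [hx.1], hx.2⟩,
    fun x hx => h.right x ⟨hx.1, by linarith [hx.2]⟩⟩

theorem continuousAt_apply (h : w.IsReturnTube O ε x₀ η R) {x θ : ℝ}
    (hx : x ∈ Ioo (x₀ - η) (x₀ + η)) (hθ : θ ∈ Icc 0 (4 * Real.pi)) :
    ContinuousAt (fun y => R y θ) x := by
  rw [ContinuousAt, Metric.tendsto_nhds]
  intro e he
  filter_upwards [h.unif x hx e he] with y hy
  rw [Real.dist_eq]
  exact hy θ hθ

theorem return_left (h : w.IsReturnTube O ε x₀ η R) {x : ℝ} (hx : x ∈ Ioo (x₀ - η) x₀) :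
    R x (2 * Real.pi) ∈ Ioo x x₀ := by
  refine ⟨h.left x hx, ?_⟩
  have := (h.radial x ⟨hx.1, by linarith [hx.2, h.pos]⟩).lt_of_lt (h.radial x₀ h.center_mem) hx.2 _
    two_pi_mem
  rwa [h.fixed] at this

theorem return_right (h : w.IsReturnTube O ε x₀ η R) {x : ℝ} (hx : x ∈ Ioo x₀ (x₀ + η)) :
    R x (2 * Real.pi) ∈ Ioo x₀ x := by
  refine ⟨?_, h.right x hx⟩
  have := (h.radial x₀ h.center_mem).lt_of_lt (h.radial x ⟨by linarith [hx.1, h.pos], hx.2⟩) hx.1 _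
    two_pi_mem
  rwa [h.fixed] at this

theorem return_mem (h : w.IsReturnTube O ε x₀ η R) {x : ℝ} (hx : x ∈ Ioo (x₀ - η) (x₀ + η)) :
    R x (2 * Real.pi) ∈ Ioo (x₀ - η) (x₀ + η) := by
  rcases lt_trichotomy x x₀ with hlt | heq | hlt
  · have := h.return_left ⟨hx.1, hlt⟩
    exact ⟨by linarith [this.1, hx.1], by linarith [this.2, h.pos]⟩
  · rw [heq, h.fixed]
    exact h.center_mem
  · have := h.return_right ⟨hlt, hx.2⟩
    exact ⟨by linarith [this.1, h.pos], by linarith [this.2, hx.2]⟩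

/-- The sequence of the successive returns of a solution. -/
def returns (R : ℝ → ℝ → ℝ) (x : ℝ) (n : ℤ) : ℝ := (fun y => R y (2 * Real.pi))^[n.toNat] x

theorem returns_succ {x : ℝ} {n : ℤ} (hn : 0 ≤ n) :
    returns R x (n + 1) = R (returns R x n) (2 * Real.pi) := by
  obtain ⟨k, rfl⟩ := Int.eq_ofNat_of_zero_le hn
  have : ((k : ℤ) + 1).toNat = k + 1 := by omega
  simp only [returns, this, Function.iterate_succ_apply', Int.toNat_natCast]

theorem returns_center (h : w.IsReturnTube O ε x₀ η R) (n : ℤ) : returns R x₀ n = x₀ :=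
  Function.iterate_fixed h.fixed _

theorem iterate_mem (h : w.IsReturnTube O ε x₀ η R) {x : ℝ} (hx : x ∈ Ioo (x₀ - η) (x₀ + η))
    (n : ℕ) : (fun y => R y (2 * Real.pi))^[n] x ∈ Ioo (x₀ - η) (x₀ + η) := by
  induction n with
  | zero => exact hx
  | succ n ih => rw [Function.iterate_succ_apply']; exact h.return_mem ih

theorem returns_mem (h : w.IsReturnTube O ε x₀ η R) {x : ℝ} (hx : x ∈ Ioo (x₀ - η) (x₀ + η))
    (n : ℤ) : returns R x n ∈ Ioo (x₀ - η) (x₀ + η) := h.iterate_mem hx _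

theorem eq_center_of_fixed (h : w.IsReturnTube O ε x₀ η R) {x : ℝ}
    (hx : x ∈ Ioo (x₀ - η) (x₀ + η)) (hf : R x (2 * Real.pi) = x) : x = x₀ := by
  rcases lt_trichotomy x x₀ with hlt | heq | hlt
  · have := h.left x ⟨hx.1, hlt⟩; linarith
  · exact heq
  · have := h.right x ⟨hlt, hx.2⟩; linarith

/-- The returns are monotone and do not cross `x₀`, hence converge; the limit is a fixed point by
continuity, and `x₀` is the only one. -/
theorem tendsto_iterate (h : w.IsReturnTube O ε x₀ η R) {x : ℝ}
    (hx : x ∈ Ioo (x₀ - η) (x₀ + η)) :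
    Tendsto (fun n => (fun y => R y (2 * Real.pi))^[n] x) atTop (𝓝 x₀) := by
  set P : ℝ → ℝ := fun y => R y (2 * Real.pi) with hP
  have hlim : ∀ L, Tendsto (fun n => P^[n] x) atTop (𝓝 L) → L ∈ Ioo (x₀ - η) (x₀ + η) →
      Tendsto (fun n => P^[n] x) atTop (𝓝 x₀) := by
    intro L hL hLm
    have := isFixedPt_of_tendsto_iterate hL (h.continuousAt_apply hLm two_pi_mem)
    rwa [h.eq_center_of_fixed hLm this] at hL
  rcases lt_trichotomy x x₀ with hlt | heq | hlt
  · have hmem : ∀ n, P^[n] x ∈ Ico x x₀ := by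
      intro n
      induction n with
      | zero => exact ⟨le_rfl, hlt⟩
      | succ n ih =>
        rw [Function.iterate_succ_apply']
        have := h.return_left (x := P^[n] x) ⟨by linarith [ih.1, hx.1], ih.2⟩
        exact ⟨ih.1.trans this.1.le, this.2⟩
    have hmono : Monotone fun n => P^[n] x := monotone_nat_of_le_succ fun n => by
      rw [Function.iterate_succ_apply']
      exact (h.left _ ⟨by linarith [(hmem n).1, hx.1], (hmem n).2⟩).le
    have hbdd : BddAbove (range fun n => P^[n] x) :=
      ⟨x₀, by rintro _ ⟨n, rfl⟩; exact (hmem n).2.le⟩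
    refine hlim _ (tendsto_atTop_ciSup hmono hbdd) ⟨?_, ?_⟩
    · exact hx.1.trans_le (le_ciSup hbdd 0)
    · exact (ciSup_le fun n => (hmem n).2.le).trans_lt h.center_mem.2
  · refine hlim x₀ ?_ h.center_mem
    rw [heq]
    simp only [Function.iterate_fixed (show P x₀ = x₀ from h.fixed)]
    exact tendsto_const_nhds
  · have hmem : ∀ n, P^[n] x ∈ Ioc x₀ x := by
      intro n
      induction n with
      | zero => exact ⟨hlt, le_rfl⟩
      | succ n ih =>
        rw [Function.iterate_succ_apply']
        have := h.return_right (x := P^[n] x) ⟨ih.1, by linarith [ih.2, hx.2]⟩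
        exact ⟨this.1, this.2.le.trans ih.2⟩
    have hanti : Antitone fun n => P^[n] x := antitone_nat_of_succ_le fun n => by
      rw [Function.iterate_succ_apply']
      exact (h.right _ ⟨(hmem n).1, by linarith [(hmem n).2, hx.2]⟩).le
    have hbdd : BddBelow (range fun n => P^[n] x) :=
      ⟨x₀, by rintro _ ⟨n, rfl⟩; exact (hmem n).1.le⟩
    refine hlim _ (tendsto_atTop_ciInf hanti hbdd) ⟨?_, ?_⟩
    · exact h.center_mem.1.trans_le (le_ciInf fun n => (hmem n).1.le)
    · exact (ciInf_le hbdd 0).trans_lt hx.2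

/-- The solution obtained by following the successive returns. -/
def concat (R : ℝ → ℝ → ℝ) (x θ : ℝ) : ℝ :=
  R (returns R x ⌊θ / (2 * Real.pi)⌋) (θ - ⌊θ / (2 * Real.pi)⌋ * (2 * Real.pi))

theorem sub_floor_mem (θ : ℝ) :
    θ - ⌊θ / (2 * Real.pi)⌋ * (2 * Real.pi) ∈ Ico 0 (2 * Real.pi) := by
  have h1 := Int.floor_le (θ / (2 * Real.pi))
  have h2 := Int.lt_floor_add_one (θ / (2 * Real.pi))
  rw [le_div_iff₀ Real.two_pi_pos] at h1
  rw [div_lt_iff₀ Real.two_pi_pos] at h2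
  constructor <;> linarith

/-- Each solution lives on two turns, so consecutive pieces overlap on a whole turn, where they
agree by uniqueness. The recursion is a hypothesis because `returns` uses `toNat` and satisfies it
for negative `k` only in special cases, such as at `x₀`. -/
theorem concat_eq (h : w.IsReturnTube O ε x₀ η R) {x θ : ℝ} (hx : x ∈ Ioo (x₀ - η) (x₀ + η))
    {k : ℤ} (hk : returns R x (k + 1) = R (returns R x k) (2 * Real.pi))
    (hθ : θ - k * (2 * Real.pi) ∈ Ico 0 (4 * Real.pi)) :
    concat R x θ = R (returns R x k) (θ - k * (2 * Real.pi)) := by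
  have hpi := Real.two_pi_pos
  rcases lt_or_ge (θ - k * (2 * Real.pi)) (2 * Real.pi) with hlt | hge
  · have : ⌊θ / (2 * Real.pi)⌋ = k := by
      rw [Int.floor_eq_iff, le_div_iff₀ hpi, div_lt_iff₀ hpi]
      constructor <;> linarith [hθ.1]
    rw [concat, this]
  · have : ⌊θ / (2 * Real.pi)⌋ = k + 1 := by
      rw [Int.floor_eq_iff, le_div_iff₀ hpi, div_lt_iff₀ hpi]
      push_cast
      constructor <;> linarith [hθ.2]
    rw [concat, this, hk]
    have hr := h.radial _ (h.returns_mem hx k)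
    have hs : w.IsRadial (2 * Real.pi) ε (R (returns R x k) (2 * Real.pi)) _ :=
      IsRadial.shift (T := 2 * Real.pi) (by convert hr using 1; ring)
    have hr' := (h.radial _ (h.return_mem (h.returns_mem hx k))).mono two_pi_mem.2
    have hmem : θ - ((k + 1 : ℤ) : ℝ) * (2 * Real.pi) ∈ Icc 0 (2 * Real.pi) := by
      push_cast
      constructor <;> linarith [hθ.2]
    rw [hr'.eqOn hs hmem]
    push_cast
    ring_nf

theorem exists_turn (θ : ℝ) : ∃ k : ℤ, θ - k * (2 * Real.pi) ∈ Ioc 0 (2 * Real.pi) := by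
  refine ⟨⌈θ / (2 * Real.pi)⌉ - 1, ?_⟩
  have h1 := Int.le_ceil (θ / (2 * Real.pi))
  have h2 := Int.ceil_lt_add_one (θ / (2 * Real.pi))
  rw [div_le_iff₀ Real.two_pi_pos] at h1
  have h2' : (⌈θ / (2 * Real.pi)⌉ - 1 : ℝ) < θ / (2 * Real.pi) := by linarith
  rw [lt_div_iff₀ Real.two_pi_pos] at h2'
  push_cast
  constructor <;> linarith

/-- The angles at which `concat R x` solves the radial equation. -/
def IsGoodAngle (R : ℝ → ℝ → ℝ) (x θ : ℝ) : Prop :=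
  ∃ k : ℤ, θ - k * (2 * Real.pi) ∈ Ioo 0 (4 * Real.pi) ∧
    returns R x (k + 1) = R (returns R x k) (2 * Real.pi)

theorem isGoodAngle_of_pos {x θ : ℝ} (hθ : 0 < θ) : IsGoodAngle R x θ := by
  obtain ⟨k, hk⟩ := exists_turn θ
  refine ⟨k, ⟨hk.1, by linarith [hk.2, Real.pi_pos]⟩, returns_succ ?_⟩
  by_contra hneg
  have h1 : (k : ℝ) ≤ -1 := by exact_mod_cast (by omega : k ≤ -1)
  nlinarith [hk.2, Real.two_pi_pos]

theorem isGoodAngle_center (h : w.IsReturnTube O ε x₀ η R) (θ : ℝ) : IsGoodAngle R x₀ θ := by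
  obtain ⟨k, hk⟩ := exists_turn θ
  refine ⟨k, ⟨hk.1, by linarith [hk.2, Real.pi_pos]⟩, ?_⟩
  rw [h.returns_center, h.returns_center, h.fixed]

/-- Near a good angle a single two-turn solution represents `concat`, even across a multiple of
`2π`; thus there are no corners at the gluing points. -/
theorem concat_spec (h : w.IsReturnTube O ε x₀ η R) {x θ : ℝ} (hx : x ∈ Ioo (x₀ - η) (x₀ + η))
    (hθ : IsGoodAngle R x θ) :
    ContinuousAt (concat R x) θ ∧ 0 < w.angSpeed ε θ (concat R x θ) ∧
      HasDerivAt (fun θ => polarMap w.c (θ, concat R x θ)) ((w.angSpeed ε θ (concat R x θ))⁻¹ •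
        w.field ε (polarMap w.c (θ, concat R x θ))) θ := by
  obtain ⟨k, hk, hret⟩ := hθ
  have hr := h.radial _ (h.returns_mem hx k)
  have hev : concat R x =ᶠ[𝓝 θ] fun t => R (returns R x k) (t - k * (2 * Real.pi)) := by
    have : ∀ᶠ t in 𝓝 θ, t - k * (2 * Real.pi) ∈ Ioo 0 (4 * Real.pi) :=
      (continuous_id.sub continuous_const).continuousAt.eventually (isOpen_Ioo.mem_nhds hk)
    filter_upwards [this] with t ht
    exact h.concat_eq hx hret (Ioo_subset_Ico_self ht)
  have hkI := Ioo_subset_Icc_self hk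
  have hval := hev.self_of_nhds
  refine ⟨?_, ?_, ?_⟩
  · refine ContinuousAt.congr ?_ hev.symm
    exact ContinuousAt.comp (g := R (returns R x k)) (f := fun t => t - k * (2 * Real.pi))
      (hr.deriv _ hkI).continuousAt (by fun_prop)
  · rw [hval, ← angSpeed_sub_int w ε θ _ k]
    exact hr.angPos _ hkI
  · have h1 := (hr.hasDerivAt_polarMap hkI).comp_sub_const θ (k * (2 * Real.pi))
    simp only [angSpeed_sub_int, polarMap_sub_int, ← hval] at h1
    refine h1.congr_of_eventuallyEq ?_
    filter_upwards [hev] with t ht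
    rw [ht]

theorem angSpeed_concat_le (h : w.IsReturnTube O ε x₀ η R) : ∃ K, 0 < K ∧
    ∀ x ∈ Ioo (x₀ - η) (x₀ + η), ∀ θ, w.angSpeed ε θ (concat R x θ) ≤ K := by
  obtain ⟨K, hK⟩ := h.bdd
  have hK' : ∀ x ∈ Ioo (x₀ - η) (x₀ + η), ∀ θ, w.angSpeed ε θ (concat R x θ) ≤ K := by
    intro x hx θ
    have hθ := sub_floor_mem θ
    rw [← angSpeed_sub_int w ε θ _ ⌊θ / (2 * Real.pi)⌋]
    exact hK _ (h.returns_mem hx _) _ ⟨hθ.1, by linarith [hθ.2, Real.pi_pos]⟩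
  refine ⟨K, ?_, hK'⟩
  exact (h.concat_spec h.center_mem (h.isGoodAngle_center 0)).2.1.trans_le
    (hK' x₀ h.center_mem 0)

/-- The forward orbit of a point of the tube. -/
theorem exists_forward (h : w.IsReturnTube O ε x₀ η R) {x s : ℝ}
    (hx : x ∈ Ioo (x₀ - η) (x₀ + η)) (hs : 0 < s) :
    ∃ (c : ℝ → ℝ × ℝ) (τ : ℝ ≃o ℝ), τ 0 = s ∧
      IsIntegralCurveOn c (fun _ => w.field ε) (Ici 0) ∧
      ∀ t, c t = polarMap w.c (τ t, concat R x (τ t)) := by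
  obtain ⟨K, hK0, hK⟩ := h.angSpeed_concat_le
  -- The time change needs a speed on the whole line, but `concat` is controlled only at positive
  -- angles; replacing `θ` by `max θ s` leaves forward times unaffected.
  have hpos : ∀ θ, 0 < max θ s := fun θ => hs.trans_le (le_max_right _ _)
  have hspec := fun θ => h.concat_spec hx (isGoodAngle_of_pos (R := R) (x := x) (hpos θ))
  have hκ : Continuous fun θ => (w.angSpeed ε (max θ s) (concat R x (max θ s)))⁻¹ := by
    have h1 : Continuous fun θ => concat R x (max θ s) := continuous_iff_continuousAt.2 fun θ =>
      ContinuousAt.comp (g := concat R x) (f := fun θ => max θ s) (hspec θ).1 (by fun_prop)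
    have h2 : Continuous fun θ => w.angSpeed ε (max θ s) (concat R x (max θ s)) :=
      w.continuous_angSpeed.comp
        (continuous_const.prodMk ((continuous_id.max continuous_const).prodMk h1))
    exact h2.inv₀ fun θ => (hspec θ).2.1.ne'
  obtain ⟨τ, hτ0, hτ⟩ := exists_timeChange hκ (inv_pos.2 hK0)
    (fun θ => inv_anti₀ (hspec θ).2.1 (hK x hx _)) s
  refine ⟨fun t => polarMap w.c (τ t, concat R x (τ t)), τ, hτ0, fun t ht => ?_, fun t => rfl⟩
  have hst : s ≤ τ t := by rw [← hτ0]; exact τ.monotone ht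
  have h1 := (hspec (τ t)).2.2
  have h2 := hτ t
  have h3 := (hspec (τ t)).2.1.ne'
  rw [max_eq_left hst] at h1 h2 h3
  refine HasDerivAt.hasDerivWithinAt ?_
  refine (HasDerivAt.scomp (g₁ := fun θ => polarMap w.c (θ, concat R x θ)) t h1 h2).congr_deriv ?_
  rw [inv_inv, smul_smul, mul_inv_cancel₀ h3, one_smul]

/-- The periodic orbit of the tube. -/
theorem exists_periodic (h : w.IsReturnTube O ε x₀ η R) :
    ∃ (c : ℝ → ℝ × ℝ) (τ : ℝ ≃o ℝ), τ 0 = 0 ∧ IsIntegralCurve c (fun _ => w.field ε) ∧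
      ∀ t, c t = polarMap w.c (τ t, concat R x₀ (τ t)) := by
  obtain ⟨K, hK0, hK⟩ := h.angSpeed_concat_le
  have hspec := fun θ => h.concat_spec h.center_mem (h.isGoodAngle_center θ)
  have hκ : Continuous fun θ => (w.angSpeed ε θ (concat R x₀ θ))⁻¹ := by
    have h1 : Continuous (concat R x₀) := continuous_iff_continuousAt.2 fun θ => (hspec θ).1
    have h2 : Continuous fun θ => w.angSpeed ε θ (concat R x₀ θ) :=
      w.continuous_angSpeed.comp (continuous_const.prodMk (continuous_id.prodMk h1))
    exact h2.inv₀ fun θ => (hspec θ).2.1.ne'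
  obtain ⟨τ, hτ0, hτ⟩ := exists_timeChange hκ (inv_pos.2 hK0)
    (fun θ => inv_anti₀ (hspec θ).2.1 (hK x₀ h.center_mem _)) 0
  refine ⟨fun t => polarMap w.c (τ t, concat R x₀ (τ t)), τ, hτ0, fun t => ?_, fun t => rfl⟩
  have h3 := (hspec (τ t)).2.1.ne'
  refine (HasDerivAt.scomp (g₁ := fun θ => polarMap w.c (θ, concat R x₀ θ)) t (hspec (τ t)).2.2
    (hτ t)).congr_deriv ?_
  rw [inv_inv, smul_smul, mul_inv_cancel₀ h3, one_smul]

end IsReturnTube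

/-! ### The limit cycle and its attraction -/

namespace IsReturnTube

variable {O : Set (ℝ × ℝ)} {ε x₀ η : ℝ} {R : ℝ → ℝ → ℝ}

/-- The neighbourhood of the periodic orbit that is swept by the tube. -/
def sweep (w : Well) (x₀ η : ℝ) (R : ℝ → ℝ → ℝ) : Set (ℝ × ℝ) :=
  polarMap w.c '' {z | z.1 ∈ Ioo 0 (4 * Real.pi) ∧ ∃ x ∈ Ioo (x₀ - η) (x₀ + η), z.2 = R x z.1}

/-- The periodic orbit at the centre of the tube. -/
def cycle (w : Well) (x₀ : ℝ) (R : ℝ → ℝ → ℝ) : Set (ℝ × ℝ) :=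
  (fun θ => polarMap w.c (θ, R x₀ θ)) '' Icc 0 (2 * Real.pi)

/-- Any point lies strictly between two radial solutions of the tube; nearby points do too, and the
intermediate value theorem in the initial radius puts them on a solution. The open interval of two
turns covers the circle without a seam. -/
theorem isOpen_sweep (h : w.IsReturnTube O ε x₀ η R) : IsOpen (sweep w x₀ η R) := by
  refine isOpen_image_polarMap _ ?_ ?_
  · rw [isOpen_iff_mem_nhds]
    rintro ⟨θ, r⟩ ⟨hθ, x, hx, hr⟩
    simp only at hθ hr
    set y := ((x₀ - η) + x) / 2 with hy
    set z := ((x₀ + η) + x) / 2 with hz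
    have hyI : y ∈ Ioo (x₀ - η) (x₀ + η) := ⟨by linarith [hx.1], by linarith [hx.1, hx.2]⟩
    have hzI : z ∈ Ioo (x₀ - η) (x₀ + η) := ⟨by linarith [hx.1, hx.2], by linarith [hx.2]⟩
    have hyx : y < x := by linarith [hx.1]
    have hxz : x < z := by linarith [hx.2]
    have hθI := Ioo_subset_Icc_self hθ
    have hcont : ∀ u ∈ Ioo (x₀ - η) (x₀ + η),
        ContinuousAt (fun p : ℝ × ℝ => R u p.1) (θ, r) := fun u hu =>
      ContinuousAt.comp (g := R u) (f := Prod.fst) (x := (θ, r))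
        ((h.radial u hu).deriv θ hθI).continuousAt continuousAt_fst
    have h1 : ∀ᶠ p : ℝ × ℝ in 𝓝 (θ, r), R y p.1 < p.2 :=
      (hcont y hyI).eventually_lt continuousAt_snd
        (by simp only [hr]; exact (h.radial y hyI).lt_of_lt (h.radial x hx) hyx θ hθI)
    have h2 : ∀ᶠ p : ℝ × ℝ in 𝓝 (θ, r), p.2 < R z p.1 :=
      continuousAt_snd.eventually_lt (hcont z hzI)
        (by simp only [hr]; exact (h.radial x hx).lt_of_lt (h.radial z hzI) hxz θ hθI)
    have h3 : ∀ᶠ p : ℝ × ℝ in 𝓝 (θ, r), p.1 ∈ Ioo 0 (4 * Real.pi) :=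
      continuousAt_fst.eventually (isOpen_Ioo.mem_nhds hθ)
    filter_upwards [h1, h2, h3] with p hp1 hp2 hp3
    have hsub : Icc y z ⊆ Ioo (x₀ - η) (x₀ + η) := fun u hu =>
      ⟨hyI.1.trans_le hu.1, hu.2.trans_lt hzI.2⟩
    obtain ⟨u, hu, hup⟩ := intermediate_value_Icc (hyx.trans hxz).le
      (f := fun u => R u p.1)
      (fun u hu => (h.continuousAt_apply (hsub hu)
        (Ioo_subset_Icc_self hp3)).continuousWithinAt) ⟨hp1.le, hp2.le⟩
    exact ⟨hp3, u, hsub hu, hup.symm⟩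
  · rintro ⟨θ, r⟩ ⟨hθ, x, hx, hr⟩
    simp only at hθ hr ⊢
    rw [hr]
    exact (h.radial x hx).pos θ (Ioo_subset_Icc_self hθ)

theorem isCompact_cycle (h : w.IsReturnTube O ε x₀ η R) : IsCompact (cycle w x₀ R) := by
  refine isCompact_Icc.image_of_continuousOn fun θ hθ => ?_
  exact ((h.radial x₀ h.center_mem).hasDerivAt_polarMap
    ⟨hθ.1, hθ.2.trans two_pi_mem.2⟩).continuousAt.continuousWithinAt

theorem cycle_subset (h : w.IsReturnTube O ε x₀ η R) : cycle w x₀ R ⊆ O := by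
  rintro _ ⟨θ, hθ, rfl⟩
  exact h.mem x₀ h.center_mem θ ⟨hθ.1, hθ.2.trans two_pi_mem.2⟩

/-- Every point of the forward solution lies on one of the returns, at an angle of the first turn. -/
theorem polarMap_concat (x θ : ℝ) :
    polarMap w.c (θ, concat R x θ) = polarMap w.c (θ - ⌊θ / (2 * Real.pi)⌋ * (2 * Real.pi),
      R (returns R x ⌊θ / (2 * Real.pi)⌋) (θ - ⌊θ / (2 * Real.pi)⌋ * (2 * Real.pi))) := by
  rw [polarMap_sub_int]
  rfl

theorem concat_mem_cycle (h : w.IsReturnTube O ε x₀ η R) (θ : ℝ) :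
    polarMap w.c (θ, concat R x₀ θ) ∈ cycle w x₀ R := by
  rw [polarMap_concat, h.returns_center]
  exact mem_image_of_mem _ (Ico_subset_Icc_self (sub_floor_mem θ))

theorem range_periodic (h : w.IsReturnTube O ε x₀ η R) {c : ℝ → ℝ × ℝ} {τ : ℝ ≃o ℝ}
    (hc : ∀ t, c t = polarMap w.c (τ t, concat R x₀ (τ t))) : range c = cycle w x₀ R := by
  apply Subset.antisymm
  · rintro _ ⟨t, rfl⟩
    rw [hc]
    exact h.concat_mem_cycle _
  · rintro _ ⟨θ, hθ, rfl⟩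
    refine ⟨τ.symm θ, ?_⟩
    have hret : returns R x₀ (0 + 1) = R (returns R x₀ 0) (2 * Real.pi) := returns_succ le_rfl
    have := h.concat_eq (θ := θ) h.center_mem hret
      (by simp only [Int.cast_zero, zero_mul, sub_zero]
          exact ⟨hθ.1, by linarith [hθ.2, Real.pi_pos]⟩)
    rw [hc, τ.apply_symm_apply, this, h.returns_center]
    simp

theorem cycle_subset_sweep (h : w.IsReturnTube O ε x₀ η R) :
    cycle w x₀ R ⊆ sweep w x₀ η R := by
  rintro _ ⟨θ, hθ, rfl⟩
  rcases hθ.1.eq_or_lt with h0 | h0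
  -- The point at angle `0` is reached at the interior angle `2π`.
  · refine ⟨(2 * Real.pi, R x₀ (2 * Real.pi)), ⟨⟨Real.two_pi_pos, by
      simp only; linarith [Real.pi_pos]⟩, x₀, h.center_mem, rfl⟩, ?_⟩
    simp only [← h0, h.fixed, (h.radial x₀ h.center_mem).init]
    simp [polarMap]
  · exact ⟨(θ, R x₀ θ), ⟨⟨h0, by simp only; linarith [hθ.2, Real.pi_pos]⟩, x₀, h.center_mem, rfl⟩,
      rfl⟩

theorem concat_of_mem_Ioo (h : w.IsReturnTube O ε x₀ η R) {x θ : ℝ}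
    (hx : x ∈ Ioo (x₀ - η) (x₀ + η)) (hθ : θ ∈ Ioo 0 (4 * Real.pi)) : concat R x θ = R x θ := by
  have hret : returns R x (0 + 1) = R (returns R x 0) (2 * Real.pi) := returns_succ le_rfl
  have := h.concat_eq (θ := θ) hx hret
    (by simp only [Int.cast_zero, zero_mul, sub_zero]; exact Ioo_subset_Ico_self hθ)
  rw [this]
  simp [returns]

/-- Each point of the swept neighbourhood starts a forward solution. -/
theorem exists_forward_of_mem_sweep (h : w.IsReturnTube O ε x₀ η R) {p : ℝ × ℝ}
    (hp : p ∈ sweep w x₀ η R) :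
    ∃ x ∈ Ioo (x₀ - η) (x₀ + η), ∃ (c : ℝ → ℝ × ℝ) (τ : ℝ ≃o ℝ), 0 < τ 0 ∧ c 0 = p ∧
      IsIntegralCurveOn c (fun _ => w.field ε) (Ici 0) ∧
      ∀ t, c t = polarMap w.c (τ t, concat R x (τ t)) := by
  obtain ⟨⟨θ, r⟩, ⟨hθ, x, hx, hr⟩, rfl⟩ := hp
  simp only at hθ hr
  obtain ⟨c, τ, hτ, hc, hcτ⟩ := h.exists_forward hx hθ.1
  refine ⟨x, hx, c, τ, by rw [hτ]; exact hθ.1, ?_, hc, hcτ⟩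
  rw [hcτ, hτ, h.concat_of_mem_Ioo hx hθ, hr]

theorem isClosedOrbit_cycle (h : w.IsReturnTube O ε x₀ η R) :
    IsClosedOrbit (w.field ε) (cycle w x₀ R) := by
  obtain ⟨c, τ, hτ0, hc, hcτ⟩ := h.exists_periodic
  set T := τ.symm (2 * Real.pi) with hT
  have hτT : τ T = 2 * Real.pi := τ.apply_symm_apply _
  have hT0 : 0 < T := by
    rw [← τ.lt_iff_lt, hτ0, hτT]
    exact Real.two_pi_pos
  have hx₀ : 0 < x₀ := by
    have := (h.radial x₀ h.center_mem).pos 0 ⟨le_rfl, by positivity⟩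
    rwa [(h.radial x₀ h.center_mem).init] at this
  have hc0 : c 0 = (w.c + x₀, 0) := by
    have hret : returns R x₀ (0 + 1) = R (returns R x₀ 0) (2 * Real.pi) := returns_succ le_rfl
    have := h.concat_eq (θ := 0) h.center_mem hret (by simp [Real.pi_pos])
    rw [hcτ, hτ0, this, h.returns_center]
    simp [polarMap, (h.radial x₀ h.center_mem).init]
  refine ⟨c, T, hT0, hc, periodic_of_isIntegralCurve (w.contDiff_field ε) hc ?_, ?_,
    h.range_periodic hcτ⟩
  · rw [hc0, hcτ, hτT, h.concat_of_mem_Ioo h.center_mem ⟨Real.two_pi_pos, by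
      linarith [Real.pi_pos]⟩, h.fixed]
    simp [polarMap]
  · refine ⟨τ.symm Real.pi, fun heq => ?_⟩
    have hpi : Real.pi ∈ Ioo 0 (4 * Real.pi) := ⟨Real.pi_pos, by linarith [Real.pi_pos]⟩
    have hRpi := (h.radial x₀ h.center_mem).pos Real.pi (Ioo_subset_Icc_self hpi)
    rw [hc0, hcτ, τ.apply_symm_apply, h.concat_of_mem_Ioo h.center_mem hpi] at heq
    have := congrArg Prod.fst heq
    simp [polarMap] at this
    linarith

/-- A closed orbit meeting the swept neighbourhood follows a tube solution forward in time, and its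
returns to the positive ray tend to the point of the cycle there. Being compact, the orbit contains
that point, and uniqueness identifies the two orbits. -/
theorem isLimitCycle_cycle (h : w.IsReturnTube O ε x₀ η R) :
    IsLimitCycle (w.field ε) (cycle w x₀ R) := by
  refine ⟨h.isClosedOrbit_cycle, sweep w x₀ η R, h.isOpen_sweep, h.cycle_subset_sweep, ?_⟩
  rintro Γ ⟨c', T, hT, hc', hper, -, hrange⟩ ⟨p, hpΓ, hpU⟩
  obtain ⟨x, hx, c, τ, hτ0, hc0, hc, hcτ⟩ := h.exists_forward_of_mem_sweep hpU
  rw [← hrange] at hpΓ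
  obtain ⟨t₀, ht₀⟩ := hpΓ
  have hshift : ∀ s, IsIntegralCurve (fun t => c' (t + s)) (fun _ => w.field ε) := fun s t => by
    simpa using (hc' (t + s)).comp_add_const t s
  have heq := eqOn_Ici_of_isIntegralCurveOn (w.contDiff_field ε)
    ((hshift t₀).isIntegralCurveOn (Ici 0)) hc (by simp [ht₀, hc0])
  have hcompact : IsClosed Γ := by
    have h1 : range c' = c' '' Icc 0 (0 + T) := (hper.image_Icc hT 0).symm
    rw [← hrange, h1]
    exact (isCompact_Icc.image hc'.continuous).isClosed
  have hmem : (w.c + x₀, (0 : ℝ)) ∈ Γ := by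
    have htend : Tendsto (fun n : ℕ => (w.c + (fun y => R y (2 * Real.pi))^[n] x, (0 : ℝ))) atTop
        (𝓝 (w.c + x₀, 0)) :=
      ((h.tendsto_iterate hx).const_add w.c).prodMk_nhds tendsto_const_nhds
    refine hcompact.mem_of_tendsto htend ?_
    -- The starting angle may lie beyond the first returns, so only returns after it occur at
    -- nonnegative times.
    obtain ⟨N, hN⟩ := exists_nat_ge (τ 0 / (2 * Real.pi))
    filter_upwards [eventually_ge_atTop N] with n hn
    have hn' : τ 0 ≤ n * (2 * Real.pi) := by
      rw [div_le_iff₀ Real.two_pi_pos] at hN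
      have : (N : ℝ) ≤ n := by exact_mod_cast hn
      nlinarith [Real.two_pi_pos]
    set t := τ.symm (n * (2 * Real.pi)) with ht
    have ht0 : 0 ≤ t := by
      rw [← τ.le_iff_le, ht, τ.apply_symm_apply]
      exact hn'
    have hret : returns R x ((n : ℤ) + 1) = R (returns R x n) (2 * Real.pi) :=
      returns_succ (Int.natCast_nonneg n)
    have hval := h.concat_eq (θ := n * (2 * Real.pi)) hx hret (by simp [Real.pi_pos])
    have : c' (t + t₀) = (w.c + (fun y => R y (2 * Real.pi))^[n] x, (0 : ℝ)) := by
      rw [show c' (t + t₀) = c t from heq ht0, hcτ, ht, τ.apply_symm_apply, hval]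
      simp only [Int.cast_natCast, sub_self,
        (h.radial _ (h.returns_mem hx n)).init]
      have hsin : Real.sin (n * (2 * Real.pi)) = 0 := by
        have := Real.sin_nat_mul_pi (n * 2)
        rwa [Nat.cast_mul, mul_assoc, Nat.cast_ofNat] at this
      simp [polarMap, returns, hsin]
    rw [← this, ← hrange]
    exact mem_range_self _
  rw [← hrange] at hmem
  obtain ⟨t₁, ht₁⟩ := hmem
  obtain ⟨c₀, τ₀, hτ₀0, hc₀, hcτ₀⟩ := h.exists_periodic
  have hc₀0 : c₀ 0 = (w.c + x₀, 0) := by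
    have hret : returns R x₀ (0 + 1) = R (returns R x₀ 0) (2 * Real.pi) := returns_succ le_rfl
    have := h.concat_eq (θ := 0) h.center_mem hret (by simp [Real.pi_pos])
    rw [hcτ₀, hτ₀0, this, h.returns_center]
    simp [polarMap, (h.radial x₀ h.center_mem).init]
  have heq2 := eq_of_isIntegralCurve (w.contDiff_field ε) (hshift t₁) hc₀ (by simp [ht₁, hc₀0])
  rw [← hrange, ← h.range_periodic hcτ₀, ← heq2]
  exact ((Equiv.addRight t₁).surjective.range_comp c').symm

theorem isAttracting_cycle (h : w.IsReturnTube O ε x₀ η R) :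
    IsAttracting (w.field ε) (cycle w x₀ R) := by
  intro U hU hΓU
  obtain ⟨δ, hδ, hδU⟩ := h.isCompact_cycle.exists_thickening_subset_open hU hΓU
  obtain ⟨η₁, hη₁, hclose⟩ := Metric.eventually_nhds_iff.1 (h.unif x₀ h.center_mem δ hδ)
  -- The smaller tube is invariant under the return map and all its solutions stay within `δ` of the
  -- cycle, so stability needs no further estimate.
  have h' := h.restrict (lt_min hη₁ h.pos) (min_le_right η₁ η)
  set η' := min η₁ η
  refine ⟨sweep w x₀ η' R, h'.isOpen_sweep, h'.cycle_subset_sweep, fun p hp => ?_⟩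
  obtain ⟨x, hx, c, τ, hτ0, hc0, hc, hcτ⟩ := h'.exists_forward_of_mem_sweep hp
  have hdist : ∀ {e : ℝ} {y θ : ℝ}, θ ∈ Ico 0 (2 * Real.pi) →
      (∀ θ ∈ Icc 0 (4 * Real.pi), |R y θ - R x₀ θ| < e) →
      dist (polarMap w.c (θ, R y θ)) (polarMap w.c (θ, R x₀ θ)) < e ∧
        polarMap w.c (θ, R x₀ θ) ∈ cycle w x₀ R := by
    intro e y θ hθ hy
    exact ⟨(dist_polarMap_le _ _ _ _).trans_lt (hy θ ⟨hθ.1, by linarith [hθ.2, Real.pi_pos]⟩),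
      mem_image_of_mem _ (Ico_subset_Icc_self hθ)⟩
  refine ⟨c, hc0, hc, fun t _ => ?_, ?_⟩
  · apply hδU
    rw [hcτ, polarMap_concat]
    set k := ⌊τ t / (2 * Real.pi)⌋
    have hk := h'.returns_mem hx k
    have hk' : dist (returns R x k) x₀ < η₁ := by
      have := min_le_left η₁ η
      rw [Real.dist_eq, abs_lt]
      constructor <;> linarith [hk.1, hk.2]
    obtain ⟨h1, h2⟩ := hdist (sub_floor_mem (τ t)) (hclose hk')
    exact Metric.mem_thickening_iff.2 ⟨_, h2, h1⟩
  · rw [Metric.tendsto_nhds]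
    intro e he
    have hfl : Tendsto (fun t => (⌊τ t / (2 * Real.pi)⌋).toNat) atTop atTop := by
      have h1 : Tendsto (fun t => τ t / (2 * Real.pi)) atTop atTop :=
        τ.tendsto_atTop.atTop_div_const Real.two_pi_pos
      have h2 := tendsto_floor_atTop.comp h1
      have h3 : Tendsto Int.toNat atTop atTop := by
        refine tendsto_atTop.2 fun n => ?_
        filter_upwards [eventually_ge_atTop (n : ℤ)] with k hk
        omega
      exact h3.comp h2
    have hev := ((h'.tendsto_iterate hx).comp hfl).eventually (h.unif x₀ h.center_mem e he)
    filter_upwards [hev] with t ht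
    rw [Real.dist_eq, sub_zero, abs_of_nonneg Metric.infDist_nonneg]
    obtain ⟨h1, h2⟩ := hdist (sub_floor_mem (τ t)) ht
    refine (Metric.infDist_le_dist_of_mem h2).trans_lt ?_
    rw [hcτ, polarMap_concat]
    exact h1

end IsReturnTube

/-! ### From signs of the Abelian integral to cycles -/

/-- The points of the strip `A < x - c < B` with energy in `(e, f)`. -/
def annulus (w : Well) (A B e f : ℝ) : Set (ℝ × ℝ) :=
  {p | p.1 - w.c ∈ Ioo A B ∧ w.energy p ∈ Ioo e f}

theorem isOpen_annulus (w : Well) (A B e f : ℝ) : IsOpen (w.annulus A B e f) :=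
  (isOpen_Ioo.preimage (continuous_fst.sub continuous_const)).inter
    (isOpen_Ioo.preimage w.continuous_energy)

theorem polarMap_two_pi (c r : ℝ) : polarMap c (2 * Real.pi, r) = polarMap c (0, r) := by
  simp [polarMap]

/-- The change of the energy along one turn. -/
theorem IsRadial.energy_sub_energy {ε x : ℝ} {R : ℝ → ℝ} (h : w.IsRadial (4 * Real.pi) ε x R) :
    w.energy (polarMap w.c (0, R (2 * Real.pi))) - w.energy (polarMap w.c (0, x)) =
      ε * ∫ θ in (0 : ℝ)..2 * Real.pi, w.energyRate ε θ (R θ) := by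
  have hsub : uIcc 0 (2 * Real.pi) ⊆ Icc 0 (4 * Real.pi) := by
    rw [uIcc_of_le Real.two_pi_pos.le]
    exact Icc_subset_Icc_right two_pi_mem.2
  have hR : ContinuousOn R (uIcc 0 (2 * Real.pi)) := h.continuousOn.mono hsub
  have hF := w.continuousOn_force (ε := ε) hR
  have hint : ContinuousOn (fun θ => ε * w.energyRate ε θ (R θ)) (uIcc 0 (2 * Real.pi)) := by
    refine continuousOn_const.mul (ContinuousOn.div ?_ ?_ fun θ hθ => (h.angPos θ (hsub hθ)).ne')
    · unfold polarMap pert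
      fun_prop
    · unfold angSpeed
      fun_prop
  have := intervalIntegral.integral_eq_sub_of_hasDerivAt
    (fun θ hθ => h.hasDerivAt_energy (hsub hθ)) hint.intervalIntegrable
  rw [polarMap_two_pi, h.init] at this
  rw [← this, ← intervalIntegral.integral_const_mul]
  rfl

variable {A B e f : ℝ}

theorem IsLevel.radius_zero_mem (hl : w.IsLevel A B e) : hl.radius 0 ∈ Ioo A B := by
  simpa using hl.radius_mem 0

/-- Translates the sign of the energy change over a turn into the sign of the displacement of the
radius. -/
theorem IsLevel.energy_lt_energy_iff (hl : w.IsLevel A B e) {r s : ℝ} (hr : 0 < r) (hs : 0 < s)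
    (hrI : r ∈ Icc A B) (hsI : s ∈ Icc A B) :
    w.energy (polarMap w.c (0, r)) < w.energy (polarMap w.c (0, s)) ↔ r < s := by
  have key : ∀ {r s : ℝ}, 0 < r → s ∈ Icc A B → r < s →
      w.energy (polarMap w.c (0, r)) < w.energy (polarMap w.c (0, s)) := fun hr hs hrs =>
    energy_lt_energy hl.left_neg.le hl.right_pos.le hl.stiffness_pos hr.le hrs (by simpa using hs)
  refine ⟨fun h => ?_, key hr hsI⟩
  by_contra hge
  rcases (not_lt.1 hge).eq_or_lt with h1 | h1
  · rw [h1] at h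
    exact lt_irrefl _ h
  · exact lt_asymm h (key hs hrI h1)

theorem IsLevel.isLevel_of_mem (le : w.IsLevel A B e) (lf : w.IsLevel A B f) {g : ℝ}
    (hg : g ∈ Icc e f) : w.IsLevel A B g :=
  ⟨le.left_neg, le.right_pos, le.stiffness_pos, le.pos.trans_le hg.1, hg.2.trans_lt lf.lt_left,
    hg.2.trans_lt lf.lt_right⟩

/-- Between two ovals across which the Abelian integral changes its sign there is, for all small
perturbations of the right sign, an attracting limit cycle. -/
theorem exists_attracting_limitCycle (le : w.IsLevel A B e) (lf : w.IsLevel A B f) (hef : e < f)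
    {σ : ℝ} (hσ : σ * σ = 1)
    (hIe : 0 < σ * ∫ θ in (0 : ℝ)..2 * Real.pi, w.energyRate 0 θ (le.radius θ))
    (hIf : 0 < -σ * ∫ θ in (0 : ℝ)..2 * Real.pi, w.energyRate 0 θ (lf.radius θ)) :
    ∃ ε₀ > 0, ∀ ε, 0 < σ * ε → |ε| < ε₀ → ∃ L ⊆ w.annulus A B e f,
      IsLimitCycle (w.field ε) L ∧ IsAttracting (w.field ε) L := by
  set O := w.annulus A B e f
  have hO : IsOpen O := w.isOpen_annulus A B e f
  set ra := le.radius 0 with hra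
  set rb := lf.radius 0 with hrb
  have hra0 : 0 < ra := le.radius_pos 0
  have hrb0 : 0 < rb := lf.radius_pos 0
  have hraI := le.radius_zero_mem
  have hrbI := lf.radius_zero_mem
  have hrab : ra < rb := by
    rw [← le.energy_lt_energy_iff hra0 hrb0 (Ioo_subset_Icc_self hraI) (Ioo_subset_Icc_self hrbI),
      le.energy_radius, lf.energy_radius]
    exact hef
  have hfam : ∀ x ∈ Ioo ra rb, ∀ᶠ z : ℝ × ℝ in 𝓝 (x, 0),
      w.IsAnalyticFamilyAt (4 * Real.pi) O z.2 z.1 := by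
    intro x hx
    have hx0 : 0 < x := hra0.trans hx.1
    have hxI : x ∈ Icc A B := ⟨hraI.1.le.trans hx.1.le, hx.2.le.trans hrbI.2.le⟩
    -- Each radius strictly between those of the two ovals starts an unperturbed oval lying in the
    -- open annulus.
    set g := w.energy (polarMap w.c (0, x)) with hg
    have hgI : g ∈ Ioo e f := by
      constructor
      · rw [← le.energy_radius 0]
        exact (le.energy_lt_energy_iff hra0 hx0 (Ioo_subset_Icc_self hraI) hxI).2 hx.1
      · rw [← lf.energy_radius 0]
        exact (le.energy_lt_energy_iff hx0 hrb0 hxI (Ioo_subset_Icc_self hrbI)).2 hx.2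
    have lg := le.isLevel_of_mem lf (Ioo_subset_Icc_self hgI)
    have hxr : x = lg.radius 0 := lg.eq_radius hx0 (by simpa using hxI) rfl
    rw [hxr]
    refine lg.eventually_isAnalyticFamilyAt (by positivity) hO fun θ => ⟨?_, ?_⟩
    · simpa [polarMap] using lg.radius_mem θ
    · rw [lg.energy_radius]
      exact hgI
  obtain ⟨δ, hδ, hballe⟩ := Metric.eventually_nhds_iff.1
    (le.eventually_integral_energyRate_pos two_pi_mem.2 hIe)
  obtain ⟨δ', hδ', hballf⟩ := Metric.eventually_nhds_iff.1
    (lf.eventually_integral_energyRate_pos two_pi_mem.2 hIf)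
  -- The endpoints are moved inside because the boundary ovals are not in the open annulus. They
  -- stay within `δ` and `δ'`, where the signs persist, and the thirds keep `a < b`.
  set a := ra + min (δ / 2) ((rb - ra) / 3) with ha
  set b := rb - min (δ' / 2) ((rb - ra) / 3) with hb
  have ha1 : ra < a := by
    have : 0 < min (δ / 2) ((rb - ra) / 3) := lt_min (by linarith) (by linarith)
    linarith
  have hb1 : b < rb := by
    have : 0 < min (δ' / 2) ((rb - ra) / 3) := lt_min (by linarith) (by linarith)
    linarith
  have ha2 : a < ra + δ := by have := min_le_left (δ / 2) ((rb - ra) / 3); linarith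
  have hb2 : rb - δ' < b := by have := min_le_left (δ' / 2) ((rb - ra) / 3); linarith
  have hab : a < b := by
    have := min_le_right (δ / 2) ((rb - ra) / 3)
    have := min_le_right (δ' / 2) ((rb - ra) / 3)
    linarith
  -- Compactness of `[a, b]` turns the local families into one bound on `ε`.
  have htube : ∀ᶠ ε : ℝ in 𝓝 0, ∀ x ∈ Icc a b, w.IsAnalyticFamilyAt (4 * Real.pi) O ε x := by
    refine isCompact_Icc.eventually_forall_of_forall_eventually fun x hx => ?_
    have hswap : Tendsto (fun z : ℝ × ℝ => (z.2, z.1)) (𝓝 (0, x)) (𝓝 (x, 0)) :=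
      (continuous_snd.prodMk continuous_fst).tendsto' _ _ rfl
    exact hswap.eventually (hfam x ⟨ha1.trans_le hx.1, hx.2.trans_lt hb1⟩)
  obtain ⟨ε₁, hε₁, hball⟩ := Metric.eventually_nhds_iff.1 htube
  refine ⟨min ε₁ (min δ δ'), lt_min hε₁ (lt_min hδ hδ'), fun ε hσε hε => ?_⟩
  have hε1 : |ε| < ε₁ := hε.trans_le (min_le_left _ _)
  have hε2 : |ε| < δ := hε.trans_le ((min_le_right _ _).trans (min_le_left _ _))
  have hε3 : |ε| < δ' := hε.trans_le ((min_le_right _ _).trans (min_le_right _ _))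
  have haI : a ∈ Icc A B := ⟨by linarith [hraI.1], by linarith [hrbI.2]⟩
  have hbI : b ∈ Icc A B := ⟨by linarith [hraI.1], by linarith [hrbI.2]⟩
  have hmul : ∀ J : ℝ, ε * J = (σ * ε) * (σ * J) := fun J => by linear_combination (-(ε * J)) * hσ
  suffices hex : ∃ x₀ η R, w.IsReturnTube O ε x₀ η R by
    obtain ⟨x₀, η, R, htube⟩ := hex
    exact ⟨_, htube.cycle_subset, htube.isLimitCycle_cycle, htube.isAttracting_cycle⟩
  refine exists_isReturnTube hab (hball (by simpa using hε1)) (fun R hR hRO => ?_)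
    (fun R hR hRO => ?_)
  · have hpos := hballe (y := (a, ε)) (by
      rw [Prod.dist_eq, max_lt_iff, Real.dist_eq, Real.dist_eq, sub_zero, abs_lt]
      exact ⟨⟨by linarith, by linarith⟩, hε2⟩) R hR
    have hde := hR.energy_sub_energy
    rw [hmul] at hde
    have := mul_pos hσε hpos
    rw [polarMap_two_pi] at hRO
    refine (le.energy_lt_energy_iff (by linarith) (hR.pos _ two_pi_mem) haI
      (by simpa [polarMap] using Ioo_subset_Icc_self hRO.1)).1 ?_
    linarith
  · have hpos := hballf (y := (b, ε)) (by
      rw [Prod.dist_eq, max_lt_iff, Real.dist_eq, Real.dist_eq, sub_zero, abs_lt]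
      exact ⟨⟨by linarith, by linarith⟩, hε3⟩) R hR
    have hde := hR.energy_sub_energy
    rw [hmul] at hde
    have := mul_pos hσε hpos
    rw [polarMap_two_pi] at hRO
    refine (le.energy_lt_energy_iff (hR.pos _ two_pi_mem) (by linarith)
      (by simpa [polarMap] using Ioo_subset_Icc_self hRO.1) hbI).1 ?_
    linarith

end Well

/-! ### Reflection and time reversal -/

section Reflection

/-- The reflection in the `x`-axis. -/
def reflection : ℝ × ℝ →L[ℝ] ℝ × ℝ :=
  (ContinuousLinearMap.fst ℝ ℝ ℝ).prod (-ContinuousLinearMap.snd ℝ ℝ ℝ)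

theorem reflection_apply (p : ℝ × ℝ) : reflection p = (p.1, -p.2) := rfl

theorem reflection_reflection (p : ℝ × ℝ) : reflection (reflection p) = p := by
  simp [reflection_apply]

theorem isometry_reflection : Isometry reflection :=
  Isometry.of_dist_eq fun p q => by simp [reflection_apply, Prod.dist_eq]

theorem image_reflection (S : Set (ℝ × ℝ)) : reflection '' S = reflection ⁻¹' S :=
  congrFun (image_eq_preimage_of_inverse reflection_reflection reflection_reflection) S

theorem image_image_reflection (S : Set (ℝ × ℝ)) : reflection '' (reflection '' S) = S := by
  rw [image_image]
  simp [reflection_reflection]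

theorem isOpen_image_reflection {U : Set (ℝ × ℝ)} (hU : IsOpen U) : IsOpen (reflection '' U) := by
  rw [image_reflection]
  exact hU.preimage reflection.continuous

variable {X Y : ℝ × ℝ → ℝ × ℝ} {Γ : Set (ℝ × ℝ)}

theorem IsClosedOrbit.reflect (hXY : ∀ p, Y p = -reflection (X (reflection p)))
    (h : IsClosedOrbit X Γ) : IsClosedOrbit Y (reflection '' Γ) := by
  obtain ⟨c, T, hT, hc, hper, ⟨t, ht⟩, hr⟩ := h
  refine ⟨fun t => reflection (c (-t)), T, hT, fun t => ?_, fun t => ?_, ⟨-t, fun heq => ht ?_⟩, ?_⟩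
  · have h1 : HasDerivAt (fun t => c (-t)) (-X (c (-t))) t :=
      (HasDerivAt.scomp (g₁ := c) (h := fun t => -t) t (hc (-t)) (hasDerivAt_neg t)).congr_deriv
        (by simp)
    have h2 := reflection.hasFDerivAt.comp_hasDerivAt t h1
    rw [map_neg] at h2
    change HasDerivAt _ (Y (reflection (c (-t)))) t
    rw [hXY, reflection_reflection]
    exact h2
  · simp only [neg_add, ← sub_eq_add_neg]
    rw [hper.sub_eq]
  · simpa [reflection_reflection] using congrArg reflection heq
  · rw [← hr, ← range_comp]
    exact (Equiv.neg ℝ).surjective.range_comp (reflection ∘ c)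

theorem IsLimitCycle.reflect (hXY : ∀ p, Y p = -reflection (X (reflection p)))
    (h : IsLimitCycle X Γ) : IsLimitCycle Y (reflection '' Γ) := by
  have hYX : ∀ p, X p = -reflection (Y (reflection p)) := fun p => by
    rw [hXY, map_neg, neg_neg, reflection_reflection, reflection_reflection]
  obtain ⟨hc, U, hU, hΓU, hiso⟩ := h
  refine ⟨hc.reflect hXY, reflection '' U, isOpen_image_reflection hU, image_mono hΓU,
    fun Γ' hΓ' hne => ?_⟩
  rw [← hiso _ (hΓ'.reflect hYX), image_image_reflection]
  obtain ⟨_, hp, q, hq, rfl⟩ := hne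
  exact ⟨q, ⟨_, hp, reflection_reflection q⟩, hq⟩

theorem IsAttracting.reflect (hXY : ∀ p, Y p = -reflection (X (reflection p)))
    (h : IsAttracting X Γ) : IsRepelling Y (reflection '' Γ) := by
  intro U hU hΓU
  obtain ⟨V, hV, hΓV, hatt⟩ := h (reflection '' U) (isOpen_image_reflection hU) fun p hp =>
    ⟨_, hΓU (mem_image_of_mem _ hp), reflection_reflection p⟩
  refine ⟨reflection '' V, isOpen_image_reflection hV, image_mono hΓV, ?_⟩
  rintro _ ⟨p, hp, rfl⟩
  obtain ⟨c, hc0, hc, hcU, hlim⟩ := hatt p hp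
  refine ⟨fun t => reflection (c t), by simp [hc0], fun t ht => ?_, fun t ht => ?_, ?_⟩
  · have h1 := reflection.hasFDerivAt.comp_hasDerivWithinAt t (hc t ht)
    change HasDerivWithinAt _ (-Y (reflection (c t))) _ _
    rw [hXY, neg_neg, reflection_reflection]
    exact h1
  · have := hcU t ht
    rwa [image_reflection] at this
  · simpa only [Metric.infDist_image isometry_reflection] using hlim

end Reflection

namespace Well

variable {w : Well}

/-- The perturbation is odd in `y`, hence reversing time and reflecting changes the sign of `ε`. -/
theorem field_eq_neg_reflection (w : Well) (ε : ℝ) (p : ℝ × ℝ) :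
    w.field ε p = -reflection (w.field (-ε) (reflection p)) := by
  ext
  · simp [field, reflection_apply]
  · simp only [field, reflection_apply, pert, Prod.snd_neg]
    ring

theorem reflection_image_annulus {A B e f : ℝ} {L : Set (ℝ × ℝ)} (h : L ⊆ w.annulus A B e f) :
    reflection '' L ⊆ w.annulus A B e f := by
  rintro _ ⟨p, hp, rfl⟩
  have := h hp
  simpa [annulus, reflection_apply, energy] using this

/-- Between two ovals across which the Abelian integral changes its sign there is a limit cycle for
all small perturbations, attracting or repelling according to the sign of the perturbation. -/
theorem exists_limitCycle {A B e f σ : ℝ} (le : w.IsLevel A B e) (lf : w.IsLevel A B f)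
    (hef : e < f) (hσ : σ * σ = 1)
    (hIe : 0 < σ * ∫ θ in (0 : ℝ)..2 * Real.pi, w.energyRate 0 θ (le.radius θ))
    (hIf : 0 < -σ * ∫ θ in (0 : ℝ)..2 * Real.pi, w.energyRate 0 θ (lf.radius θ)) :
    ∃ ε₀ > 0, ∀ ε, ε ≠ 0 → |ε| < ε₀ → ∃ L ⊆ w.annulus A B e f, IsLimitCycle (w.field ε) L ∧
      (0 < σ * ε → IsAttracting (w.field ε) L) ∧ (σ * ε < 0 → IsRepelling (w.field ε) L) := by
  obtain ⟨ε₀, hε₀, h⟩ := exists_attracting_limitCycle le lf hef hσ hIe hIf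
  refine ⟨ε₀, hε₀, fun ε hne hε => ?_⟩
  have hσ0 : σ ≠ 0 := fun h0 => by simp [h0] at hσ
  rcases lt_or_gt_of_ne (mul_ne_zero hσ0 hne) with hlt | hgt
  -- For the wrong sign of `ε`, the attracting cycle for `-ε` is reflected; the annulus is
  -- symmetric.
  · obtain ⟨L, hL, hcyc, hatt⟩ := h (-ε) (by linarith) (by rwa [abs_neg])
    have hf := w.field_eq_neg_reflection ε
    exact ⟨_, reflection_image_annulus hL, hcyc.reflect hf, fun hpos => absurd hpos (not_lt.2 hlt.le),
      fun _ => hatt.reflect hf⟩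
  · obtain ⟨L, hL, hcyc, hatt⟩ := h ε hgt hε
    exact ⟨L, hL, hcyc, fun _ => hatt, fun hneg => absurd hneg (not_lt.2 hgt.le)⟩

end Well

/-! ### The Abelian integral along an oval -/

theorem exists_polarMap_eq {c : ℝ} {p : ℝ × ℝ} (hp : p ≠ (c, 0)) :
    ∃ θ r, 0 < r ∧ polarMap c (θ, r) = p := by
  set z : ℂ := ⟨p.1 - c, p.2⟩ with hz
  have hz0 : z ≠ 0 := fun h => hp <| by
    have h1 := congrArg Complex.re h
    have h2 := congrArg Complex.im h
    simp only [hz, Complex.zero_re, Complex.zero_im] at h1 h2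
    exact Prod.ext (sub_eq_zero.1 h1) h2
  refine ⟨z.arg, ‖z‖, norm_pos_iff.2 hz0, Prod.ext ?_ ?_⟩
  · simp [polarMap, Complex.norm_mul_cos_arg, hz]
  · simp [polarMap, Complex.norm_mul_sin_arg, hz]

theorem angle_eq_of_polarMap_eq {c θ φ r s : ℝ} (hr : 0 < r) (hs : 0 < s)
    (hθ : θ ∈ Ico 0 (2 * Real.pi)) (hφ : φ ∈ Ico 0 (2 * Real.pi))
    (h : polarMap c (θ, r) = polarMap c (φ, s)) : θ = φ := by
  simp only [polarMap, Prod.mk.injEq, add_right_inj] at h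
  have hrs : r = s := by
    have h1 := Real.sin_sq_add_cos_sq θ
    have h2 := Real.sin_sq_add_cos_sq φ
    have : r ^ 2 = s ^ 2 := by
      linear_combination (-r ^ 2) * h1 + s ^ 2 * h2 + (r * Real.cos θ + s * Real.cos φ) * h.1 +
        (r * Real.sin θ + s * Real.sin φ) * h.2
    exact (pow_left_inj₀ hr.le hs.le two_ne_zero).1 this
  subst hrs
  obtain ⟨k, hk⟩ := Real.Angle.angle_eq_iff_two_pi_dvd_sub.1
    (Real.Angle.cos_sin_inj (mul_left_cancel₀ hr.ne' h.1) (mul_left_cancel₀ hr.ne' h.2))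
  have hk0 : k = 0 := by
    have hpi := Real.two_pi_pos
    have h1 : (k : ℝ) < 1 := by
      by_contra hge
      nlinarith [hθ.2, hφ.1, not_lt.1 hge]
    have h2 : (-1 : ℝ) < k := by
      by_contra hge
      nlinarith [hθ.1, hφ.2, not_lt.1 hge]
    have h3 : k < 1 := by exact_mod_cast h1
    have h4 : -1 < k := by exact_mod_cast h2
    omega
  rw [hk0] at hk
  simpa [sub_eq_zero] using hk

namespace Well

variable {w : Well} {A B h : ℝ}

namespace IsLevel

theorem continuous_angSpeed_radius (hl : w.IsLevel A B h) :
    Continuous fun θ => w.angSpeed 0 θ (hl.radius θ) :=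
  w.continuous_angSpeed.comp
    (continuous_const.prodMk (continuous_id.prodMk hl.continuous_radius))

theorem continuous_polarMap_radius (hl : w.IsLevel A B h) :
    Continuous fun θ => polarMap w.c (θ, hl.radius θ) :=
  (continuous_polarMap w.c).comp (continuous_id.prodMk hl.continuous_radius)

theorem hasDerivAt_polarMap_radius (hl : w.IsLevel A B h) (θ : ℝ) :
    HasDerivAt (fun θ => polarMap w.c (θ, hl.radius θ))
      ((w.angSpeed 0 θ (hl.radius θ))⁻¹ • w.field 0 (polarMap w.c (θ, hl.radius θ))) θ :=
  w.hasDerivAt_polarMap (hl.angSpeed_pos θ) (hl.hasDerivAt_radius θ)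

theorem continuous_energyRate_radius (hl : w.IsLevel A B h) :
    Continuous fun θ => w.energyRate 0 θ (hl.radius θ) := by
  have h1 := hl.continuous_polarMap_radius
  have h2 : Continuous fun θ => (polarMap w.c (θ, hl.radius θ)).1 := continuous_fst.comp h1
  have h3 : Continuous fun θ => (polarMap w.c (θ, hl.radius θ)).2 := continuous_snd.comp h1
  unfold energyRate pert
  exact Continuous.div (by fun_prop) hl.continuous_angSpeed_radius fun θ => (hl.angSpeed_pos θ).ne'

theorem exists_angSpeed_le (hl : w.IsLevel A B h) :
    ∃ M, 0 < M ∧ ∀ θ, w.angSpeed 0 θ (hl.radius θ) ≤ M := by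
  have hper : Function.Periodic (fun θ => w.angSpeed 0 θ (hl.radius θ)) (2 * Real.pi) := fun θ => by
    simp only [angSpeed_add_two_pi, hl.radius_add_two_pi]
  obtain ⟨M, hM⟩ := (hper.compact_of_continuous Real.two_pi_pos.ne'
    hl.continuous_angSpeed_radius).bddAbove
  have hle : ∀ θ, w.angSpeed 0 θ (hl.radius θ) ≤ M := fun θ => hM (mem_range_self θ)
  exact ⟨M, (hl.angSpeed_pos 0).trans_le (hle 0), hle⟩

/-- The ovals are periodic orbits, along which the Abelian integral of the perturbation is the
integral of the rate of change of the energy. -/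
theorem isAbelianIntegral (hl : w.IsLevel A B h) :
    IsAbelianIntegral (w.field 0) 0 w.pert {p | p.1 - w.c ∈ Ioo A B ∧ w.energy p = h}
      (∫ θ in (0 : ℝ)..2 * Real.pi, w.energyRate 0 θ (hl.radius θ)) := by
  obtain ⟨M, hM, hle⟩ := hl.exists_angSpeed_le
  obtain ⟨τ, hτ0, hτ⟩ := exists_timeChange
    (κ := fun θ => (w.angSpeed 0 θ (hl.radius θ))⁻¹) (m := M⁻¹) (s₀ := 0)
    (hl.continuous_angSpeed_radius.inv₀ fun θ => (hl.angSpeed_pos θ).ne') (inv_pos.2 hM)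
    (fun θ => inv_anti₀ (hl.angSpeed_pos θ) (hle θ))
  simp only [inv_inv] at hτ
  set Q : ℝ → ℝ × ℝ := fun θ => polarMap w.c (θ, hl.radius θ) with hQ
  set T := τ.symm (2 * Real.pi) with hT
  have hτT : τ T = 2 * Real.pi := τ.apply_symm_apply _
  have hc : IsIntegralCurve (fun t => Q (τ t)) (fun _ => w.field 0) := fun t => by
    refine ((hl.hasDerivAt_polarMap_radius (τ t)).scomp t (hτ t)).congr_deriv ?_
    rw [smul_smul, mul_inv_cancel₀ (hl.angSpeed_pos _).ne', one_smul]
  have hT0 : 0 < T := by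
    rw [← τ.lt_iff_lt, hτT, hτ0]
    exact Real.two_pi_pos
  have hτI : ∀ t ∈ Ico 0 T, τ t ∈ Ico 0 (2 * Real.pi) := fun t ht =>
    ⟨hτ0 ▸ τ.monotone ht.1, hτT ▸ τ.strictMono ht.2⟩
  refine ⟨fun t => Q (τ t), T, hT0, hc, periodic_of_isIntegralCurve (w.contDiff_field 0) hc ?_,
    fun s hs t ht hst => ?_, ?_, ?_⟩
  · have := hl.radius_add_two_pi 0
    rw [zero_add] at this
    simp [hQ, hτT, hτ0, polarMap, this]
  · exact τ.injective (angle_eq_of_polarMap_eq (hl.radius_pos _) (hl.radius_pos _) (hτI s hs)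
      (hτI t ht) hst)
  · ext p
    constructor
    · rintro ⟨t, rfl⟩
      exact ⟨by simpa [hQ, polarMap] using hl.radius_mem (τ t), hl.energy_radius _⟩
    · rintro ⟨hpI, hpe⟩
      obtain ⟨θ, r, hr, rfl⟩ := exists_polarMap_eq (c := w.c) (p := p) (by
        rintro rfl
        have := hl.pos
        simp [energy] at hpe
        linarith)
      refine ⟨τ.symm θ, ?_⟩
      simp only [hQ, τ.apply_symm_apply]
      rw [← hl.eq_radius hr (by simpa [polarMap] using Ioo_subset_Icc_self hpI) hpe]
  · have hcont : Continuous fun t => w.angSpeed 0 (τ t) (hl.radius (τ t)) :=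
      hl.continuous_angSpeed_radius.comp τ.continuous
    have hsub := intervalIntegral.integral_comp_mul_deriv (a := 0) (b := T) (fun t _ => hτ t)
      hcont.continuousOn hl.continuous_energyRate_radius
    rw [hτ0, hτT] at hsub
    rw [← hsub]
    refine intervalIntegral.integral_congr fun t _ => ?_
    -- Since `dx = -y dt`, the form `-g dx` equals `y g dt`, the energy rate per unit of time.
    have h1 : HasDerivAt (fun s => (Q (τ s)).1) (-(Q (τ t)).2) t :=
      (HasFDerivAt.comp_hasDerivAt (f := fun s => Q (τ s)) t (hasFDerivAt_fst (𝕜 := ℝ))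
        (hc t)).congr_deriv rfl
    simp only [Function.comp_apply, h1.deriv, energyRate, Pi.zero_apply]
    rw [div_mul_cancel₀ _ (hl.angSpeed_pos _).ne']
    simp only [hQ]
    ring

/-- Locates the oval on a ray by evaluating the energy, without solving a quartic equation. -/
theorem radius_le_iff (hl : w.IsLevel A B h) {θ s : ℝ} (hs : 0 ≤ s)
    (hsc : s * Real.cos θ ∈ Icc A B) :
    hl.radius θ ≤ s ↔ h ≤ w.energy (polarMap w.c (θ, s)) := by
  constructor
  · intro hle
    rcases hle.eq_or_lt with heq | hlt
    · rw [← heq, hl.energy_radius]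
    · have := energy_lt_energy hl.left_neg.le hl.right_pos.le hl.stiffness_pos (hl.radius_pos θ).le
        hlt hsc
      rw [hl.energy_radius] at this
      exact this.le
  · intro hle
    by_contra hlt
    have := energy_lt_energy hl.left_neg.le hl.right_pos.le hl.stiffness_pos hs (not_le.1 hlt)
      (Ioo_subset_Icc_self (hl.radius_mem θ))
    rw [hl.energy_radius] at this
    exact absurd hle (not_le.2 this)

end IsLevel

/-- The upper half of the level set of energy `h`, as a graph. -/
def height (w : Well) (h x : ℝ) : ℝ := √(2 * (h - w.energy (x, 0)))

theorem continuous_height (w : Well) (h : ℝ) : Continuous (w.height h) := by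
  have := w.continuous_energy
  unfold height
  fun_prop

namespace IsLevel

theorem height_eq_abs (hl : w.IsLevel A B h) (θ : ℝ) :
    w.height h (polarMap w.c (θ, hl.radius θ)).1 = |(polarMap w.c (θ, hl.radius θ)).2| := by
  rw [height, ← Real.sqrt_sq_eq_abs]
  congr 1
  have := hl.energy_radius θ
  simp only [energy] at this ⊢
  linear_combination -2 * this

theorem continuous_pert_height (w : Well) (h : ℝ) :
    Continuous fun x => w.pert (x, w.height h x) := by
  have := w.continuous_height h
  unfold pert
  fun_prop

/-- The Abelian integral as an integral over the projection of the oval. -/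
theorem integral_energyRate (hl : w.IsLevel A B h) {a b : ℝ} (ha : a ∈ Icc (w.c + A) w.c)
    (hb : b ∈ Icc w.c (w.c + B)) (hea : h ≤ w.energy (a, 0)) (heb : h ≤ w.energy (b, 0)) :
    ∫ θ in (0 : ℝ)..2 * Real.pi, w.energyRate 0 θ (hl.radius θ) =
      2 * ∫ x in a..b, w.pert (x, w.height h x) := by
  set Q : ℝ → ℝ × ℝ := fun θ => polarMap w.c (θ, hl.radius θ) with hQ
  set F : ℝ → ℝ := fun x => w.pert (x, w.height h x) with hF
  have hFc : Continuous F := continuous_pert_height w h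
  set D : ℝ → ℝ := fun θ => w.angSpeed 0 θ (hl.radius θ) with hD
  have hD0 : ∀ θ, D θ ≠ 0 := fun θ => (hl.angSpeed_pos θ).ne'
  have hX : ∀ θ, HasDerivAt (fun θ => (Q θ).1) (-(Q θ).2 / D θ) θ := fun θ =>
    ((hasFDerivAt_fst (𝕜 := ℝ) (p := Q θ)).comp_hasDerivAt θ
      (hl.hasDerivAt_polarMap_radius θ)).congr_deriv (by
        simp [field, hQ, hD, div_eq_inv_mul])
  have hQ2 : Continuous fun θ => (Q θ).2 := continuous_snd.comp hl.continuous_polarMap_radius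
  have hXc : Continuous fun θ => -(Q θ).2 / D θ :=
    hQ2.neg.div hl.continuous_angSpeed_radius hD0
  have hER : ∀ θ, w.energyRate 0 θ (hl.radius θ) = (Q θ).2 * w.pert (Q θ) / D θ := fun _ => rfl
  have hsubst : ∀ u v : ℝ, ∫ θ in u..v, F (Q θ).1 * (-(Q θ).2 / D θ) =
      ∫ x in (Q u).1..(Q v).1, F x := fun u v =>
    intervalIntegral.integral_comp_mul_deriv (fun θ _ => hX θ) hXc.continuousOn hFc
  have hpi := Real.pi_pos
  have hupper : ∫ θ in (0 : ℝ)..Real.pi, w.energyRate 0 θ (hl.radius θ) =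
      ∫ x in (Q Real.pi).1..(Q 0).1, F x := by
    rw [intervalIntegral.integral_symm (Q 0).1, ← hsubst, ← intervalIntegral.integral_neg]
    refine intervalIntegral.integral_congr fun θ hθ => ?_
    rw [uIcc_of_le hpi.le] at hθ
    have hy : 0 ≤ (Q θ).2 := mul_nonneg (hl.radius_pos θ).le (Real.sin_nonneg_of_mem_Icc hθ)
    have hFQ : F (Q θ).1 = w.pert (Q θ) := by
      simp only [hF, hQ, hl.height_eq_abs]
      rw [abs_of_nonneg hy]
    simp only [hER, hFQ]
    ring
  -- On the lower half both `y`, hence `g`, and the direction of travel in `x` are reversed, so it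
  -- contributes as much as the upper half.
  have hlower : ∫ θ in Real.pi..2 * Real.pi, w.energyRate 0 θ (hl.radius θ) =
      ∫ x in (Q Real.pi).1..(Q 0).1, F x := by
    have h0 : Q 0 = Q (2 * Real.pi) := by
      have := hl.radius_add_two_pi 0
      rw [zero_add] at this
      simp [hQ, this, polarMap]
    rw [h0, ← hsubst]
    refine intervalIntegral.integral_congr fun θ hθ => ?_
    rw [uIcc_of_le (by linarith)] at hθ
    have hs : Real.sin θ ≤ 0 := by
      rw [← neg_nonneg, ← Real.sin_sub_pi]
      exact Real.sin_nonneg_of_nonneg_of_le_pi (by linarith [hθ.1]) (by linarith [hθ.2])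
    have hy : (Q θ).2 ≤ 0 := mul_nonpos_of_nonneg_of_nonpos (hl.radius_pos θ).le hs
    have hFQ : F (Q θ).1 = -w.pert (Q θ) := by
      simp only [hF, hQ, hl.height_eq_abs]
      rw [abs_of_nonpos hy]
      simp only [pert]
      ring
    simp only [hER, hFQ]
    ring
  have hQ0 : (Q 0).1 = w.c + hl.radius 0 := by simp [hQ, polarMap]
  have hQpi : (Q Real.pi).1 = w.c - hl.radius Real.pi := by simp [hQ, polarMap, sub_eq_add_neg]
  have hleft : ∀ x ∈ Icc (w.c + A) w.c, hl.radius Real.pi ≤ w.c - x ↔ h ≤ w.energy (x, 0) :=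
    fun x hx => by
      rw [hl.radius_le_iff (sub_nonneg.2 hx.2) (by
        rw [Real.cos_pi]
        exact ⟨by linarith [hx.1], by linarith [hx.2, hl.right_pos]⟩)]
      simp [polarMap]
  have hright : ∀ x ∈ Icc w.c (w.c + B), hl.radius 0 ≤ x - w.c ↔ h ≤ w.energy (x, 0) :=
    fun x hx => by
      rw [hl.radius_le_iff (sub_nonneg.2 hx.1) (by
        rw [Real.cos_zero]
        exact ⟨by linarith [hx.1, hl.left_neg], by linarith [hx.2]⟩)]
      simp [polarMap]
  -- Outside the projection the real square root of a negative number is `0` and so is the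
  -- integrand. Hence any enclosing interval, in particular one with rational ends, gives the same
  -- integral.
  have hzero : ∀ x, h ≤ w.energy (x, 0) → F x = 0 := fun x hx => by
    have h0 : w.height h x = 0 := Real.sqrt_eq_zero_of_nonpos (by linarith)
    simp [hF, h0, pert]
  have hra := (hleft a ha).2 hea
  have hrb := (hright b hb).2 heb
  have hI1 : ∫ x in a..(Q Real.pi).1, F x = 0 := by
    refine intervalIntegral.integral_zero_ae (MeasureTheory.ae_of_all _ fun x hx => hzero x ?_)
    rw [uIoc_of_le (by linarith)] at hx
    exact (hleft x ⟨by linarith [hx.1, ha.1], by linarith [hx.2, hl.radius_pos Real.pi]⟩).1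
      (by linarith [hx.2])
  have hI2 : ∫ x in (Q 0).1..b, F x = 0 := by
    refine intervalIntegral.integral_zero_ae (MeasureTheory.ae_of_all _ fun x hx => hzero x ?_)
    rw [uIoc_of_le (by linarith)] at hx
    exact (hright x ⟨by linarith [hx.1, hl.radius_pos 0], by linarith [hx.2, hb.2]⟩).1
      (by linarith [hx.1])
  have hFi : ∀ u v : ℝ, IntervalIntegrable F MeasureTheory.volume u v := fun u v =>
    hFc.intervalIntegrable u v
  have hEi : ∀ u v : ℝ, IntervalIntegrable (fun θ => w.energyRate 0 θ (hl.radius θ))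
      MeasureTheory.volume u v := fun u v => hl.continuous_energyRate_radius.intervalIntegrable u v
  rw [← intervalIntegral.integral_add_adjacent_intervals (hEi 0 Real.pi) (hEi _ _), hupper, hlower,
    ← intervalIntegral.integral_add_adjacent_intervals (hFi a (Q Real.pi).1) (hFi _ b),
    ← intervalIntegral.integral_add_adjacent_intervals (hFi (Q Real.pi).1 (Q 0).1) (hFi _ b),
    hI1, hI2]
  ring

end IsLevel

end Well

/-! ### Certified lower bounds for the integrals -/

section Quadrature

open Real

theorem integral_cos_pow_add_two (n : ℕ) :
    ∫ φ in (0 : ℝ)..π, cos φ ^ (n + 2) = (n + 1) / (n + 2) * ∫ φ in (0 : ℝ)..π, cos φ ^ n := by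
  rw [integral_cos_pow]
  simp

theorem integral_cos_pow_mul_sin_sq (n : ℕ) :
    ∫ φ in (0 : ℝ)..π, cos φ ^ n * sin φ ^ 2 = 1 / (n + 2) * ∫ φ in (0 : ℝ)..π, cos φ ^ n := by
  have h : ∀ φ, cos φ ^ n * sin φ ^ 2 = cos φ ^ n - cos φ ^ (n + 2) := fun φ => by
    rw [sin_sq]; ring
  simp only [h]
  rw [intervalIntegral.integral_sub, integral_cos_pow_add_two]
  · field_simp
    ring
  all_goals exact (by fun_prop : Continuous _).intervalIntegrable _ _

theorem integral_sum_cos_mul_sin_sq (n : ℕ) (p : ℕ → ℝ) :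
    ∫ φ in (0 : ℝ)..π, (∑ i ∈ Finset.range n, p i * cos φ ^ i) * sin φ ^ 2 =
      ∑ i ∈ Finset.range n, p i * (1 / (i + 2) * ∫ φ in (0 : ℝ)..π, cos φ ^ i) := by
  simp only [Finset.sum_mul, mul_assoc]
  rw [intervalIntegral.integral_finsetSum fun i _ =>
    (by fun_prop : Continuous _).intervalIntegrable _ _]
  simp only [intervalIntegral.integral_const_mul, integral_cos_pow_mul_sin_sq]

theorem integral_octic_cos_mul_sin_sq (p₀ p₁ p₂ p₃ p₄ p₅ p₆ p₇ p₈ : ℝ) :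
    ∫ φ in (0 : ℝ)..π, (p₀ + p₁ * cos φ + p₂ * cos φ ^ 2 + p₃ * cos φ ^ 3 + p₄ * cos φ ^ 4 +
      p₅ * cos φ ^ 5 + p₆ * cos φ ^ 6 + p₇ * cos φ ^ 7 + p₈ * cos φ ^ 8) * sin φ ^ 2 =
      π * (p₀ / 2 + p₂ / 8 + p₄ / 16 + 5 / 128 * p₆ + 7 / 256 * p₈) := by
  have h0 : ∫ φ in (0 : ℝ)..π, cos φ ^ 0 = π := by simp
  have h1 : ∫ φ in (0 : ℝ)..π, cos φ ^ 1 = 0 := by simp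
  have h2 := integral_cos_pow_add_two 0
  have h3 := integral_cos_pow_add_two 1
  have h4 := integral_cos_pow_add_two 2
  have h5 := integral_cos_pow_add_two 3
  have h6 := integral_cos_pow_add_two 4
  have h7 := integral_cos_pow_add_two 5
  have h8 := integral_cos_pow_add_two 6
  simp only [zero_add, Nat.reduceAdd] at h2 h3 h4 h5 h6 h7 h8
  have key := integral_sum_cos_mul_sin_sq 9
    fun i => [p₀, p₁, p₂, p₃, p₄, p₅, p₆, p₇, p₈].getD i 0
  simp only [Finset.sum_range_succ, Finset.sum_range_zero] at key
  rw [h8, h7, h6, h5, h4, h3, h2, h1, h0] at key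
  convert key using 1
  · simp
  · simp
    ring

theorem abs_sqrt_sub_sqrt_le (a b : ℝ) : |√a - √b| ≤ √|a - b| := by
  have key : ∀ a b : ℝ, √a ≤ √b + √|a - b| := fun a b => by
    rw [Real.sqrt_le_left (by positivity), add_sq]
    rcases le_total 0 b with hb | hb
    · rw [Real.sq_sqrt hb, Real.sq_sqrt (abs_nonneg _)]
      nlinarith [le_abs_self (a - b), mul_nonneg (Real.sqrt_nonneg b) (Real.sqrt_nonneg |a - b|)]
    · rw [Real.sqrt_eq_zero_of_nonpos hb, Real.sq_sqrt (abs_nonneg _)]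
      nlinarith [le_abs_self (a - b)]
  have h1 := key a b
  have h2 := key b a
  rw [abs_sub_comm b a] at h2
  exact abs_le.2 ⟨by linarith, by linarith⟩

/-- From `√q - s = (q - s²) / (√q + s)`, with denominator at least `2σ`. -/
theorem abs_sqrt_sub_le {q s σ : ℝ} (hσ : 0 < σ) (hs : σ ≤ s) (hq : σ ^ 2 ≤ q) :
    |√q - s| ≤ |q - s ^ 2| / (2 * σ) := by
  have h1 : σ ≤ √q := Real.le_sqrt_of_sq_le hq
  have h2 : q - s ^ 2 = (√q - s) * (√q + s) := by
    have := Real.sq_sqrt ((sq_nonneg σ).trans hq)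
    linear_combination -this
  rw [le_div_iff₀ (by positivity), h2, abs_mul, abs_of_nonneg (by linarith : 0 ≤ √q + s)]
  exact mul_le_mul_of_nonneg_left (by linarith) (abs_nonneg _)

/-- A pointwise lower bound for `W √u sin φ`, when `u` is close to `sin² φ q` and `q` is close to
`s²`. -/
theorem le_mul_sqrt_mul {W S q r s σ l η M : ℝ} (hS : 0 ≤ S) (hσ : 0 < σ) (hs : σ ≤ s)
    (hq : σ ^ 2 ≤ q) (hη0 : 0 ≤ η) (hr : |r| ≤ η ^ 2) (hl : 0 < l) (hW : |W| ≤ M) :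
    W * s * S ^ 2 - (l * W ^ 2 + (q - s ^ 2) ^ 2 / l) / (4 * σ) * S ^ 2 - M * η * S ≤
      W * √(S ^ 2 * q + r) * S := by
  have hM : 0 ≤ M := (abs_nonneg W).trans hW
  have h1 : |√(S ^ 2 * q + r) - S * √q| ≤ η := by
    have := abs_sqrt_sub_sqrt_le (S ^ 2 * q + r) (S ^ 2 * q)
    rw [add_sub_cancel_left, Real.sqrt_mul (sq_nonneg S) q, Real.sqrt_sq hS] at this
    exact this.trans (Real.sqrt_le_left hη0 |>.2 hr)
  have h2 := abs_sqrt_sub_le hσ hs hq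
  -- Young's inequality with weight `l` removes the absolute values, leaving a polynomial that can
  -- be integrated exactly.
  have h3 : |W| * |q - s ^ 2| ≤ (l * W ^ 2 + (q - s ^ 2) ^ 2 / l) / 2 := by
    have h : (q - s ^ 2) ^ 2 / l = l * (|q - s ^ 2| / l) ^ 2 := by
      rw [div_pow, sq_abs]; field_simp
    have h' : |W| * |q - s ^ 2| = l * (|W| * (|q - s ^ 2| / l)) := by field_simp
    rw [h, h', ← sq_abs W]
    nlinarith [mul_nonneg hl.le (sq_nonneg (|W| - |q - s ^ 2| / l))]
  have h4 : |W * (√(S ^ 2 * q + r) - S * √q) * S| ≤ M * η * S := by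
    rw [abs_mul, abs_mul, abs_of_nonneg hS]
    gcongr
  have h5 : |W * (√q - s) * S ^ 2| ≤
      (l * W ^ 2 + (q - s ^ 2) ^ 2 / l) / (4 * σ) * S ^ 2 := by
    rw [abs_mul, abs_mul, abs_of_nonneg (sq_nonneg S)]
    refine mul_le_mul_of_nonneg_right ?_ (sq_nonneg S)
    calc |W| * |√q - s| ≤ |W| * (|q - s ^ 2| / (2 * σ)) := by gcongr
      _ = |W| * |q - s ^ 2| / (2 * σ) := by ring
      _ ≤ (l * W ^ 2 + (q - s ^ 2) ^ 2 / l) / 2 / (2 * σ) := by gcongr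
      _ = _ := by field_simp; ring
  have h6 := neg_abs_le (W * (√(S ^ 2 * q + r) - S * √q) * S)
  have h7 := neg_abs_le (W * (√q - s) * S ^ 2)
  have h8 : W * √(S ^ 2 * q + r) * S = W * s * S ^ 2 + W * (√q - s) * S ^ 2 +
      W * (√(S ^ 2 * q + r) - S * √q) * S := by ring
  linarith

/-- Integrates the bound of `le_mul_sqrt_mul` with `q` quadratic and `s = s₀ + s₁ cos φ`. In `hmain`
the bracket is the exact integral of the polynomial part divided by `π`, and `2 M η` is the integral
of `M η sin φ`. -/
theorem integral_mul_sqrt_mul_sin_pos {w₀ w₁ w₂ w₃ w₄ q₀ q₁ q₂ r₀ r₁ s₀ s₁ σ l η M : ℝ}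
    (hσ : 0 < σ) (hs : σ ≤ s₀ - |s₁|)
    (hq : ∀ t ∈ Icc (-1 : ℝ) 1, σ ^ 2 ≤ q₀ + q₁ * t + q₂ * t ^ 2)
    (hη0 : 0 ≤ η) (hr : |r₀| + |r₁| ≤ η ^ 2) (hl : 0 < l)
    (hM : |w₀| + |w₁| + |w₂| + |w₃| + |w₄| ≤ M)
    (hmain : 2 * M * η < 3 * (w₀ * s₀ / 2 + (w₁ * s₁ + w₂ * s₀) / 8 + (w₃ * s₁ + w₄ * s₀) / 16 -
      (l * (w₀ ^ 2 / 2 + (2 * w₀ * w₂ + w₁ ^ 2) / 8 + (2 * w₀ * w₄ + 2 * w₁ * w₃ + w₂ ^ 2) / 16 +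
        5 / 128 * (2 * w₂ * w₄ + w₃ ^ 2) + 7 / 256 * w₄ ^ 2) +
       ((q₀ - s₀ ^ 2) ^ 2 / 2 + (2 * (q₀ - s₀ ^ 2) * (q₂ - s₁ ^ 2) + (q₁ - 2 * s₀ * s₁) ^ 2) / 8 +
        (q₂ - s₁ ^ 2) ^ 2 / 16) / l) / (4 * σ))) :
    0 < ∫ φ in (0 : ℝ)..π, (w₀ + w₁ * cos φ + w₂ * cos φ ^ 2 + w₃ * cos φ ^ 3 + w₄ * cos φ ^ 4) *
      √(sin φ ^ 2 * (q₀ + q₁ * cos φ + q₂ * cos φ ^ 2) + (r₀ + r₁ * cos φ)) * sin φ := by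
  set W : ℝ → ℝ := fun t => w₀ + w₁ * t + w₂ * t ^ 2 + w₃ * t ^ 3 + w₄ * t ^ 4 with hW
  set q : ℝ → ℝ := fun t => q₀ + q₁ * t + q₂ * t ^ 2 with hqdef
  set s : ℝ → ℝ := fun t => s₀ + s₁ * t with hsdef
  have hWc : Continuous W := by fun_prop
  have hqc : Continuous q := by fun_prop
  have hsc : Continuous s := by fun_prop
  have hM0 : 0 ≤ M := le_trans (by positivity) hM
  have hlow : ∀ φ ∈ Icc 0 π, W (cos φ) * s (cos φ) * sin φ ^ 2 - (l * W (cos φ) ^ 2 +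
      (q (cos φ) - s (cos φ) ^ 2) ^ 2 / l) / (4 * σ) * sin φ ^ 2 - M * η * sin φ ≤
      W (cos φ) * √(sin φ ^ 2 * q (cos φ) + (r₀ + r₁ * cos φ)) * sin φ := by
    intro φ hφ
    have ht : |cos φ| ≤ 1 := abs_cos_le_one φ
    have habs : ∀ (a : ℝ) (n : ℕ), |a * cos φ ^ n| ≤ |a| := fun a n => by
      rw [abs_mul, abs_pow]
      exact mul_le_of_le_one_right (abs_nonneg a) (pow_le_one₀ (abs_nonneg _) ht)
    have h1 : ∀ a : ℝ, |a * cos φ| ≤ |a| := fun a => by simpa using habs a 1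
    refine le_mul_sqrt_mul (sin_nonneg_of_mem_Icc hφ) hσ ?_ (hq _ (abs_le.1 ht)) hη0 ?_ hl ?_
    · have := neg_abs_le (s₁ * cos φ)
      simp only [hsdef]
      linarith [h1 s₁]
    · exact (abs_add_le _ _).trans (by linarith [h1 r₁])
    · simp only [hW]
      linarith [abs_add_le (w₀ + w₁ * cos φ + w₂ * cos φ ^ 2 + w₃ * cos φ ^ 3) (w₄ * cos φ ^ 4),
        abs_add_le (w₀ + w₁ * cos φ + w₂ * cos φ ^ 2) (w₃ * cos φ ^ 3),
        abs_add_le (w₀ + w₁ * cos φ) (w₂ * cos φ ^ 2), abs_add_le w₀ (w₁ * cos φ), h1 w₁,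
        habs w₂ 2, habs w₃ 3, habs w₄ 4]
  refine lt_of_lt_of_le ?_ (intervalIntegral.integral_mono_on pi_pos.le
    ((by fun_prop : Continuous _).intervalIntegrable _ _)
    ((by fun_prop : Continuous _).intervalIntegrable _ _) hlow)
  have hlowint : ∀ φ, W (cos φ) * s (cos φ) * sin φ ^ 2 - (l * W (cos φ) ^ 2 +
      (q (cos φ) - s (cos φ) ^ 2) ^ 2 / l) / (4 * σ) * sin φ ^ 2 - M * η * sin φ =
      W (cos φ) * s (cos φ) * sin φ ^ 2 - l / (4 * σ) * (W (cos φ) ^ 2 * sin φ ^ 2) -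
      1 / (l * (4 * σ)) * ((q (cos φ) - s (cos φ) ^ 2) ^ 2 * sin φ ^ 2) - M * η * sin φ := fun φ => by
    field_simp
    ring
  simp only [hlowint]
  have e1 : ∫ φ in (0 : ℝ)..π, W (cos φ) * s (cos φ) * sin φ ^ 2 = π * (w₀ * s₀ / 2 +
      (w₁ * s₁ + w₂ * s₀) / 8 + (w₃ * s₁ + w₄ * s₀) / 16) := by
    have := integral_octic_cos_mul_sin_sq (w₀ * s₀) (w₀ * s₁ + w₁ * s₀) (w₁ * s₁ + w₂ * s₀)
      (w₂ * s₁ + w₃ * s₀) (w₃ * s₁ + w₄ * s₀) (w₄ * s₁) 0 0 0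
    convert this using 1
    · refine intervalIntegral.integral_congr fun φ _ => ?_
      simp only [hW, hsdef]
      ring
    · ring
  have e2 : ∫ φ in (0 : ℝ)..π, W (cos φ) ^ 2 * sin φ ^ 2 = π * (w₀ ^ 2 / 2 +
      (2 * w₀ * w₂ + w₁ ^ 2) / 8 + (2 * w₀ * w₄ + 2 * w₁ * w₃ + w₂ ^ 2) / 16 +
        5 / 128 * (2 * w₂ * w₄ + w₃ ^ 2) + 7 / 256 * w₄ ^ 2) := by
    have := integral_octic_cos_mul_sin_sq (w₀ ^ 2) (2 * w₀ * w₁) (2 * w₀ * w₂ + w₁ ^ 2)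
      (2 * w₀ * w₃ + 2 * w₁ * w₂) (2 * w₀ * w₄ + 2 * w₁ * w₃ + w₂ ^ 2)
      (2 * w₁ * w₄ + 2 * w₂ * w₃) (2 * w₂ * w₄ + w₃ ^ 2) (2 * w₃ * w₄) (w₄ ^ 2)
    convert this using 1
    refine intervalIntegral.integral_congr fun φ _ => ?_
    simp only [hW]
    ring
  have e3 : ∫ φ in (0 : ℝ)..π, (q (cos φ) - s (cos φ) ^ 2) ^ 2 * sin φ ^ 2 =
      π * ((q₀ - s₀ ^ 2) ^ 2 / 2 + (2 * (q₀ - s₀ ^ 2) * (q₂ - s₁ ^ 2) +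
        (q₁ - 2 * s₀ * s₁) ^ 2) / 8 + (q₂ - s₁ ^ 2) ^ 2 / 16) := by
    have := integral_octic_cos_mul_sin_sq ((q₀ - s₀ ^ 2) ^ 2)
      (2 * (q₀ - s₀ ^ 2) * (q₁ - 2 * s₀ * s₁))
      (2 * (q₀ - s₀ ^ 2) * (q₂ - s₁ ^ 2) + (q₁ - 2 * s₀ * s₁) ^ 2)
      (2 * (q₁ - 2 * s₀ * s₁) * (q₂ - s₁ ^ 2)) ((q₂ - s₁ ^ 2) ^ 2) 0 0 0 0
    convert this using 1
    · refine intervalIntegral.integral_congr fun φ _ => ?_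
      simp only [hqdef, hsdef]
      ring
    · ring
  rw [intervalIntegral.integral_sub, intervalIntegral.integral_sub, intervalIntegral.integral_sub,
    intervalIntegral.integral_const_mul, intervalIntegral.integral_const_mul,
    intervalIntegral.integral_const_mul, integral_sin, e1, e2, e3, cos_zero, cos_pi]
  -- `hmain` makes the bracket positive, so replacing its factor `3` by `π` keeps the inequality.
  · have hX := lt_of_le_of_lt (by positivity : 0 ≤ 2 * M * η) hmain
    have hX' := mul_lt_mul_of_pos_right pi_gt_three ((mul_pos_iff_of_pos_left (by norm_num)).1 hX)
    refine (sub_pos.2 (hmain.trans hX')).trans_eq ?_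
    field_simp
    ring
  all_goals exact (by fun_prop : Continuous _).intervalIntegrable _ _

end Quadrature

namespace Well

variable {w : Well}

/-- A convex quadratic lies above its tangent line at `t₀`, which is then bounded below on `[-1,
1]`. -/
theorem le_quadratic {q₀ q₁ q₂ σ t₀ : ℝ} (hq₂ : 0 ≤ q₂)
    (hq : σ ^ 2 + |q₁ + 2 * q₂ * t₀| ≤ q₀ - q₂ * t₀ ^ 2) :
    ∀ t ∈ Icc (-1 : ℝ) 1, σ ^ 2 ≤ q₀ + q₁ * t + q₂ * t ^ 2 := by
  intro t ht
  have h1 := mul_nonneg hq₂ (sq_nonneg (t - t₀))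
  have h2 : |(q₁ + 2 * q₂ * t₀) * t| ≤ |q₁ + 2 * q₂ * t₀| := by
    rw [abs_mul]
    exact mul_le_of_le_one_right (abs_nonneg _) (abs_le.2 ht)
  have h3 := neg_abs_le ((q₁ + 2 * q₂ * t₀) * t)
  linarith

/-- A sufficient condition for the sign `τ` of the integral of the perturbation over the oval of
energy `h`, whose projection is contained in `[m - k, m + k]`. Here
`2 (h - energy (m + k t, 0)) = u₀ + u₁ t + ⋯ + u₄ t⁴`. -/
theorem integral_pert_height_pos {h m k n τ u₀ u₁ u₂ u₃ u₄ s₀ s₁ σ l η M t₀ w₀ w₁ w₂ w₃ w₄ : ℝ}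
    (hk : 0 < k) (hn : n = m - w.c)
    (hu₀ : u₀ = 2 * h - w.k₀ * n ^ 2 - 2 / 3 * w.k₁ * n ^ 3 - n ^ 4 / 2)
    (hu₁ : u₁ = -(2 * k * n * w.stiffness n))
    (hu₂ : u₂ = -(k ^ 2 * (w.k₀ + 2 * w.k₁ * n + 3 * n ^ 2)))
    (hu₃ : u₃ = -(k ^ 3 * (2 / 3 * w.k₁ + 2 * n))) (hu₄ : u₄ = -(k ^ 4 / 2))
    (hw₀ : w₀ = τ * (w.a₀ + w.a₁ * n + w.a₂ * n ^ 2 + w.a₃ * u₀))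
    (hw₁ : w₁ = τ * (k * (w.a₁ + 2 * w.a₂ * n) + w.a₃ * u₁))
    (hw₂ : w₂ = τ * (w.a₂ * k ^ 2 + w.a₃ * u₂))
    (hw₃ : w₃ = τ * (w.a₃ * u₃)) (hw₄ : w₄ = τ * (w.a₃ * u₄))
    (hσ : 0 < σ) (hs : σ ≤ s₀ - |s₁|)
    (hq : σ ^ 2 + |-u₃ - 2 * u₄ * t₀| ≤ -u₂ - u₄ + u₄ * t₀ ^ 2)
    (hη0 : 0 ≤ η) (hr : |u₀ + u₂ + u₄| + |u₁ + u₃| ≤ η ^ 2) (hl : 0 < l)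
    (hM : |w₀| + |w₁| + |w₂| + |w₃| + |w₄| ≤ M)
    (hmain : 2 * M * η < 3 * (w₀ * s₀ / 2 + (w₁ * s₁ + w₂ * s₀) / 8 + (w₃ * s₁ + w₄ * s₀) / 16 -
      (l * (w₀ ^ 2 / 2 + (2 * w₀ * w₂ + w₁ ^ 2) / 8 + (2 * w₀ * w₄ + 2 * w₁ * w₃ + w₂ ^ 2) / 16 +
        5 / 128 * (2 * w₂ * w₄ + w₃ ^ 2) + 7 / 256 * w₄ ^ 2) +
       ((-u₂ - u₄ - s₀ ^ 2) ^ 2 / 2 + (2 * (-u₂ - u₄ - s₀ ^ 2) * (-u₄ - s₁ ^ 2) +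
        (-u₃ - 2 * s₀ * s₁) ^ 2) / 8 + (-u₄ - s₁ ^ 2) ^ 2 / 16) / l) / (4 * σ))) :
    0 < τ * ∫ x in (m - k)..(m + k), w.pert (x, w.height h x) := by
  have hu₄0 : 0 ≤ -u₄ := by
    rw [hu₄, neg_neg]
    positivity
  have hpos := integral_mul_sqrt_mul_sin_pos hσ hs
    (le_quadratic (t₀ := t₀) hu₄0 (by convert hq using 1 <;> ring_nf)) hη0 hr hl hM hmain
  set F : ℝ → ℝ := fun x => w.pert (x, w.height h x) with hF
  have hFc : Continuous F := IsLevel.continuous_pert_height w h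
  have hX : ∀ φ : ℝ, HasDerivAt (fun φ => m + k * Real.cos φ) (k * -Real.sin φ) φ := fun φ =>
    ((Real.hasDerivAt_cos φ).const_mul k).const_add m
  have hsub := intervalIntegral.integral_comp_mul_deriv (a := 0) (b := Real.pi) (fun φ _ => hX φ)
    (by fun_prop) hFc
  rw [Real.cos_zero, Real.cos_pi, mul_one, mul_neg_one, ← sub_eq_add_neg] at hsub
  rw [intervalIntegral.integral_symm, ← hsub, ← intervalIntegral.integral_neg,
    ← intervalIntegral.integral_const_mul]
  refine (mul_pos hk hpos).trans_eq ?_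
  rw [← intervalIntegral.integral_const_mul]
  refine intervalIntegral.integral_congr fun φ _ => ?_
  have hsq := Real.sin_sq φ
  set t := Real.cos φ
  -- Division of the quartic by `1 - t² = sin² φ`. The linear remainder vanishes exactly when `m ±
  -- k` are roots, and is small here because they nearly are.
  have hU : 2 * (h - w.energy (m + k * t, 0)) =
      Real.sin φ ^ 2 * (-u₂ - u₄ + -u₃ * t + -u₄ * t ^ 2) + (u₀ + u₂ + u₄ + (u₁ + u₃) * t) := by
    rw [hsq, hu₀, hu₁, hu₂, hu₃, hu₄, hn]
    simp only [energy, stiffness]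
    ring
  have hy : w.height h (m + k * t) = √(Real.sin φ ^ 2 * (-u₂ - u₄ + -u₃ * t + -u₄ * t ^ 2) +
      (u₀ + u₂ + u₄ + (u₁ + u₃) * t)) := by
    rw [height, hU]
  have hpert : F (m + k * t) = w.height h (m + k * t) * (w.a₀ + w.a₁ * (m + k * t - w.c) +
      w.a₂ * (m + k * t - w.c) ^ 2 + w.a₃ * (2 * (h - w.energy (m + k * t, 0)))) := by
    simp only [hF, pert]
    rcases le_total 0 (2 * (h - w.energy (m + k * t, 0))) with h0 | h0
    · rw [show w.height h (m + k * t) ^ 2 = _ from Real.sq_sqrt h0]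
    · rw [show w.height h (m + k * t) = 0 from Real.sqrt_eq_zero_of_nonpos h0]
      ring
  simp only [Function.comp_apply]
  rw [hpert, ← hy, hU, hsq, hw₀, hw₁, hw₂, hw₃, hw₄, hn]
  ring

variable {A B e₁ e₂ e₃ : ℝ}

/-- Two limit cycles between three ovals on which the Abelian integral takes alternating signs. -/
theorem exists_two_limitCycles (l₁ : w.IsLevel A B e₁) (l₂ : w.IsLevel A B e₂)
    (l₃ : w.IsLevel A B e₃) (h₁₂ : e₁ < e₂) (h₂₃ : e₂ < e₃)
    (hI₁ : 0 < ∫ θ in (0 : ℝ)..2 * Real.pi, w.energyRate 0 θ (l₁.radius θ))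
    (hI₂ : ∫ θ in (0 : ℝ)..2 * Real.pi, w.energyRate 0 θ (l₂.radius θ) < 0)
    (hI₃ : 0 < ∫ θ in (0 : ℝ)..2 * Real.pi, w.energyRate 0 θ (l₃.radius θ)) :
    ∃ ε₀ > 0, ∀ ε, ε ≠ 0 → |ε| < ε₀ →
      ∃ L₁ ⊆ w.annulus A B e₁ e₂, ∃ L₂ ⊆ w.annulus A B e₂ e₃,
        IsLimitCycle (w.field ε) L₁ ∧ IsLimitCycle (w.field ε) L₂ ∧
        (0 < ε → IsAttracting (w.field ε) L₁ ∧ IsRepelling (w.field ε) L₂) ∧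
        (ε < 0 → IsRepelling (w.field ε) L₁ ∧ IsAttracting (w.field ε) L₂) := by
  -- The sign pattern is `+` then `-` on the inner pair and `-` then `+` on the outer pair, whence
  -- the opposite `σ` and opposite stability.
  obtain ⟨ε₁, hε₁, H₁⟩ := exists_limitCycle (σ := 1) l₁ l₂ h₁₂ (by norm_num) (by linarith)
    (by linarith)
  obtain ⟨ε₂, hε₂, H₂⟩ := exists_limitCycle (σ := -1) l₂ l₃ h₂₃ (by norm_num) (by linarith)
    (by linarith)
  refine ⟨min ε₁ ε₂, lt_min hε₁ hε₂, fun ε hne hε => ?_⟩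
  obtain ⟨L₁, hL₁, hc₁, hp₁, hn₁⟩ := H₁ ε hne (hε.trans_le (min_le_left _ _))
  obtain ⟨L₂, hL₂, hc₂, hp₂, hn₂⟩ := H₂ ε hne (hε.trans_le (min_le_right _ _))
  exact ⟨L₁, hL₁, L₂, hL₂, hc₁, hc₂, fun h => ⟨hp₁ (by linarith), hn₂ (by linarith)⟩,
    fun h => ⟨hn₁ (by linarith), hp₂ (by linarith)⟩⟩

end Well

/-! ### The two eyes of the concrete system -/

/-- The well of the Hamiltonian at the equilibrium `(c, 0)`. -/
def wellAt (lam c α β γ δ : ℝ) : Well where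
  c := c
  k₀ := 3 * c ^ 2 + 2 * (1 - lam) * c - lam
  k₁ := 3 * c + (1 - lam)
  a₀ := α + β * c + γ * c ^ 2
  a₁ := β + 2 * γ * c
  a₂ := γ
  a₃ := δ / 3

section WellAt

variable {lam c α β γ δ : ℝ}

theorem perturbation_eq_pert : perturbation α β γ δ = (wellAt lam c α β γ δ).pert := by
  ext p
  simp only [perturbation, Well.pert, wellAt]
  ring

theorem perturbedField_eq_field (hc : c ^ 3 + (1 - lam) * c ^ 2 - lam * c = 0) (ε : ℝ) :
    perturbedField lam α β γ δ ε = (wellAt lam c α β γ δ).field ε := by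
  ext p
  · simp [perturbedField, hamiltonianField, Well.field]
  · simp only [perturbedField, hamiltonianField, Well.field, Prod.snd_add, Prod.smul_snd,
      smul_eq_mul, ← perturbation_eq_pert]
    simp only [Well.stiffness, wellAt]
    linear_combination hc

theorem hamiltonianField_eq_field (hc : c ^ 3 + (1 - lam) * c ^ 2 - lam * c = 0) :
    hamiltonianField lam = (wellAt lam c α β γ δ).field 0 := by
  rw [← perturbedField_eq_field hc]
  ext p <;> simp [perturbedField]

theorem hamiltonian_eq_energy_add (hc : c ^ 3 + (1 - lam) * c ^ 2 - lam * c = 0) (p : ℝ × ℝ) :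
    hamiltonian lam p = (wellAt lam c α β γ δ).energy p + hamiltonian lam (c, 0) := by
  simp only [hamiltonian, Well.energy, wellAt]
  linear_combination (p.1 - c) * hc

end WellAt

theorem Well.IsLevel.mul_integral_energyRate_pos {w : Well} {A B h a b τ : ℝ}
    (hl : w.IsLevel A B h) (hI : 0 < τ * ∫ x in a..b, w.pert (x, w.height h x))
    (ha : a ∈ Icc (w.c + A) w.c) (hb : b ∈ Icc w.c (w.c + B)) (hea : h ≤ w.energy (a, 0))
    (heb : h ≤ w.energy (b, 0)) :
    0 < τ * ∫ θ in (0 : ℝ)..2 * Real.pi, w.energyRate 0 θ (hl.radius θ) := by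
  rw [hl.integral_energyRate ha hb hea heb]
  linarith

/-- The well at the equilibrium `(c, 0)`, for the concrete system. -/
def eye (c : ℝ) : Well := wellAt 0.95 c 438.4905 (-25.2469) (-452.7899) (-741.0341)

/-- The strip is `-3/2 < x < -1/10`. It avoids the other two equilibria, so the stiffness is
positive, and `H` exceeds `-0.01` at both ends of its axis. -/
theorem isLevel_left {h : ℝ} (h₁ : hamiltonian 0.95 (-1, 0) < h) (h₂ : h < -0.01) :
    (eye (-1)).IsLevel (-1 / 2) (9 / 10) (h - hamiltonian 0.95 (-1, 0)) where
  left_neg := by norm_num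
  right_pos := by norm_num
  stiffness_pos u hu := by
    simp only [eye, wellAt, Well.stiffness]
    nlinarith [hu.1, hu.2]
  pos := sub_pos.2 h₁
  lt_left := by
    norm_num [eye, wellAt, Well.energy, hamiltonian]
    linarith
  lt_right := by
    norm_num [eye, wellAt, Well.energy, hamiltonian]
    linarith

/-- The strip is `1/10 < x < 3/2`, chosen as in the left eye. -/
theorem isLevel_right {h : ℝ} (h₁ : hamiltonian 0.95 (0.95, 0) < h) (h₂ : h < -0.01) :
    (eye 0.95).IsLevel (-17 / 20) (11 / 20) (h - hamiltonian 0.95 (0.95, 0)) where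
  left_neg := by norm_num
  right_pos := by norm_num
  stiffness_pos u hu := by
    simp only [eye, wellAt, Well.stiffness]
    nlinarith [hu.1, hu.2]
  pos := sub_pos.2 h₁
  lt_left := by
    norm_num [eye, wellAt, Well.energy, hamiltonian]
    linarith
  lt_right := by
    norm_num [eye, wellAt, Well.energy, hamiltonian]
    linarith

/-- In this and the five analogous lemmas `m ± k` are decimal approximations, rounded outwards, of
the ends of the oval on the axis; `s₀ + s₁ t` approximates `√q` and `σ` bounds both from below; `t₀`
is the end at which `s₀ + s₁ t` is smallest; `η²` bounds the remainder of the division, `M` the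
coefficients of the weight, and `l` is the weight in Young's inequality. -/
theorem integral_left_inner_pos (hl : (eye (-1)).IsLevel (-1 / 2) (9 / 10)
    (-0.1933 - hamiltonian 0.95 (-1, 0))) :
    0 < ∫ θ in (0 : ℝ)..2 * Real.pi, (eye (-1)).energyRate 0 θ (hl.radius θ) := by
  rw [← one_mul (∫ θ in (0 : ℝ)..2 * Real.pi, _)]
  refine hl.mul_integral_energyRate_pos (Well.integral_pert_height_pos (m := -0.9732248)
    (k := 0.2288929) (s₀ := 0.309) (s₁ := -0.037) (σ := 0.271) (t₀ := 1) (η := 0.00026) (M := 219)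
    (l := 0.0000011) ?_ rfl rfl rfl rfl rfl rfl rfl rfl rfl rfl rfl ?_ ?_ ?_ ?_ ?_ ?_ ?_ ?_)
    ?_ ?_ ?_ ?_ <;> norm_num [eye, wellAt, Well.stiffness, Well.energy, hamiltonian]

theorem integral_left_middle_neg (hl : (eye (-1)).IsLevel (-1 / 2) (9 / 10)
    (-0.0846 - hamiltonian 0.95 (-1, 0))) :
    ∫ θ in (0 : ℝ)..2 * Real.pi, (eye (-1)).energyRate 0 θ (hl.radius θ) < 0 := by
  rw [← neg_pos, ← neg_one_mul]
  refine hl.mul_integral_energyRate_pos (Well.integral_pert_height_pos (m := -0.8919902)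
    (k := 0.4502679) (s₀ := 0.541) (s₁ := -0.148) (σ := 0.393) (t₀ := 1) (η := 0.00022) (M := 489)
    (l := 0.0000046) ?_ rfl rfl rfl rfl rfl rfl rfl rfl rfl rfl rfl ?_ ?_ ?_ ?_ ?_ ?_ ?_ ?_)
    ?_ ?_ ?_ ?_ <;> norm_num [eye, wellAt, Well.stiffness, Well.energy, hamiltonian]

theorem integral_left_outer_pos (hl : (eye (-1)).IsLevel (-1 / 2) (9 / 10)
    (-0.0121 - hamiltonian 0.95 (-1, 0))) :
    0 < ∫ θ in (0 : ℝ)..2 * Real.pi, (eye (-1)).energyRate 0 θ (hl.radius θ) := by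
  rw [← one_mul (∫ θ in (0 : ℝ)..2 * Real.pi, _)]
  refine hl.mul_integral_energyRate_pos (Well.integral_pert_height_pos (m := -0.7817182)
    (k := 0.62148) (s₀ := 0.615) (s₁ := -0.299) (σ := 0.304) (t₀ := 1) (η := 0.00029) (M := 809)
    (l := 0.000021) ?_ rfl rfl rfl rfl rfl rfl rfl rfl rfl rfl rfl ?_ ?_ ?_ ?_ ?_ ?_ ?_ ?_)
    ?_ ?_ ?_ ?_ <;> norm_num [eye, wellAt, Well.stiffness, Well.energy, hamiltonian]

theorem integral_right_inner_pos (hl : (eye 0.95).IsLevel (-17 / 20) (11 / 20)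
    (-0.1686 - hamiltonian 0.95 (0.95, 0))) :
    0 < ∫ θ in (0 : ℝ)..2 * Real.pi, (eye 0.95).energyRate 0 θ (hl.radius θ) := by
  rw [← one_mul (∫ θ in (0 : ℝ)..2 * Real.pi, _)]
  refine hl.mul_integral_energyRate_pos (Well.integral_pert_height_pos (m := 0.9245833)
    (k := 0.2192041) (s₀ := 0.288) (s₁ := 0.034) (σ := 0.253) (t₀ := -1) (η := 0.00021) (M := 209)
    (l := 0.0000027) ?_ rfl rfl rfl rfl rfl rfl rfl rfl rfl rfl rfl ?_ ?_ ?_ ?_ ?_ ?_ ?_ ?_)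
    ?_ ?_ ?_ ?_ <;> norm_num [eye, wellAt, Well.stiffness, Well.energy, hamiltonian]

theorem integral_right_middle_neg (hl : (eye 0.95).IsLevel (-17 / 20) (11 / 20)
    (-0.0738 - hamiltonian 0.95 (0.95, 0))) :
    ∫ θ in (0 : ℝ)..2 * Real.pi, (eye 0.95).energyRate 0 θ (hl.radius θ) < 0 := by
  rw [← neg_pos, ← neg_one_mul]
  refine hl.mul_integral_energyRate_pos (Well.integral_pert_height_pos (m := 0.8476191)
    (k := 0.4307125) (s₀ := 0.506) (s₁ := 0.137) (σ := 0.368) (t₀ := -1) (η := 0.0004) (M := 468)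
    (l := 0.0000027) ?_ rfl rfl rfl rfl rfl rfl rfl rfl rfl rfl rfl ?_ ?_ ?_ ?_ ?_ ?_ ?_ ?_)
    ?_ ?_ ?_ ?_ <;> norm_num [eye, wellAt, Well.stiffness, Well.energy, hamiltonian]

theorem integral_right_outer_pos (hl : (eye 0.95).IsLevel (-17 / 20) (11 / 20)
    (-0.0105 - hamiltonian 0.95 (0.95, 0))) :
    0 < ∫ θ in (0 : ℝ)..2 * Real.pi, (eye 0.95).energyRate 0 θ (hl.radius θ) := by
  rw [← one_mul (∫ θ in (0 : ℝ)..2 * Real.pi, _)]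
  refine hl.mul_integral_energyRate_pos (Well.integral_pert_height_pos (m := 0.74344645)
    (k := 0.59348045) (s₀ := 0.575) (s₁ := 0.276) (σ := 0.286) (t₀ := -1) (η := 0.00039) (M := 765)
    (l := 0.000021) ?_ rfl rfl rfl rfl rfl rfl rfl rfl rfl rfl rfl ?_ ?_ ?_ ?_ ?_ ?_ ?_ ?_)
    ?_ ?_ ?_ ?_ <;> norm_num [eye, wellAt, Well.stiffness, Well.energy, hamiltonian]

/-- The sublevel sets below the energy of the loop are bounded and avoid the saddle. -/
theorem lt_abs_and_abs_lt_of_hamiltonian_lt {p : ℝ × ℝ} (h : hamiltonian 0.95 p < -0.01) :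
    1 / 10 < |p.1| ∧ |p.1| < 3 / 2 := by
  obtain ⟨x, y⟩ := p
  -- Dropping `y² / 2` leaves the potential, with its double zero at the saddle factored out.
  have hV : x ^ 2 * (x ^ 2 / 4 + x / 60 - 19 / 40) < -0.01 := by
    simp only [hamiltonian] at h
    nlinarith [sq_nonneg y]
  have hneg : x ^ 2 / 4 + x / 60 - 19 / 40 < 0 := by
    by_contra hge
    have := mul_nonneg (sq_nonneg x) (not_lt.1 hge)
    linarith
  simp only
  constructor
  · by_contra hle
    have h1 := abs_le.1 (not_lt.1 hle)
    have h2 : x ^ 2 ≤ 1 / 100 := by nlinarith [h1.1, h1.2]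
    nlinarith [sq_nonneg x, mul_nonneg (sq_nonneg x) (sq_nonneg x)]
  · rw [abs_lt]
    constructor <;> nlinarith

section Eyes

variable {h e f : ℝ}

theorem left_equilibrium : (-1 : ℝ) ^ 3 + (1 - 0.95) * (-1) ^ 2 - 0.95 * -1 = 0 := by norm_num

theorem right_equilibrium : (0.95 : ℝ) ^ 3 + (1 - 0.95) * 0.95 ^ 2 - 0.95 * 0.95 = 0 := by norm_num

theorem sub_mem_Ioo_left_iff {p : ℝ × ℝ} (h : hamiltonian 0.95 p < -0.01) :
    p.1 - (eye (-1)).c ∈ Ioo (-1 / 2) (9 / 10) ↔ p.1 < 0 := by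
  obtain ⟨h1, h2⟩ := lt_abs_and_abs_lt_of_hamiltonian_lt h
  simp only [eye, wellAt, mem_Ioo]
  refine ⟨fun hp => by linarith [hp.2], fun hp => ?_⟩
  rw [abs_of_neg hp] at h1 h2
  constructor <;> linarith

theorem sub_mem_Ioo_right_iff {p : ℝ × ℝ} (h : hamiltonian 0.95 p < -0.01) :
    p.1 - (eye 0.95).c ∈ Ioo (-17 / 20) (11 / 20) ↔ 0 < p.1 := by
  obtain ⟨h1, h2⟩ := lt_abs_and_abs_lt_of_hamiltonian_lt h
  simp only [eye, wellAt, mem_Ioo]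
  refine ⟨fun hp => by linarith [hp.1], fun hp => ?_⟩
  rw [abs_of_pos hp] at h1 h2
  constructor <;> linarith

theorem hamiltonian_left (p : ℝ × ℝ) :
    hamiltonian 0.95 p = (eye (-1)).energy p + hamiltonian 0.95 (-1, 0) :=
  hamiltonian_eq_energy_add left_equilibrium p

theorem hamiltonian_right (p : ℝ × ℝ) :
    hamiltonian 0.95 p = (eye 0.95).energy p + hamiltonian 0.95 (0.95, 0) :=
  hamiltonian_eq_energy_add right_equilibrium p

theorem leftOval_eq (hh : h < -0.01) :
    leftOval 0.95 h = {p | p.1 - (eye (-1)).c ∈ Ioo (-1 / 2) (9 / 10) ∧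
      (eye (-1)).energy p = h - hamiltonian 0.95 (-1, 0)} := by
  ext p
  simp only [leftOval, mem_ofPred_eq, eq_sub_iff_add_eq, ← hamiltonian_left]
  exact and_congr_left fun hp => (sub_mem_Ioo_left_iff (hp ▸ hh)).symm

theorem rightOval_eq (hh : h < -0.01) :
    rightOval 0.95 h = {p | p.1 - (eye 0.95).c ∈ Ioo (-17 / 20) (11 / 20) ∧
      (eye 0.95).energy p = h - hamiltonian 0.95 (0.95, 0)} := by
  ext p
  simp only [rightOval, mem_ofPred_eq, eq_sub_iff_add_eq, ← hamiltonian_right]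
  exact and_congr_left fun hp => (sub_mem_Ioo_right_iff (hp ▸ hh)).symm

theorem annulus_subset_leftAnnulus (hf : f < -0.01) :
    (eye (-1)).annulus (-1 / 2) (9 / 10) (e - hamiltonian 0.95 (-1, 0))
      (f - hamiltonian 0.95 (-1, 0)) ⊆ leftAnnulus 0.95 e f := by
  rintro p ⟨hp, he, hf'⟩
  have := hamiltonian_left p
  refine ⟨(sub_mem_Ioo_left_iff (by linarith)).1 hp, by linarith, by linarith⟩

theorem annulus_subset_rightAnnulus (hf : f < -0.01) :
    (eye 0.95).annulus (-17 / 20) (11 / 20) (e - hamiltonian 0.95 (0.95, 0))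
      (f - hamiltonian 0.95 (0.95, 0)) ⊆ rightAnnulus 0.95 e f := by
  rintro p ⟨hp, he, hf'⟩
  have := hamiltonian_right p
  refine ⟨(sub_mem_Ioo_right_iff (by linarith)).1 hp, by linarith, by linarith⟩

theorem isAbelianIntegral_left (hh : h < -0.01)
    (hl : (eye (-1)).IsLevel (-1 / 2) (9 / 10) (h - hamiltonian 0.95 (-1, 0))) :
    IsAbelianIntegral (hamiltonianField 0.95) 0
      (perturbation 438.4905 (-25.2469) (-452.7899) (-741.0341)) (leftOval 0.95 h)
      (∫ θ in (0 : ℝ)..2 * Real.pi, (eye (-1)).energyRate 0 θ (hl.radius θ)) := by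
  rw [leftOval_eq hh, perturbation_eq_pert (lam := 0.95) (c := -1),
    hamiltonianField_eq_field left_equilibrium]
  exact hl.isAbelianIntegral

theorem isAbelianIntegral_right (hh : h < -0.01)
    (hl : (eye 0.95).IsLevel (-17 / 20) (11 / 20) (h - hamiltonian 0.95 (0.95, 0))) :
    IsAbelianIntegral (hamiltonianField 0.95) 0
      (perturbation 438.4905 (-25.2469) (-452.7899) (-741.0341)) (rightOval 0.95 h)
      (∫ θ in (0 : ℝ)..2 * Real.pi, (eye 0.95).energyRate 0 θ (hl.radius θ)) := by
  rw [rightOval_eq hh, perturbation_eq_pert (lam := 0.95) (c := 0.95),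
    hamiltonianField_eq_field right_equilibrium]
  exact hl.isAbelianIntegral

end Eyes

end

end FigureEight

theorem mainTheorem1 (lam α β γ δ : ℝ) (hlam : lam = 0.95) (hα : α = 438.4905)
    (hβ : β = -25.2469) (hγ : γ = -452.7899) (hδ : δ = -741.0341) :
    -- signs of the Abelian integral on three ovals in the left eye
    (∃ I, FigureEight.IsAbelianIntegral (FigureEight.hamiltonianField lam) 0
      (FigureEight.perturbation α β γ δ) (FigureEight.leftOval lam (-0.0121)) I ∧ 0 < I) ∧
    (∃ I, FigureEight.IsAbelianIntegral (FigureEight.hamiltonianField lam) 0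
      (FigureEight.perturbation α β γ δ) (FigureEight.leftOval lam (-0.0846)) I ∧ I < 0) ∧
    (∃ I, FigureEight.IsAbelianIntegral (FigureEight.hamiltonianField lam) 0
      (FigureEight.perturbation α β γ δ) (FigureEight.leftOval lam (-0.1933)) I ∧ 0 < I) ∧
    -- signs of the Abelian integral on three ovals in the right eye
    (∃ I, FigureEight.IsAbelianIntegral (FigureEight.hamiltonianField lam) 0
      (FigureEight.perturbation α β γ δ) (FigureEight.rightOval lam (-0.0105)) I ∧ 0 < I) ∧
    (∃ I, FigureEight.IsAbelianIntegral (FigureEight.hamiltonianField lam) 0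
      (FigureEight.perturbation α β γ δ) (FigureEight.rightOval lam (-0.0738)) I ∧ I < 0) ∧
    (∃ I, FigureEight.IsAbelianIntegral (FigureEight.hamiltonianField lam) 0
      (FigureEight.perturbation α β γ δ) (FigureEight.rightOval lam (-0.1686)) I ∧ 0 < I) ∧
    -- four limit cycles, in pairwise disjoint annuli between these ovals
    (∃ ε₀ : ℝ, 0 < ε₀ ∧ ∀ ε : ℝ, ε ≠ 0 → |ε| < ε₀ →
      ∃ L₁ L₂ R₁ R₂ : Set (ℝ × ℝ),
        (FigureEight.IsLimitCycle (FigureEight.perturbedField lam α β γ δ ε) L₁ ∧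
          L₁ ⊆ FigureEight.leftAnnulus lam (-0.1933) (-0.0846)) ∧
        (FigureEight.IsLimitCycle (FigureEight.perturbedField lam α β γ δ ε) L₂ ∧
          L₂ ⊆ FigureEight.leftAnnulus lam (-0.0846) (-0.0121)) ∧
        (FigureEight.IsLimitCycle (FigureEight.perturbedField lam α β γ δ ε) R₁ ∧
          R₁ ⊆ FigureEight.rightAnnulus lam (-0.1686) (-0.0738)) ∧
        (FigureEight.IsLimitCycle (FigureEight.perturbedField lam α β γ δ ε) R₂ ∧
          R₂ ⊆ FigureEight.rightAnnulus lam (-0.0738) (-0.0105)) ∧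
        (0 < ε →
          FigureEight.IsAttracting (FigureEight.perturbedField lam α β γ δ ε) L₁ ∧
          FigureEight.IsRepelling (FigureEight.perturbedField lam α β γ δ ε) L₂ ∧
          FigureEight.IsAttracting (FigureEight.perturbedField lam α β γ δ ε) R₁ ∧
          FigureEight.IsRepelling (FigureEight.perturbedField lam α β γ δ ε) R₂) ∧
        (ε < 0 →
          FigureEight.IsRepelling (FigureEight.perturbedField lam α β γ δ ε) L₁ ∧
          FigureEight.IsAttracting (FigureEight.perturbedField lam α β γ δ ε) L₂ ∧
          FigureEight.IsRepelling (FigureEight.perturbedField lam α β γ δ ε) R₁ ∧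
          FigureEight.IsAttracting (FigureEight.perturbedField lam α β γ δ ε) R₂)) := by
  subst hlam hα hβ hγ hδ
  have l₁ := FigureEight.isLevel_left (h := -0.1933) (by norm_num [FigureEight.hamiltonian])
    (by norm_num)
  have l₂ := FigureEight.isLevel_left (h := -0.0846) (by norm_num [FigureEight.hamiltonian])
    (by norm_num)
  have l₃ := FigureEight.isLevel_left (h := -0.0121) (by norm_num [FigureEight.hamiltonian])
    (by norm_num)
  have r₁ := FigureEight.isLevel_right (h := -0.1686) (by norm_num [FigureEight.hamiltonian])
    (by norm_num)
  have r₂ := FigureEight.isLevel_right (h := -0.0738) (by norm_num [FigureEight.hamiltonian])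
    (by norm_num)
  have r₃ := FigureEight.isLevel_right (h := -0.0105) (by norm_num [FigureEight.hamiltonian])
    (by norm_num)
  refine ⟨⟨_, FigureEight.isAbelianIntegral_left (by norm_num) l₃,
      FigureEight.integral_left_outer_pos l₃⟩,
    ⟨_, FigureEight.isAbelianIntegral_left (by norm_num) l₂,
      FigureEight.integral_left_middle_neg l₂⟩,
    ⟨_, FigureEight.isAbelianIntegral_left (by norm_num) l₁,
      FigureEight.integral_left_inner_pos l₁⟩,
    ⟨_, FigureEight.isAbelianIntegral_right (by norm_num) r₃,
      FigureEight.integral_right_outer_pos r₃⟩,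
    ⟨_, FigureEight.isAbelianIntegral_right (by norm_num) r₂,
      FigureEight.integral_right_middle_neg r₂⟩,
    ⟨_, FigureEight.isAbelianIntegral_right (by norm_num) r₁,
      FigureEight.integral_right_inner_pos r₁⟩, ?_⟩
  obtain ⟨ε₁, hε₁, hL⟩ := FigureEight.Well.exists_two_limitCycles l₁ l₂ l₃ (by norm_num)
    (by norm_num) (FigureEight.integral_left_inner_pos l₁)
    (FigureEight.integral_left_middle_neg l₂) (FigureEight.integral_left_outer_pos l₃)
  obtain ⟨ε₂, hε₂, hR⟩ := FigureEight.Well.exists_two_limitCycles r₁ r₂ r₃ (by norm_num)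
    (by norm_num) (FigureEight.integral_right_inner_pos r₁)
    (FigureEight.integral_right_middle_neg r₂) (FigureEight.integral_right_outer_pos r₃)
  refine ⟨min ε₁ ε₂, lt_min hε₁ hε₂, fun ε hne hε => ?_⟩
  obtain ⟨L₁, hL₁, L₂, hL₂, hLc₁, hLc₂, hLp, hLn⟩ := hL ε hne (hε.trans_le (min_le_left _ _))
  obtain ⟨R₁, hR₁, R₂, hR₂, hRc₁, hRc₂, hRp, hRn⟩ := hR ε hne (hε.trans_le (min_le_right _ _))
  -- Both recentred wells give the same planar field, so the two pairs of cycles belong to one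
  -- system.
  have hl := FigureEight.perturbedField_eq_field (α := 438.4905) (β := -25.2469) (γ := -452.7899)
    (δ := -741.0341) FigureEight.left_equilibrium ε
  have hr := FigureEight.perturbedField_eq_field (α := 438.4905) (β := -25.2469) (γ := -452.7899)
    (δ := -741.0341) FigureEight.right_equilibrium ε
  rw [FigureEight.eye, ← hl] at hLc₁ hLc₂ hLp hLn
  rw [FigureEight.eye, ← hr] at hRc₁ hRc₂ hRp hRn
  exact ⟨L₁, L₂, R₁, R₂,
    ⟨hLc₁, hL₁.trans (FigureEight.annulus_subset_leftAnnulus (by norm_num))⟩,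
    ⟨hLc₂, hL₂.trans (FigureEight.annulus_subset_leftAnnulus (by norm_num))⟩,
    ⟨hRc₁, hR₁.trans (FigureEight.annulus_subset_rightAnnulus (by norm_num))⟩,
    ⟨hRc₂, hR₂.trans (FigureEight.annulus_subset_rightAnnulus (by norm_num))⟩,
    fun h => ⟨(hLp h).1, (hLp h).2, (hRp h).1, (hRp h).2⟩,
    fun h => ⟨(hLn h).1, (hLn h).2, (hRn h).1, (hRn h).2⟩⟩
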